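/- **Setting.** Let $\mathcal X,\mathcal Y,\mathcal Z$ be Borel subsets of finite-dimensional real normed spaces, $p\in[1,\infty)$, $\epsilon>0$, $\rho\ge 0$, and let $\widehat{\mathbb P}$ be a probability measure on $\mathcal X\times\mathcal Y$ with $\mathcal X$-marginal $\widehat{\mathbb P}_{\widehat X}$ and regular conditional distribution $\widehat{\mathbb P}_{\widehat Y|\widehat X}$. Let $f:\mathcal X\to\mathcal Z$ and $\Psi:\mathcal Z\times\mathcal Y\to\mathbb R\cup\{\infty\}$ be measurable with $\Psi$ bounded below, and let $\nu_{\mathcal X},\nu_{\mathcal Y}$ be measures on $\mathcal X,\mathcal Y$ such that $\int e^{-\delta\|u\|^p}d\nu_{\mathcal X}(u)<\infty$ and $\int e^{-\delta\|u\|^p}d\nu_{\mathcal Y}(u)<\infty$ for every $\delta>0$. Put $c_p((\hat x,\hat y),(x,y))=\|x-\hat x\|^p+\|y-\hat y\|^p$. For a probability measure $\mathbb P$ on $\mathcal X\times\mathcal Y$ let $\Gamma_c(\widehat{\mathbb P},\mathbb P)$ be the set of couplings $\gamma$ of $\widehat{\mathbb P}$ and $\mathbb P$ such that, for $((\widehat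 X,\widehat Y),(X,Y))\sim\gamma$, $X$ is conditionally independent of $\widehat Y$ given $\widehat X$, and let $$R_p(\widehat{\mathbb P},\mathbb P)^p=\inf_{\gamma\in\Gamma_c(\widehat{\mathbb P},\mathbb P)}\mathbb E_\gamma\Big[c_p+\epsilon\log\frac{d\gamma}{d(\widehat{\mathbb P}\otimes\nu_{\mathcal X}\otimes\nu_{\mathcal Y})}\Big],$$ the expectation being $+\infty$ if $\gamma$ has no density. The primal problem is $v_{\mathrm P}=\sup\{\mathbb E_{\mathbb P}[\Psi(f(x),y)]: R_p(\widehat{\mathbb P},\mathbb P)^p\le\rho^p\}$. The dual problem is $$v_{\mathrm D}=\inf_{\lambda\ge0}\Big\{\lambda\rho^p+\mathbb E_{\hat x\sim\widehat{\mathbb P}_{\widehat X}}\Big[\lambda\epsilon\log\int_{\mathcal X}\exp\Big(\frac{g(\hat x,x,\lambda)}{\lambda\epsilon}\Big)d\nu_{\mathcal X}(x)\Big]\Big\},$$ $$g(\hat x,x,\lambda)=\mathbb E_{\hat y\sim\widehat{\mathbb P}_{\widehat Y|\widehat X=\hat x}}\Big[\lambda\epsilon\log\int_{\mathcal Y}\exp\Big(\frac{\Psi(f(x),y)-\lambda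 c_p((\hat x,\hat y),(x,y))}{\lambda\epsilon}\Big)d\nu_{\mathcal Y}(y)\Big],$$ where at $\lambda=0$ both log-integral-exp expressions are replaced by essential suprema. With $Z_{\mathcal X}(\hat x)=\int e^{-\|x-\hat x\|^p/\epsilon}d\nu_{\mathcal X}(x)$ and $Z_{\mathcal Y}(\hat y)=\int e^{-\|y-\hat y\|^p/\epsilon}d\nu_{\mathcal Y}(y)$, the adjusted radius is $$\bar\rho=\rho^p+\epsilon\,\mathbb E_{\widehat{\mathbb P}}[\log Z_{\mathcal X}(\hat x)]+\epsilon\,\mathbb E_{\widehat{\mathbb P}}[\log Z_{\mathcal Y}(\hat y)],$$ which is assumed to be well defined in $[-\infty,\infty]$. *Light-tail condition:* there is $\lambda>0$ such that $\int_{\mathcal Y}\exp\big(\frac{\Psi(f(x),y)}{\lambda\epsilon}\big)\,\frac{e^{-\|y-\hat y\|^p/\epsilon}}{Z_{\mathcal Y}(\hat y)}\,d\nu_{\mathcal Y}(y)<\infty$ for $\widehat{\mathbb P}\otimes\nu_{\mathcal X}$-almost every $((\hat x,\hat y),x)$. *Binding:* every primal optimal solution $\mathbb P^*$ satisfies $R_p(\widehat{\mathbb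 P},\mathbb P^*)^p=\rho^p$. **Theorem (Strong Duality).** 1. The primal problem is feasible if and only if $\bar\rho\ge0$. 2. If $0<\bar\rho<\infty$, then $v_{\mathrm P}=v_{\mathrm D}$. Moreover, if the light-tail condition holds and the constraint $R_p(\widehat{\mathbb P},\mathbb P)^p\le\rho^p$ is binding, then $v_{\mathrm P}=v_{\mathrm D}<\infty$; if the light-tail condition fails, then $v_{\mathrm P}=v_{\mathrm D}=\infty$. 3. If $\bar\rho=0$, then $v_{\mathrm P}=v_{\mathrm D}$ whenever $v_{\mathrm D}<\infty$, and $v_{\mathrm D}=\infty$ if the light-tail condition fails. -/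

import Mathlib

open MeasureTheory ProbabilityTheory
open scoped ENNReal

namespace CausalSDRO

/-- Expectation `E[F⁺] - E[F⁻]` of an extended-real function; it is `-∞` when both parts are
infinite. -/
noncomputable def eexp {Ω : Type*} [MeasurableSpace Ω] (μ : Measure Ω) (F : Ω → EReal) : EReal :=
  ((∫⁻ ω, (F ω).toENNReal ∂μ : ℝ≥0∞) : EReal) - ((∫⁻ ω, (-F ω).toENNReal ∂μ : ℝ≥0∞) : EReal)

/-- The log-integral-exp functional `τ log ∫ exp (h / τ) dν` for `τ ≠ 0`; for `τ = 0` it is its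
limiting value, the `ν`-essential supremum of `h`. -/
noncomputable def softSup {S : Type*} [MeasurableSpace S] (τ : ℝ) (ν : Measure S)
    (h : S → EReal) : EReal :=
  if τ = 0 then essSup h ν
  else (τ : EReal) * ENNReal.log (∫⁻ s, EReal.exp (h s / (τ : EReal)) ∂ν)

section Kernels

variable {E : Type*} [NormedAddCommGroup E] [MeasurableSpace E] {S : Set E}

/-- The unnormalized kernel density `u ↦ exp (-‖u - a‖ ^ p / ε)` centred at `a`. -/
noncomputable def kernelDensity (p ε : ℝ) (a u : S) : ℝ≥0∞ :=
  ENNReal.ofReal (Real.exp (-(‖(u : E) - (a : E)‖ ^ p) / ε))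

/-- The normalizing constant `∫ exp (-‖u - a‖ ^ p / ε) dν(u)`. -/
noncomputable def normalizer (p ε : ℝ) (ν : Measure S) (a : S) : ℝ≥0∞ :=
  ∫⁻ u, kernelDensity p ε a u ∂ν

/-- The kernel probability distribution centred at `a`, with density proportional to
`exp (-‖u - a‖ ^ p / ε)` with respect to `ν`. -/
noncomputable def smoothingKernel (p ε : ℝ) (ν : Measure S) (a : S) : Measure S :=
  (normalizer p ε ν a)⁻¹ • ν.withDensity (kernelDensity p ε a)

end Kernels

section Model

variable {E F G : Type*}
  [NormedAddCommGroup E] [MeasurableSpace E]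
  [NormedAddCommGroup F] [MeasurableSpace F]
  [MeasurableSpace G]
  {X : Set E} {Y : Set F} {Z : Set G}

/-- The transport cost `‖x - x̂‖ ^ p + ‖y - ŷ‖ ^ p` from `a = (x̂, ŷ)` to `b = (x, y)`. -/
noncomputable def transportCost (p : ℝ) (a b : X × Y) : ℝ :=
  ‖(b.1 : E) - (a.1 : E)‖ ^ p + ‖(b.2 : F) - (a.2 : F)‖ ^ p

/-- Causality of a joint law `γ` of `((X̂, Ŷ), (X, Y))`: `X` is conditionally independent of `Ŷ`
given `X̂`. -/
def IsCausal (γ : Measure ((X × Y) × (X × Y))) : Prop :=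
  ∀ A : Set X, MeasurableSet A → ∀ B : Set Y, MeasurableSet B →
    γ⟦{ω | ω.2.1 ∈ A} ∩ {ω | ω.1.2 ∈ B} |
        MeasurableSpace.comap (fun ω : (X × Y) × (X × Y) => ω.1.1) inferInstance⟧
      =ᵐ[γ] fun ω =>
        (γ⟦{ω | ω.2.1 ∈ A} |
          MeasurableSpace.comap (fun ω : (X × Y) × (X × Y) => ω.1.1) inferInstance⟧) ω *
        (γ⟦{ω | ω.1.2 ∈ B} |
          MeasurableSpace.comap (fun ω : (X × Y) × (X × Y) => ω.1.1) inferInstance⟧) ω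

/-- The set of causal transport plans from `P` to `Q`. -/
def causalPlans (P Q : Measure (X × Y)) : Set (Measure ((X × Y) × (X × Y))) :=
  {γ | γ.fst = P ∧ γ.snd = Q ∧ IsCausal γ}

open Classical in
/-- The entropy-regularized cost `E_γ [c + ε log (dγ / d(P ⊗ (νX ⊗ νY)))]` of a plan `γ`; it is
`+∞` when `γ` has no density, or when the expectation is undefined. -/
noncomputable def entropicCost (p ε : ℝ) (νX : Measure X) (νY : Measure Y) (P : Measure (X × Y))
    (γ : Measure ((X × Y) × (X × Y))) : EReal :=
  if γ ≪ P.prod (νX.prod νY) then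
    -eexp γ (fun ω =>
      ((-(transportCost p ω.1 ω.2 + ε * llr γ (P.prod (νX.prod νY)) ω) : ℝ) : EReal))
  else ⊤

/-- The `p`-th power of the causal Sinkhorn discrepancy between `P` and `Q`. -/
noncomputable def csdPow (p ε : ℝ) (νX : Measure X) (νY : Measure Y) (P Q : Measure (X × Y)) :
    EReal :=
  ⨅ γ ∈ causalPlans P Q, entropicCost p ε νX νY P γ

/-- Primal feasibility: `Q` is a probability measure in the causal Sinkhorn ball of radius `ρ`
around `P`. -/
def IsFeasible (p ε ρ : ℝ) (νX : Measure X) (νY : Measure Y) (P Q : Measure (X × Y)) : Prop :=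
  IsProbabilityMeasure Q ∧ csdPow p ε νX νY P Q ≤ ((ρ ^ p : ℝ) : EReal)

/-- The expected loss `E_{(x, y) ∼ Q} [Ψ (f x, y)]`. -/
noncomputable def expectedLoss (f : X → Z) (Ψ : Z × Y → EReal) (Q : Measure (X × Y)) : EReal :=
  eexp Q (fun b => Ψ (f b.1, b.2))

/-- The primal optimal value: the worst-case expected loss over the causal Sinkhorn ball. -/
noncomputable def primalValue (p ε ρ : ℝ) (νX : Measure X) (νY : Measure Y) (P : Measure (X × Y))
    (f : X → Z) (Ψ : Z × Y → EReal) : EReal :=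
  ⨆ Q ∈ {Q | IsFeasible p ε ρ νX νY P Q}, expectedLoss f Ψ Q

/-- The discrepancy constraint is binding: it holds with equality at every primal optimal
solution. -/
def IsBinding (p ε ρ : ℝ) (νX : Measure X) (νY : Measure Y) (P : Measure (X × Y))
    (f : X → Z) (Ψ : Z × Y → EReal) : Prop :=
  ∀ Q, IsFeasible p ε ρ νX νY P Q →
    expectedLoss f Ψ Q = primalValue p ε ρ νX νY P f Ψ →
      csdPow p ε νX νY P Q = ((ρ ^ p : ℝ) : EReal)

/-- The inner function `g (x̂, x, l)` of the dual; `κ` is the conditional law of `Ŷ` given `X̂`. -/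
noncomputable def dualInner (p ε : ℝ) (νY : Measure Y) (κ : Kernel X Y)
    (f : X → Z) (Ψ : Z × Y → EReal) (l : ℝ) (xh x : X) : EReal :=
  eexp (κ xh) (fun yh =>
    softSup (l * ε) νY (fun y =>
      Ψ (f x, y) - ((l * transportCost p (xh, yh) (x, y) : ℝ) : EReal)))

/-- The dual objective at the multiplier `l`. -/
noncomputable def dualObjective (p ε ρ : ℝ) (νX : Measure X) (νY : Measure Y)
    (P : Measure (X × Y)) (κ : Kernel X Y) (f : X → Z) (Ψ : Z × Y → EReal) (l : ℝ) : EReal :=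
  ((l * ρ ^ p : ℝ) : EReal) +
    eexp P.fst (fun xh => softSup (l * ε) νX (fun x => dualInner p ε νY κ f Ψ l xh x))

/-- The dual optimal value. -/
noncomputable def dualValue (p ε ρ : ℝ) (νX : Measure X) (νY : Measure Y)
    (P : Measure (X × Y)) (κ : Kernel X Y) (f : X → Z) (Ψ : Z × Y → EReal) : EReal :=
  ⨅ l ∈ Set.Ici (0 : ℝ), dualObjective p ε ρ νX νY P κ f Ψ l

/-- The adjusted radius
`ρ ^ p + ε E [log ∫ exp (-‖x - x̂‖ ^ p / ε) dνX(x)] + ε E [log ∫ exp (-‖y - ŷ‖ ^ p / ε) dνY(y)]`. -/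
noncomputable def adjustedRadius (p ε ρ : ℝ) (νX : Measure X) (νY : Measure Y)
    (P : Measure (X × Y)) : EReal :=
  ((ρ ^ p : ℝ) : EReal)
    + (ε : EReal) * eexp P.fst (fun xh => ENNReal.log (normalizer p ε νX xh))
    + (ε : EReal) * eexp P (fun a => ENNReal.log (normalizer p ε νY a.2))

/-- The adjusted radius is well defined in `[-∞, ∞]`: both expectations in it exist, and they are
not infinite with opposite signs. -/
def RadiusWellDefined (p ε : ℝ) (νX : Measure X) (νY : Measure Y) (P : Measure (X × Y)) : Prop :=
  (∫⁻ xh, (ENNReal.log (normalizer p ε νX xh)).toENNReal ∂P.fst < ⊤ ∧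
    ∫⁻ a, (ENNReal.log (normalizer p ε νY a.2)).toENNReal ∂P < ⊤) ∨
  (∫⁻ xh, (-ENNReal.log (normalizer p ε νX xh)).toENNReal ∂P.fst < ⊤ ∧
    ∫⁻ a, (-ENNReal.log (normalizer p ε νY a.2)).toENNReal ∂P < ⊤)

/-- The light-tail condition: for some `l > 0`, the expectation of `exp (Ψ (f x, y) / (l ε))` over
the kernel distribution of `y` centred at `ŷ` is finite for almost every `((x̂, ŷ), x)`. -/
def LightTail (p ε : ℝ) (νX : Measure X) (νY : Measure Y) (P : Measure (X × Y))
    (f : X → Z) (Ψ : Z × Y → EReal) : Prop :=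
  ∃ l : ℝ, 0 < l ∧ ∀ᵐ w ∂(P.prod νX),
    ∫⁻ y, EReal.exp (Ψ (f w.2, y) / ((l * ε : ℝ) : EReal))
      ∂(smoothingKernel p ε νY w.1.2) < ⊤

end Model

end CausalSDRO

namespace CausalSDRO

/-! Multiplying the product reference measure by `exp (-c / ε)` and normalizing in each variable
gives `smoothedPlan`, a probability law drawing `X` and `Y` independently from kernels centred at
`X̂` and `Ŷ`. This absorbs the transport cost: by `entropicCost_eq` the cost of a plan is `ε` times
its relative entropy to the smoothed plan, minus `ε` times the mean log-normalizers. Up to a slack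
for an infimum that need not be attained, the constraint is thus an entropy ball of radius `ρ̄ / ε`,
empty for negative radius and containing the smoothed plan otherwise. The same change of measure in
`dualObjective_eq` turns the dual objective, with `τ = λ ε`, into a nested log-mean-exp functional
plus `λ ρ̄`. Replacing the loss by its excess over a lower bound `M` keeps everything in `[0, ∞]`.

What remains is Gibbs duality under a linear constraint, for causality says that `Ŷ` given `(X̂, X)`
has law `κ X̂`. For a bounded loss take the density `exp` of `gibbsExponent`. Integrating out `y`
leaves a density in `(X̂, X)` alone, so the tilted plan is causal. Under any causal law the inner
potential and its `κ`-average have the same integral, so the exponent integrates to (mean loss minus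
dual functional) / `τ`. The Gibbs inequality then gives weak duality, with equality at the tilted
plan (`integral_le_of_mem_causalLaws`, `exists_integral_eq`); truncation and monotone convergence
remove boundedness.

For `ρ̄ > 0`, convexity of relative entropy makes the value concave in the entropy radius, so there
is a supporting line (`exists_supporting_slope`). Testing it on Gibbs plans whose temperature is
that slope, slightly increased, bounds the dual (`exists_softDual_le`); neither compactness nor a
primal optimizer is needed.

If the dual value is infinite, the loss is unbounded on the ball, and a geometric mixture averaged
with the reference plan has infinite loss at half the entropy radius (`exists_lintegral_eq_top`): an
optimal solution at which the constraint is slack. Without light tails every dual objective is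
infinite, since a finite nested functional forces almost all inner exponential integrals to be
finite. For `ρ̄ = 0` the dual functional decreases to the mean loss of the smoothed plan as `τ → ∞`
(`iInf_softDual_le`). Non-integrable log-normalizers and zero reference measures give `ρ̄ = ±∞` and
are settled separately. -/

/-- `exp (h / τ)` for an extended nonnegative real `h`. -/
noncomputable def scaledExp (τ : ℝ) (h : ℝ≥0∞) : ℝ≥0∞ := EReal.exp ((h : EReal) / (τ : EReal))

/-- The functional `τ log ∫ exp (h / τ) dμ` of a nonnegative function, truncated at zero. -/
noncomputable def logMeanExp {S : Type*} [MeasurableSpace S] (τ : ℝ) (μ : Measure S)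
    (h : S → ℝ≥0∞) : ℝ≥0∞ :=
  ENNReal.ofReal τ * (ENNReal.log (∫⁻ s, scaledExp τ (h s) ∂μ)).toENNReal

/-! ### Scaled exponentials and their difference quotients on `[0, ∞]`. -/

section ScaledExp

variable {τ : ℝ}

lemma scaledExp_mono (hτ : 0 < τ) : Monotone (scaledExp τ) := fun a b hab =>
  EReal.exp_monotone (EReal.div_le_div_right_of_nonneg (by exact_mod_cast hτ.le)
    (by exact_mod_cast hab))

lemma continuous_scaledExp (hτ : 0 < τ) : Continuous (scaledExp τ) := by
  refine ENNReal.continuous_exp.comp ?_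
  have h1 : Continuous fun x : EReal => x / (τ : EReal) := by
    simp_rw [EReal.div_eq_inv_mul, ← EReal.coe_inv]
    refine continuous_iff_continuousAt.2 fun x => ?_
    refine (EReal.continuousAt_mul (p := (((τ⁻¹ : ℝ) : EReal), x)) ?_ ?_ ?_ ?_).comp
      (by fun_prop : ContinuousAt (fun x : EReal => (((τ⁻¹ : ℝ) : EReal), x)) x) <;>
    simp [hτ.ne']
  exact h1.comp continuous_coe_ennreal_ereal

lemma measurable_scaledExp (hτ : 0 < τ) : Measurable (scaledExp τ) :=
  (continuous_scaledExp hτ).measurable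

lemma scaledExp_top (hτ : 0 < τ) : scaledExp τ ⊤ = ⊤ := by
  simp [scaledExp, EReal.top_div_of_pos_ne_top (by exact_mod_cast hτ : (0 : EReal) < τ)]

lemma scaledExp_ofReal (x : ℝ) (hx : 0 ≤ x) :
    scaledExp τ (ENNReal.ofReal x) = ENNReal.ofReal (Real.exp (x / τ)) := by
  rw [scaledExp, EReal.coe_ennreal_ofReal, max_eq_left hx, ← EReal.coe_div, EReal.exp_coe]

lemma scaledExp_zero : scaledExp τ 0 = 1 := by simp [scaledExp]

lemma one_le_scaledExp (hτ : 0 < τ) (h : ℝ≥0∞) : 1 ≤ scaledExp τ h :=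
  scaledExp_zero (τ := τ) ▸ scaledExp_mono hτ (zero_le)

/-- Turns a change of temperature into a change of Lebesgue exponent. -/
lemma scaledExp_eq_rpow {τ' : ℝ} (hτ : 0 < τ) (hτ' : 0 < τ') (h : ℝ≥0∞) :
    scaledExp τ' h = scaledExp τ h ^ (τ / τ') := by
  induction h with
  | top => rw [scaledExp_top hτ, scaledExp_top hτ', ENNReal.top_rpow_of_pos (div_pos hτ hτ')]
  | coe x =>
    rw [← ENNReal.ofReal_coe_nnreal, scaledExp_ofReal _ x.coe_nonneg,
      scaledExp_ofReal _ x.coe_nonneg,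
      ENNReal.ofReal_rpow_of_pos (Real.exp_pos _), ← Real.exp_mul]
    congr 2
    field_simp

/-- The difference quotient `τ (exp (h / τ) - 1)`. -/
noncomputable def expQuotient (τ : ℝ) (h : ℝ≥0∞) : ℝ≥0∞ := ENNReal.ofReal τ * (scaledExp τ h - 1)

lemma expQuotient_top (hτ : 0 < τ) : expQuotient τ ⊤ = ⊤ := by
  simp [expQuotient, scaledExp_top hτ, ENNReal.mul_top, hτ]

lemma expQuotient_ofReal (hτ : 0 < τ) (x : ℝ) (hx : 0 ≤ x) :
    expQuotient τ (ENNReal.ofReal x) = ENNReal.ofReal (τ * (Real.exp (x / τ) - 1)) := by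
  rw [expQuotient, scaledExp_ofReal _ hx, ENNReal.ofReal_mul hτ.le,
    ENNReal.ofReal_sub _ zero_le_one, ENNReal.ofReal_one]

lemma measurable_expQuotient (hτ : 0 < τ) : Measurable (expQuotient τ) :=
  ((measurable_scaledExp hτ).sub_const 1).const_mul _

/-- With `s = 1 / τ` this is the chord slope `(exp (s h) - 1) / s` from `0`, monotone in `s` by
convexity of `exp`. -/
lemma expQuotient_antitone {τ' : ℝ} (hτ : 0 < τ) (hτ' : τ ≤ τ') (h : ℝ≥0∞) :
    expQuotient τ' h ≤ expQuotient τ h := by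
  have h0 : 0 < τ' := hτ.trans_le hτ'
  induction h with
  | top => rw [expQuotient_top hτ]; exact le_top
  | coe x =>
    rw [← ENNReal.ofReal_coe_nnreal, expQuotient_ofReal hτ _ x.coe_nonneg,
      expQuotient_ofReal h0 _ x.coe_nonneg]
    refine ENNReal.ofReal_le_ofReal ?_
    have hc := convexOn_exp.2 (Set.mem_univ ((x : ℝ) / τ)) (Set.mem_univ 0)
      (div_nonneg hτ.le h0.le) (sub_nonneg.2 ((div_le_one h0).2 hτ')) (by ring)
    simp only [smul_eq_mul, mul_zero, add_zero, Real.exp_zero, mul_one] at hc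
    rw [show τ / τ' * ((x : ℝ) / τ) = x / τ' by field_simp] at hc
    have := mul_le_mul_of_nonneg_left hc h0.le
    have e : τ' * (τ / τ' * Real.exp (x / τ) + (1 - τ / τ'))
      = τ * Real.exp (x / τ) + τ' - τ := by field_simp; ring
    linarith

lemma le_expQuotient (hτ : 0 < τ) (h : ℝ≥0∞) : h ≤ expQuotient τ h := by
  induction h with
  | top => rw [expQuotient_top hτ]
  | coe x =>
    rw [← ENNReal.ofReal_coe_nnreal, expQuotient_ofReal hτ _ x.coe_nonneg]
    refine ENNReal.ofReal_le_ofReal ?_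
    have := mul_le_mul_of_nonneg_left (Real.add_one_le_exp ((x : ℝ) / τ)) hτ.le
    have e : τ * ((x : ℝ) / τ + 1) = x + τ := by field_simp
    linarith

/-- The second-order bound `exp u - 1 - u ≤ u ^ 2` for `|u| ≤ 1`, taken at `u = h / (τ + n)`, leaves
an error `h ^ 2 / (τ + n)`. -/
lemma iInf_expQuotient_le (hτ : 0 < τ) {h : ℝ≥0∞} (hh : h ≠ ⊤) :
    ⨅ n : ℕ, expQuotient (τ + n) h ≤ h := by
  lift h to NNReal using hh
  refine ENNReal.le_of_forall_pos_le_add fun δ hδ _ => ?_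
  -- The first bound puts `u` in `[-1, 1]`; the second makes the error at most `δ`.
  obtain ⟨n, hn⟩ := exists_nat_ge (max (h : ℝ) ((h : ℝ) ^ 2 / δ))
  have h1 : (h : ℝ) ≤ τ + n := by linarith [le_max_left (h : ℝ) ((h : ℝ) ^ 2 / δ)]
  have h2 : (h : ℝ) ^ 2 / δ ≤ τ + n := by linarith [le_max_right (h : ℝ) ((h : ℝ) ^ 2 / δ)]
  have hδ' : (0 : ℝ) < δ := hδ
  have ht : 0 < τ + n := by positivity
  refine (iInf_le _ n).trans ?_
  rw [← ENNReal.ofReal_coe_nnreal, expQuotient_ofReal ht _ h.coe_nonneg,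
    ← ENNReal.ofReal_coe_nnreal (p := δ), ← ENNReal.ofReal_add h.coe_nonneg hδ'.le]
  refine ENNReal.ofReal_le_ofReal ?_
  have h3 : |(h : ℝ) / (τ + n)| ≤ 1 := by
    rw [abs_of_nonneg (by positivity), div_le_one ht]; exact h1
  have h4 := (abs_le.1 (Real.abs_exp_sub_one_sub_id_le h3)).2
  have h5 := mul_le_mul_of_nonneg_left h4 ht.le
  have e1 : (τ + n) * (Real.exp ((h : ℝ) / (τ + n)) - 1 - (h : ℝ) / (τ + n))
      = (τ + n) * (Real.exp ((h : ℝ) / (τ + n)) - 1) - h := by field_simp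
  have e2 : (τ + n) * ((h : ℝ) / (τ + n)) ^ 2 = (h : ℝ) ^ 2 / (τ + n) := by field_simp
  have h6 : (h : ℝ) ^ 2 / (τ + n) ≤ δ := by
    rw [div_le_iff₀ ht]; rw [div_le_iff₀ hδ'] at h2; linarith
  linarith

end ScaledExp

/-! ### The log-mean-exp functional, extended-valued and real. -/

section LogMeanExp

lemma toENNReal_log_le_sub_one (z : ℝ≥0∞) : (ENNReal.log z).toENNReal ≤ z - 1 := by
  rcases eq_or_ne z ⊤ with rfl | hz
  · simp
  rcases eq_or_ne z 0 with rfl | h0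
  · simp
  lift z to NNReal using hz
  have hz0 : (0 : ℝ) < z := by
    have : z ≠ 0 := by simpa using h0
    positivity
  rw [ENNReal.log_of_nnreal (by simpa using h0), EReal.real_coe_toENNReal,
    ← ENNReal.ofReal_coe_nnreal, ← ENNReal.ofReal_one, ← ENNReal.ofReal_sub _ zero_le_one]
  exact ENNReal.ofReal_le_ofReal (Real.log_le_sub_one_of_pos hz0)

variable {S : Type*} [MeasurableSpace S] {τ : ℝ} {μ : Measure S}

lemma logMeanExp_mono (hτ : 0 < τ) {g h : S → ℝ≥0∞} (hgh : ∀ᵐ s ∂μ, g s ≤ h s) :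
    logMeanExp τ μ g ≤ logMeanExp τ μ h := by
  refine mul_le_mul_right (EReal.toENNReal_le_toENNReal (ENNReal.log_monotone ?_)) _
  exact lintegral_mono_ae (hgh.mono fun s hs => scaledExp_mono hτ hs)

/-- Monotone convergence; the outer maps are monotone and continuous on the extended half-line, so
infinite integrals need no separate treatment. -/
lemma logMeanExp_iSup (hτ : 0 < τ) {h : ℕ → S → ℝ≥0∞} (hm : ∀ n, Measurable (h n))
    (hmono : Monotone h) : logMeanExp τ μ (fun s => ⨆ n, h n s) = ⨆ n, logMeanExp τ μ (h n) := by
  have h1 : ∀ s, scaledExp τ (⨆ n, h n s) = ⨆ n, scaledExp τ (h n s) := fun s =>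
    (scaledExp_mono hτ).map_ciSup_of_continuousAt (continuous_scaledExp hτ).continuousAt
  have h2 : Monotone fun z => (ENNReal.log z).toENNReal := fun a b hab =>
    EReal.toENNReal_le_toENNReal (ENNReal.log_monotone hab)
  have h3 : Continuous fun z => (ENNReal.log z).toENNReal :=
    EReal.continuous_toENNReal.comp ENNReal.continuous_log
  simp only [logMeanExp, h1]
  rw [lintegral_iSup (f := fun n s => scaledExp τ (h n s))
    (fun n => (measurable_scaledExp hτ).comp (hm n))
    (fun a b hab s => scaledExp_mono hτ (hmono hab s)),
    h2.map_ciSup_of_continuousAt h3.continuousAt, ENNReal.mul_iSup]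

lemma logMeanExp_antitone [IsProbabilityMeasure μ] (hτ : 0 < τ) {τ' : ℝ} (hτ' : τ ≤ τ')
    {h : S → ℝ≥0∞} (hm : Measurable h) : logMeanExp τ' μ h ≤ logMeanExp τ μ h := by
  have h0 : 0 < τ' := hτ.trans_le hτ'
  have hs : 0 < τ / τ' := div_pos hτ h0
  have key : ∫⁻ s, scaledExp τ' (h s) ∂μ ≤ (∫⁻ s, scaledExp τ (h s) ∂μ) ^ (τ / τ') := by
    -- On a probability space the `L^s` norm is at most the `L^1` norm for `s = τ / τ' ≤ 1`, here of
    -- `exp (h / τ)`.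
    have := eLpNorm'_le_eLpNorm'_of_exponent_le hs ((div_le_one h0).2 hτ') μ
      (((measurable_scaledExp hτ).comp hm).aestronglyMeasurable)
    simp only [eLpNorm', enorm_eq_self, Function.comp, ENNReal.rpow_one, div_one, one_div] at this
    simp_rw [scaledExp_eq_rpow hτ h0]
    have h3 := ENNReal.rpow_le_rpow this hs.le
    rwa [← ENNReal.rpow_mul, inv_mul_cancel₀ hs.ne', ENNReal.rpow_one] at h3
  calc logMeanExp τ' μ h
      ≤ ENNReal.ofReal τ' *
        (ENNReal.log ((∫⁻ s, scaledExp τ (h s) ∂μ) ^ (τ / τ'))).toENNReal :=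
        mul_le_mul_right (EReal.toENNReal_le_toENNReal (ENNReal.log_monotone key)) _
    _ = logMeanExp τ μ h := by
        rw [ENNReal.log_rpow, EReal.toENNReal_mul (by exact_mod_cast hs.le),
          EReal.real_coe_toENNReal, ← mul_assoc, ← ENNReal.ofReal_mul h0.le,
          mul_div_cancel₀ _ h0.ne', logMeanExp]

/-- `log z ≤ z - 1` at `z = ∫ exp (h / τ)`; total mass one lets the `1` be subtracted under the
integral. -/
lemma logMeanExp_le_lintegral_expQuotient [IsProbabilityMeasure μ] (hτ : 0 < τ)
    {h : S → ℝ≥0∞} : logMeanExp τ μ h ≤ ∫⁻ s, expQuotient τ (h s) ∂μ := by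
  simp only [expQuotient]
  rw [lintegral_const_mul' _ _ ENNReal.ofReal_ne_top, logMeanExp]
  refine mul_le_mul_right ((toENNReal_log_le_sub_one _).trans ?_) _
  refine tsub_le_iff_right.2 ?_
  calc ∫⁻ s, scaledExp τ (h s) ∂μ = ∫⁻ s, (scaledExp τ (h s) - 1) + 1 ∂μ :=
        lintegral_congr fun s => (tsub_add_cancel_of_le (one_le_scaledExp hτ _)).symm
    _ ≤ _ := by rw [lintegral_add_right _ measurable_const]; simp

lemma lintegral_scaledExp_ne_top (hτ : 0 < τ) {h : S → ℝ≥0∞} (hfin : logMeanExp τ μ h ≠ ⊤) :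
    ∫⁻ s, scaledExp τ (h s) ∂μ ≠ ⊤ := fun H => hfin (by
  simp [logMeanExp, H, ENNReal.mul_top, hτ])

lemma lintegral_expQuotient_ne_top (hτ : 0 < τ) {h : S → ℝ≥0∞}
    (hfin : logMeanExp τ μ h ≠ ⊤) : ∫⁻ s, expQuotient τ (h s) ∂μ ≠ ⊤ := by
  simp only [expQuotient]
  rw [lintegral_const_mul' _ _ ENNReal.ofReal_ne_top]
  refine ENNReal.mul_ne_top ENNReal.ofReal_ne_top (ne_top_of_le_ne_top
    (lintegral_scaledExp_ne_top hτ hfin) (lintegral_mono fun s => tsub_le_self))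

lemma lintegral_ne_top_of_logMeanExp_ne_top (hτ : 0 < τ) {h : S → ℝ≥0∞}
    (hfin : logMeanExp τ μ h ≠ ⊤) : ∫⁻ s, h s ∂μ ≠ ⊤ :=
  ne_top_of_le_ne_top (lintegral_expQuotient_ne_top hτ hfin)
    (lintegral_mono fun s => le_expQuotient hτ (h s))

/-- The log-mean-exp functional decreases to the mean as the temperature increases. -/
lemma iInf_logMeanExp_le [IsProbabilityMeasure μ] (hτ : 0 < τ) {h : S → ℝ≥0∞} (hm : Measurable h)
    (hfin : logMeanExp τ μ h ≠ ⊤) : ⨅ n : ℕ, logMeanExp (τ + n) μ h ≤ ∫⁻ s, h s ∂μ := by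
  have hpos : ∀ n : ℕ, 0 < τ + n := fun n => by positivity
  have hq := lintegral_expQuotient_ne_top hτ hfin
  have hae : ∀ᵐ s ∂μ, h s ≠ ⊤ :=
    (ae_lt_top hm (lintegral_ne_top_of_logMeanExp_ne_top hτ hfin)).mono fun s hs => hs.ne
  calc ⨅ n : ℕ, logMeanExp (τ + n) μ h
      ≤ ⨅ n : ℕ, ∫⁻ s, expQuotient (τ + n) (h s) ∂μ :=
        iInf_mono fun n => logMeanExp_le_lintegral_expQuotient (hpos n)
    -- Decreasing convergence, licensed by finiteness of the first quotient, which comes from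
    -- `hfin`.
    _ = ∫⁻ s, ⨅ n : ℕ, expQuotient (τ + n) (h s) ∂μ := by
        refine (lintegral_iInf (fun n => (measurable_expQuotient (hpos n)).comp hm)
          (fun a b hab s => expQuotient_antitone (hpos a) (by gcongr) _) (by simpa using hq)).symm
    _ ≤ _ := lintegral_mono_ae (hae.mono fun s hs => iInf_expQuotient_le hτ hs)

lemma logMeanExp_const_le [IsProbabilityMeasure μ] (hτ : 0 < τ) {h : S → ℝ≥0∞} {C : ℝ≥0∞}
    (hC : ∀ᵐ s ∂μ, h s ≤ C) : logMeanExp τ μ h ≤ C := by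
  refine (logMeanExp_mono hτ hC).trans ?_
  induction C with
  | top => exact le_top
  | coe x =>
    rw [logMeanExp, ← ENNReal.ofReal_coe_nnreal]
    simp only [scaledExp_ofReal _ x.coe_nonneg, lintegral_const, measure_univ, mul_one]
    rw [ENNReal.log_ofReal_of_pos (Real.exp_pos _), Real.log_exp, EReal.real_coe_toENNReal,
      ← ENNReal.ofReal_mul hτ.le, mul_div_cancel₀ _ hτ.ne']

lemma measurable_logMeanExp {T : Type*} [MeasurableSpace T] (hτ : 0 < τ) (q : Kernel T S)
    [IsSFiniteKernel q] {h : T → S → ℝ≥0∞} (hm : Measurable (Function.uncurry h)) :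
    Measurable fun t => logMeanExp τ (q t) (h t) := by
  refine Measurable.const_mul (EReal.continuous_toENNReal.measurable.comp
    (ENNReal.measurable_log.comp ?_)) _
  exact Measurable.lintegral_kernel_prod_right ((measurable_scaledExp hτ).comp hm)

/-- The real log-mean-exp functional. -/
noncomputable def realLogMeanExp (τ : ℝ) (μ : Measure S) (h : S → ℝ) : ℝ :=
  τ * Real.log (∫ s, Real.exp (h s / τ) ∂μ)

variable {h : S → ℝ} {C : ℝ}

lemma integrable_exp_div_of_mem_Icc [IsFiniteMeasure μ] (hτ : 0 < τ) (hm : Measurable h)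
    (hb : ∀ s, h s ∈ Set.Icc 0 C) : Integrable (fun s => Real.exp (h s / τ)) μ := by
  refine Integrable.of_bound (by fun_prop) (Real.exp (C / τ)) (ae_of_all _ fun s => ?_)
  rw [Real.norm_of_nonneg (Real.exp_nonneg _)]
  exact Real.exp_le_exp.2 (div_le_div_of_nonneg_right (hb s).2 hτ.le)

lemma integral_exp_div_mem_Icc [IsProbabilityMeasure μ] (hτ : 0 < τ) (hm : Measurable h)
    (hb : ∀ s, h s ∈ Set.Icc 0 C) :
    ∫ s, Real.exp (h s / τ) ∂μ ∈ Set.Icc 1 (Real.exp (C / τ)) := by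
  have hi := integrable_exp_div_of_mem_Icc (μ := μ) hτ hm hb
  constructor
  · calc (1 : ℝ) = ∫ s, 1 ∂μ := by simp
      _ ≤ _ := integral_mono (by simp) hi fun s =>
        Real.one_le_exp (div_nonneg (hb s).1 hτ.le)
  · calc _ ≤ ∫ s, Real.exp (C / τ) ∂μ := integral_mono hi (by simp) fun s =>
          Real.exp_le_exp.2 (div_le_div_of_nonneg_right (hb s).2 hτ.le)
      _ = _ := by simp

lemma realLogMeanExp_mem_Icc [IsProbabilityMeasure μ] (hτ : 0 < τ) (hm : Measurable h)
    (hb : ∀ s, h s ∈ Set.Icc 0 C) : realLogMeanExp τ μ h ∈ Set.Icc 0 C := by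
  obtain ⟨h1, h2⟩ := integral_exp_div_mem_Icc (μ := μ) hτ hm hb
  refine ⟨mul_nonneg hτ.le (Real.log_nonneg h1), ?_⟩
  have := Real.log_le_log (by linarith) h2
  rw [Real.log_exp] at this
  calc _ ≤ τ * (C / τ) := mul_le_mul_of_nonneg_left this hτ.le
    _ = C := by field_simp

lemma exp_realLogMeanExp_div [IsProbabilityMeasure μ] (hτ : 0 < τ) (hm : Measurable h)
    (hb : ∀ s, h s ∈ Set.Icc 0 C) :
    Real.exp (realLogMeanExp τ μ h / τ) = ∫ s, Real.exp (h s / τ) ∂μ := by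
  rw [realLogMeanExp, mul_div_cancel_left₀ _ hτ.ne',
    Real.exp_log (by linarith [(integral_exp_div_mem_Icc (μ := μ) hτ hm hb).1])]

lemma logMeanExp_ofReal [IsProbabilityMeasure μ] (hτ : 0 < τ) (hm : Measurable h)
    (hb : ∀ s, h s ∈ Set.Icc 0 C) :
    logMeanExp τ μ (fun s => ENNReal.ofReal (h s)) = ENNReal.ofReal (realLogMeanExp τ μ h) := by
  have h1 := (integral_exp_div_mem_Icc (μ := μ) hτ hm hb).1
  rw [logMeanExp, realLogMeanExp, ENNReal.ofReal_mul hτ.le]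
  simp only [scaledExp_ofReal _ (hb _).1]
  rw [← ofReal_integral_eq_lintegral_ofReal (integrable_exp_div_of_mem_Icc hτ hm hb)
    (ae_of_all _ fun s => Real.exp_nonneg _), ENNReal.log_ofReal_of_pos (by linarith),
    EReal.real_coe_toENNReal]

lemma measurable_realLogMeanExp {T : Type*} [MeasurableSpace T] (q : Kernel T S)
    [IsSFiniteKernel q] {h : T → S → ℝ} (hm : Measurable (Function.uncurry h)) :
    Measurable fun t => realLogMeanExp τ (q t) (h t) := by
  have h1 : StronglyMeasurable (Function.uncurry fun t s => Real.exp (h t s / τ)) :=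
    (Real.measurable_exp.comp (hm.div_const τ)).stronglyMeasurable
  exact (Real.measurable_log.comp h1.integral_kernel_prod_right.measurable).const_mul τ

end LogMeanExp

/-! ### Relative entropy: convexity and the Gibbs variational inequality. -/

section RelativeEntropy

open InformationTheory

/-- The left side is the tangent line of the convex function `klFun` at `t`. -/
lemma log_mul_sub_add_one_le_klFun {x : ℝ} (hx : 0 ≤ x) {t : ℝ} (ht : 0 < t) :
    Real.log t * x - t + 1 ≤ klFun x := by
  rcases hx.eq_or_lt with rfl | hx
  · rw [klFun_zero]; linarith
  · have := Real.log_le_sub_one_of_pos (div_pos ht hx)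
    rw [Real.log_div ht.ne' hx.ne'] at this
    have h2 := mul_le_mul_of_nonneg_left this hx.le
    have e : x * (t / x - 1) = t - x := by field_simp
    rw [klFun_apply]
    linarith

/-- Jensen's inequality for `klFun` and countable convex combinations. -/
lemma ofReal_klFun_tsum_le {ι : Type*} {w q : ι → ℝ≥0∞} (hw : ∑' i, w i = 1)
    (hfin : ∑' i, w i * q i ≠ ⊤) :
    ENNReal.ofReal (klFun (∑' i, w i * q i).toReal)
      ≤ ∑' i, w i * ENNReal.ofReal (klFun (q i).toReal) := by
  by_cases htop : ∑' i, w i * ENNReal.ofReal (klFun (q i).toReal) = ⊤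
  · rw [htop]; exact le_top
  have hwt : ∑' i, w i ≠ ⊤ := by simp [hw]
  have hwi : ∀ i, w i ≠ ⊤ := ENNReal.ne_top_of_tsum_ne_top hwt
  set t := (∑' i, w i * q i).toReal with ht
  -- At barycentre zero no finite tangent slope exists, but every term with positive weight has `q i
  -- = 0`, so both sides are `1`.
  rcases eq_or_ne (∑' i, w i * q i) 0 with h0 | h0
  · have : ∀ i, w i * q i = 0 := by simpa using h0
    rw [ht, h0, ENNReal.toReal_zero, klFun_zero, ENNReal.ofReal_one, ← hw]
    refine ENNReal.tsum_le_tsum fun i => ?_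
    rcases mul_eq_zero.1 (this i) with h | h
    · simp [h]
    · simp [h, klFun_zero]
  have htpos : 0 < t := ENNReal.toReal_pos h0 hfin
  have s1 : HasSum (fun i => (w i).toReal) 1 := by
    have := (ENNReal.summable_toReal hwt).hasSum
    rwa [← ENNReal.tsum_toReal_eq hwi, hw, ENNReal.toReal_one] at this
  have s2 : HasSum (fun i => (w i).toReal * (q i).toReal) t := by
    have := (ENNReal.summable_toReal hfin).hasSum
    rw [← ENNReal.tsum_toReal_eq (ENNReal.ne_top_of_tsum_ne_top hfin)] at this
    simpa [ENNReal.toReal_mul] using this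
  have s3 := (ENNReal.summable_toReal htop)
  have e3 : ∀ i, (w i * ENNReal.ofReal (klFun (q i).toReal)).toReal
      = (w i).toReal * klFun (q i).toReal := fun i => by
    rw [ENNReal.toReal_mul, ENNReal.toReal_ofReal (klFun_nonneg ENNReal.toReal_nonneg)]
  rw [← ENNReal.ofReal_toReal htop,
    ENNReal.tsum_toReal_eq (ENNReal.ne_top_of_tsum_ne_top htop)]
  refine ENNReal.ofReal_le_ofReal ?_
  -- Averaging the tangent line at the barycentre `t` returns its value there, `klFun t`.
  have s4 : HasSum (fun i => Real.log t * ((w i).toReal * (q i).toReal)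
      + (1 - t) * (w i).toReal) (Real.log t * t + (1 - t) * 1) :=
    (s2.mul_left _).add (s1.mul_left _)
  have h5 : klFun t = Real.log t * t + (1 - t) * 1 := by rw [klFun_apply]; ring
  rw [h5]
  refine hasSum_le (fun i => ?_) s4 s3.hasSum
  rw [e3]
  have := mul_le_mul_of_nonneg_left
    (log_mul_sub_add_one_le_klFun (ENNReal.toReal_nonneg (a := q i)) htpos)
    (ENNReal.toReal_nonneg (a := w i))
  linarith

variable {Ω : Type*} [MeasurableSpace Ω]

lemma isProbabilityMeasure_sum_smul {ι : Type*} {w : ι → ℝ≥0∞} (hw : ∑' i, w i = 1)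
    {γ : ι → Measure Ω} [∀ i, IsProbabilityMeasure (γ i)] :
    IsProbabilityMeasure (Measure.sum fun i => w i • γ i) :=
  ⟨by rw [Measure.sum_apply _ MeasurableSet.univ]; simp [hw]⟩

/-- Convexity of the relative entropy under countable mixtures. -/
lemma klDiv_sum_smul_le {ι : Type*} [Countable ι] {w : ι → ℝ≥0∞} (hw : ∑' i, w i = 1)
    {γ : ι → Measure Ω} [∀ i, IsProbabilityMeasure (γ i)] {ν : Measure Ω}
    [IsProbabilityMeasure ν] (hac : ∀ i, γ i ≪ ν) :
    klDiv (Measure.sum fun i => w i • γ i) ν ≤ ∑' i, w i * klDiv (γ i) ν := by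
  have := isProbabilityMeasure_sum_smul hw (γ := γ)
  have hwt : ∑' i, w i ≠ ⊤ := by simp [hw]
  have hm : ∀ i, Measurable fun ω => w i * (γ i).rnDeriv ν ω := fun i =>
    (Measure.measurable_rnDeriv _ _).const_mul _
  -- The density of a mixture is the mixture of the densities, so the pointwise Jensen inequality
  -- can be integrated.
  have hsum : (Measure.sum fun i => w i • γ i)
      = ν.withDensity (fun ω => ∑' i, w i * (γ i).rnDeriv ν ω) := by
    have h1 : (fun ω => ∑' i, w i * (γ i).rnDeriv ν ω)
        = ∑' i, fun ω => w i * (γ i).rnDeriv ν ω := by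
      ext ω; rw [tsum_apply]; exact Pi.summable.2 fun _ => ENNReal.summable
    rw [h1, withDensity_tsum hm]
    congr 1
    ext1 i
    have : (fun ω => w i * (γ i).rnDeriv ν ω) = w i • (γ i).rnDeriv ν := rfl
    rw [this, withDensity_smul _ (Measure.measurable_rnDeriv _ _),
      Measure.withDensity_rnDeriv_eq _ _ (hac i)]
  have hacs : (Measure.sum fun i => w i • γ i) ≪ ν := by
    rw [hsum]; exact withDensity_absolutelyContinuous _ _
  have hrn : (Measure.sum fun i => w i • γ i).rnDeriv ν
      =ᵐ[ν] fun ω => ∑' i, w i * (γ i).rnDeriv ν ω := by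
    rw [hsum]; exact Measure.rnDeriv_withDensity _ (Measurable.tsum hm)
  have hfin : ∀ᵐ ω ∂ν, ∑' i, w i * (γ i).rnDeriv ν ω ≠ ⊤ := by
    filter_upwards [hrn, Measure.rnDeriv_lt_top (Measure.sum fun i => w i • γ i) ν] with ω h1 h2
    rw [← h1]; exact h2.ne
  rw [klDiv_eq_lintegral_klFun_of_ac hacs]
  calc _ ≤ ∫⁻ ω, ∑' i, w i * ENNReal.ofReal (klFun ((γ i).rnDeriv ν ω).toReal) ∂ν := by
        refine lintegral_mono_ae ?_
        filter_upwards [hrn, hfin] with ω h1 h2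
        rw [h1]
        exact ofReal_klFun_tsum_le hw h2
    _ = _ := by
        have hm2 : ∀ i, Measurable fun ω => ENNReal.ofReal (klFun ((γ i).rnDeriv ν ω).toReal) :=
          fun i => (measurable_klFun.comp
            (Measure.measurable_rnDeriv _ _).ennreal_toReal).ennreal_ofReal
        rw [lintegral_tsum fun i => ((hm2 i).const_mul _).aemeasurable]
        congr 1
        ext1 i
        rw [lintegral_const_mul _ (hm2 i), klDiv_eq_lintegral_klFun_of_ac (hac i)]

/-- The Gibbs variational inequality for a bounded normalized exponent. -/
lemma integral_le_toReal_klDiv {γ ν : Measure Ω} [IsProbabilityMeasure γ]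
    [IsProbabilityMeasure ν] (hkl : klDiv γ ν ≠ ⊤) {h : Ω → ℝ} (hi : Integrable h γ)
    (he : Integrable (fun ω => Real.exp (h ω)) ν) (h1 : ∫ ω, Real.exp (h ω) ∂ν = 1) :
    ∫ ω, h ω ∂γ ≤ (klDiv γ ν).toReal := by
  obtain ⟨hac, hllr⟩ := klDiv_ne_top_iff.1 hkl
  have := isProbabilityMeasure_tilted he
  have h2 := integral_llr_tilted_right hac hi he hllr
  -- Nonnegativity of the relative entropy of `γ` with respect to the tilted measure.
  have h3 := integral_llr_add_sub_measure_univ_nonneg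
    (hac.trans (absolutelyContinuous_tilted he))
    (integrable_llr_tilted_right hac hi hllr he)
  rw [h2, h1, Real.log_one] at h3
  rw [toReal_klDiv_of_measure_eq hac (by simp)]
  simp only [probReal_univ] at h3
  linarith

/-- The relative entropy of a tilted measure. -/
lemma klDiv_tilted_self {ν : Measure Ω} [IsProbabilityMeasure ν] {h : Ω → ℝ}
    (he : Integrable (fun ω => Real.exp (h ω)) ν) (h1 : ∫ ω, Real.exp (h ω) ∂ν = 1)
    (hi : Integrable h (ν.tilted h)) :
    klDiv (ν.tilted h) ν ≠ ⊤ ∧ (klDiv (ν.tilted h) ν).toReal = ∫ ω, h ω ∂(ν.tilted h) := by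
  have := isProbabilityMeasure_tilted he
  have hac := tilted_absolutelyContinuous ν h
  have hl : llr (ν.tilted h) ν =ᵐ[ν.tilted h] h := by
    filter_upwards [hac.ae_le (log_rnDeriv_tilted_left_self he)] with ω hω
    rw [llr_def]
    simp only [hω, h1, Real.log_one, sub_zero]
  refine ⟨klDiv_ne_top hac (hi.congr hl.symm), ?_⟩
  rw [toReal_klDiv_of_measure_eq hac (by simp), integral_congr_ae hl]

end RelativeEntropy

/-! ### Causal laws as a linear constraint, and the reference plan. -/

section CausalLaws

variable {X Y : Type*} [MeasurableSpace X] [MeasurableSpace Y]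

/-- The joint laws `γ` of `((X̂, Ŷ), (X, Y))` with `(X̂, Ŷ) ∼ μ ⊗ κ` for which the conditional
law of `Ŷ` given `(X̂, X)` is `κ X̂`. -/
def causalLaws (μ : Measure X) (κ : Kernel X Y) : Set (Measure ((X × Y) × (X × Y))) :=
  {γ | γ.fst = μ.compProd κ ∧
    γ.map (fun ω => ((ω.1.1, ω.2.1), ω.1.2))
      = (γ.map (fun ω => (ω.1.1, ω.2.1))).compProd (κ.comap Prod.fst measurable_fst)}

/-- The plan `μ ⊗ κ ⊗ qX ⊗ qY`, in which `X` and `Y` are drawn independently from `qX X̂` and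
`qY Ŷ`. -/
noncomputable def referencePlan (μ : Measure X) (κ : Kernel X Y) (qX : Kernel X X)
    (qY : Kernel Y Y) : Measure ((X × Y) × (X × Y)) :=
  (μ.compProd κ).compProd
    ((qX.comap Prod.fst measurable_fst).prod (qY.comap Prod.snd measurable_snd))

variable {μ : Measure X} {κ : Kernel X Y} {qX : Kernel X X} {qY : Kernel Y Y}
  {γ : Measure ((X × Y) × (X × Y))}

lemma isProbabilityMeasure_of_fst_eq {α β : Type*} [MeasurableSpace α] [MeasurableSpace β]
    {γ : Measure (α × β)} {P : Measure α} [IsProbabilityMeasure P] (h : γ.fst = P) :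
    IsProbabilityMeasure γ :=
  ⟨by rw [← Measure.fst_univ, h, measure_univ]⟩

lemma isProbabilityMeasure_of_mem_causalLaws [IsProbabilityMeasure μ] [IsMarkovKernel κ]
    (hγ : γ ∈ causalLaws μ κ) : IsProbabilityMeasure γ := isProbabilityMeasure_of_fst_eq hγ.1

section Reference

variable [IsProbabilityMeasure μ] [IsMarkovKernel κ] [IsMarkovKernel qX] [IsMarkovKernel qY]

instance : IsProbabilityMeasure (referencePlan μ κ qX qY) := by
  unfold referencePlan; infer_instance

lemma lintegral_referencePlan {F : (X × Y) × (X × Y) → ℝ≥0∞} (hF : Measurable F) :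
    ∫⁻ ω, F ω ∂(referencePlan μ κ qX qY)
      = ∫⁻ xh, ∫⁻ yh, ∫⁻ x, ∫⁻ y, F ((xh, yh), (x, y)) ∂(qY yh) ∂(qX xh) ∂(κ xh) ∂μ := by
  rw [referencePlan, Measure.lintegral_compProd hF, Measure.lintegral_compProd
    (Measurable.lintegral_kernel_prod_right (f := fun a b => F (a, b)) hF)]
  refine lintegral_congr fun xh => lintegral_congr fun yh => ?_
  rw [Kernel.lintegral_prod _ _ _ (g := fun c => F ((xh, yh), c))
    (hF.comp measurable_prodMk_left)]
  simp [Kernel.comap_apply]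

end Reference

/-- A plan whose `(X̂, Ŷ, X)` marginal has density depending only on `(X̂, X)` with respect to
the reference plan is causal. -/
lemma mem_causalLaws_of_lintegral [IsProbabilityMeasure μ] [IsMarkovKernel κ] [IsMarkovKernel qX]
    {m : X → X → ℝ≥0∞} (hm : Measurable (Function.uncurry m))
    (hm1 : ∀ xh, ∫⁻ x, m xh x ∂(qX xh) = 1)
    (h : ∀ F : (X × X) × Y → ℝ≥0∞, Measurable F → ∫⁻ ω, F ((ω.1.1, ω.2.1), ω.1.2) ∂γ
      = ∫⁻ xh, ∫⁻ yh, ∫⁻ x, F ((xh, x), yh) * m xh x ∂(qX xh) ∂(κ xh) ∂μ) :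
    γ ∈ causalLaws μ κ := by
  have hfst : γ.fst = μ.compProd κ := by
    refine Measure.ext_of_lintegral _ fun F hF => ?_
    rw [Measure.fst, lintegral_map hF measurable_fst, Measure.lintegral_compProd hF]
    have := h (fun z => F (z.1.1, z.2)) (by fun_prop)
    simp only [Prod.mk.eta] at this
    rw [this]
    refine lintegral_congr fun xh => lintegral_congr fun yh => ?_
    rw [lintegral_const_mul _ (by exact hm.comp measurable_prodMk_left), hm1, mul_one]
  have := isProbabilityMeasure_of_fst_eq hfst
  refine ⟨hfst, Measure.ext_of_lintegral _ fun F hF => ?_⟩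
  have hF1 : Measurable fun z : X × X => ∫⁻ yh, F (z, yh) ∂(κ z.1) :=
    Measurable.lintegral_kernel_prod_right (κ := κ.comap Prod.fst measurable_fst)
      (f := fun z yh => F (z, yh)) hF
  have hm' : ∀ xh, Measurable (m xh) := fun xh => hm.comp measurable_prodMk_left
  rw [lintegral_map hF (by fun_prop), h F hF, Measure.lintegral_compProd hF]
  simp only [Kernel.comap_apply]
  rw [lintegral_map hF1 (by fun_prop)]
  have h2 := h (fun z => ∫⁻ yh, F (z.1, yh) ∂(κ z.1.1)) (hF1.comp measurable_fst)
  rw [h2]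
  refine lintegral_congr fun xh => ?_
  dsimp only
  -- Since `m` does not involve `ŷ`, Fubini lets `ŷ` be integrated first, against `κ x̂`, with the
  -- density as a constant factor.
  rw [lintegral_const, measure_univ, mul_one, lintegral_lintegral_swap]
  · refine lintegral_congr fun x => ?_
    exact lintegral_mul_const _ (hF.comp measurable_prodMk_left)
  · exact (((hF.comp (by fun_prop : Measurable fun z : Y × X => ((xh, z.2), z.1))).mul
      ((hm' xh).comp measurable_snd))).aemeasurable

lemma referencePlan_mem_causalLaws [IsProbabilityMeasure μ] [IsMarkovKernel κ]
    [IsMarkovKernel qX] [IsMarkovKernel qY] : referencePlan μ κ qX qY ∈ causalLaws μ κ := by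
  refine mem_causalLaws_of_lintegral (qX := qX) (m := fun _ _ => 1) measurable_const
    (by simp) fun F hF => ?_
  rw [lintegral_referencePlan (by fun_prop)]
  simp

/-- The kernel `κ` is the same for every member, so both defining equations are linear in the law.
-/
lemma sum_smul_mem_causalLaws [IsProbabilityMeasure μ] [IsMarkovKernel κ] {ι : Type*} [Countable ι]
    {w : ι → ℝ≥0∞} (hw : ∑' i, w i = 1) {γ : ι → Measure ((X × Y) × (X × Y))}
    (hγ : ∀ i, γ i ∈ causalLaws μ κ) : (Measure.sum fun i => w i • γ i) ∈ causalLaws μ κ := by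
  have hp := fun i => isProbabilityMeasure_of_mem_causalLaws (hγ i)
  constructor
  · rw [Measure.fst, Measure.map_sum measurable_fst.aemeasurable]
    ext s hs
    rw [Measure.sum_apply _ hs]
    have h1 : ∀ i, ((γ i).map Prod.fst) s = (μ.compProd κ) s := fun i =>
      congrArg (fun m => m s) (hγ i).1
    simp only [Measure.map_smul, Measure.smul_apply, smul_eq_mul, h1]
    rw [ENNReal.tsum_mul_right, hw, one_mul]
  · rw [Measure.map_sum (by fun_prop), Measure.map_sum (by fun_prop)]
    simp only [Measure.map_smul]
    rw [Measure.compProd_sum_left]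
    congr 1
    ext1 i
    rw [(hγ i).2, Measure.compProd_smul_left]

section Integrals

variable [IsProbabilityMeasure μ] [IsMarkovKernel κ]

lemma integral_fst_of_mem_causalLaws (hγ : γ ∈ causalLaws μ κ) {b : X → ℝ}
    (hb : Measurable b) : ∫ ω, b ω.1.1 ∂γ = ∫ xh, b xh ∂μ := by
  have h1 : γ.map (fun ω => ω.1.1) = μ := by
    rw [← Measure.fst_compProd μ κ, ← hγ.1, Measure.fst, Measure.fst,
      Measure.map_map measurable_fst measurable_fst]; rfl
  rw [← integral_map (by fun_prop : AEMeasurable (fun ω : (X × Y) × (X × Y) => ω.1.1) γ)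
    hb.aestronglyMeasurable, h1]

/-- The step where causality enters weak duality: given `(X̂, X)`, the variable `Ŷ` has law `κ X̂`,
so an inner potential may be replaced by its `κ`-average. -/
lemma integral_of_mem_causalLaws (hγ : γ ∈ causalLaws μ κ) {a : Y → X → ℝ} {C : ℝ}
    (ha : Measurable (Function.uncurry a)) (hb : ∀ yh x, a yh x ∈ Set.Icc 0 C) :
    ∫ ω, a ω.1.2 ω.2.1 ∂γ = ∫ ω, (∫ yh, a yh ω.2.1 ∂(κ ω.1.1)) ∂γ := by
  have := isProbabilityMeasure_of_mem_causalLaws hγ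
  have hF : Measurable fun z : (X × X) × Y => a z.2 z.1.2 :=
    ha.comp (by fun_prop : Measurable fun z : (X × X) × Y => (z.2, z.1.2))
  have e1 : ∫ ω, a ω.1.2 ω.2.1 ∂γ
      = ∫ z, a z.2 z.1.2 ∂(γ.map (fun ω => ((ω.1.1, ω.2.1), ω.1.2))) :=
    (integral_map (φ := fun ω : (X × Y) × (X × Y) => ((ω.1.1, ω.2.1), ω.1.2))
      (f := fun z : (X × X) × Y => a z.2 z.1.2) (by fun_prop)
      hF.aestronglyMeasurable).symm
  have hmk : IsFiniteMeasure (γ.map (fun ω => (ω.1.1, ω.2.1))) := by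
    infer_instance
  have hG : StronglyMeasurable fun z : X × X => ∫ yh, a yh z.2 ∂(κ z.1) :=
    StronglyMeasurable.integral_kernel_prod_right (κ := κ.comap Prod.fst measurable_fst)
      (f := fun z yh => a yh z.2) hF.stronglyMeasurable
  rw [e1, hγ.2, Measure.integral_compProd]
  · simp only [Kernel.comap_apply]
    rw [integral_map (by fun_prop) hG.aestronglyMeasurable]
  · refine Integrable.of_bound hF.aestronglyMeasurable C (ae_of_all _ fun z => ?_)
    rw [Real.norm_of_nonneg (hb _ _).1]
    exact (hb _ _).2

end Integrals

end CausalLaws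

/-! ### Potentials, the causal Gibbs plan, and duality for bounded losses. -/

section Dual

variable {X Y : Type*} [MeasurableSpace X] [MeasurableSpace Y]

/-- The nested log-mean-exp functional appearing in the dual problem. -/
noncomputable def softDual (τ : ℝ) (μ : Measure X) (κ : Kernel X Y) (qX : Kernel X X)
    (qY : Kernel Y Y) (φ : X → Y → ℝ≥0∞) : ℝ≥0∞ :=
  ∫⁻ xh, logMeanExp τ (qX xh) (fun x => ∫⁻ yh, logMeanExp τ (qY yh) (φ x) ∂(κ xh)) ∂μ

variable {τ C : ℝ} {μ : Measure X} {κ : Kernel X Y} {qX : Kernel X X} {qY : Kernel Y Y}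
  [IsProbabilityMeasure μ] [IsMarkovKernel κ] [IsMarkovKernel qX] [IsMarkovKernel qY]

lemma measurable_logMeanExp_inner (hτ : 0 < τ) {φ : X → Y → ℝ≥0∞}
    (hφ : Measurable (Function.uncurry φ)) :
    Measurable fun z : Y × X => logMeanExp τ (qY z.1) (φ z.2) := by
  refine measurable_logMeanExp (T := Y × X) hτ (qY.comap Prod.fst measurable_fst)
    (h := fun z y => φ z.2 y) ?_
  exact hφ.comp (by fun_prop : Measurable fun z : (Y × X) × Y => (z.1.2, z.2))

lemma measurable_lintegral_logMeanExp (hτ : 0 < τ) {φ : X → Y → ℝ≥0∞}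
    (hφ : Measurable (Function.uncurry φ)) :
    Measurable fun z : X × X => ∫⁻ yh, logMeanExp τ (qY yh) (φ z.2) ∂(κ z.1) := by
  refine Measurable.lintegral_kernel_prod_right (κ := κ.comap Prod.fst measurable_fst)
    (f := fun z yh => logMeanExp τ (qY yh) (φ z.2)) ?_
  exact (measurable_logMeanExp_inner hτ hφ).comp
    (by fun_prop : Measurable fun z : (X × X) × Y => (z.2, z.1.2))

lemma measurable_softDual_integrand (hτ : 0 < τ) {φ : X → Y → ℝ≥0∞}
    (hφ : Measurable (Function.uncurry φ)) :
    Measurable fun xh => logMeanExp τ (qX xh)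
      (fun x => ∫⁻ yh, logMeanExp τ (qY yh) (φ x) ∂(κ xh)) :=
  measurable_logMeanExp hτ qX (measurable_lintegral_logMeanExp hτ hφ)

/-- Subtracting the log-mean-exp is exactly division by the partition function. -/
lemma lintegral_exp_sub_realLogMeanExp {S : Type*} [MeasurableSpace S] {ν : Measure S}
    [IsProbabilityMeasure ν] (hτ : 0 < τ) {h : S → ℝ} (hm : Measurable h)
    (hb : ∀ s, h s ∈ Set.Icc 0 C) :
    ∫⁻ s, ENNReal.ofReal (Real.exp ((h s - realLogMeanExp τ ν h) / τ)) ∂ν = 1 := by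
  simp_rw [sub_div, Real.exp_sub, exp_realLogMeanExp_div hτ hm hb]
  have hpos := (integral_exp_div_mem_Icc (μ := ν) hτ hm hb).1
  rw [← ofReal_integral_eq_lintegral_ofReal
    ((integrable_exp_div_of_mem_Icc hτ hm hb).div_const _) (ae_of_all _ fun s => by positivity),
    integral_div, div_self (by linarith), ENNReal.ofReal_one]

variable (τ κ qX qY) in
/-- The inner potential `τ log ∫ exp (φ (x, y) / τ) qY(ŷ, dy)`. -/
noncomputable def innerPotential (φ : X → Y → ℝ) (yh : Y) (x : X) : ℝ :=
  realLogMeanExp τ (qY yh) (φ x)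

variable (τ κ qX qY) in
/-- The conditional expectation of the inner potential given `X̂`. -/
noncomputable def meanPotential (φ : X → Y → ℝ) (xh x : X) : ℝ :=
  ∫ yh, innerPotential τ qY φ yh x ∂(κ xh)

variable (τ κ qX qY) in
/-- The outer potential, obtained by a log-mean-exp over `x`. -/
noncomputable def outerPotential (φ : X → Y → ℝ) (xh : X) : ℝ :=
  realLogMeanExp τ (qX xh) (meanPotential τ κ qY φ xh)

variable (τ κ qX qY) in
/-- The exponent of the density of the causal Gibbs plan. -/
noncomputable def gibbsExponent (φ : X → Y → ℝ) (ω : (X × Y) × (X × Y)) : ℝ :=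
  (φ ω.2.1 ω.2.2 - innerPotential τ qY φ ω.1.2 ω.2.1) / τ
    + (meanPotential τ κ qY φ ω.1.1 ω.2.1 - outerPotential τ κ qX qY φ ω.1.1) / τ

variable {φ : X → Y → ℝ}

lemma measurable_innerPotential (hφ : Measurable (Function.uncurry φ)) :
    Measurable (Function.uncurry (innerPotential τ qY φ)) := by
  refine measurable_realLogMeanExp (T := Y × X) (qY.comap Prod.fst measurable_fst)
    (h := fun z y => φ z.2 y) ?_
  exact hφ.comp (by fun_prop : Measurable fun z : (Y × X) × Y => (z.1.2, z.2))

lemma innerPotential_mem_Icc (hτ : 0 < τ) (hφ : Measurable (Function.uncurry φ))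
    (hb : ∀ x y, φ x y ∈ Set.Icc 0 C) (yh : Y) (x : X) :
    innerPotential τ qY φ yh x ∈ Set.Icc 0 C :=
  realLogMeanExp_mem_Icc hτ (hφ.comp measurable_prodMk_left) (hb x)

lemma measurable_meanPotential (hφ : Measurable (Function.uncurry φ)) :
    Measurable (Function.uncurry (meanPotential τ κ qY φ)) := by
  refine (StronglyMeasurable.integral_kernel_prod_right (κ := κ.comap Prod.fst measurable_fst)
    (f := fun (z : X × X) yh => innerPotential τ qY φ yh z.2)
    (Measurable.stronglyMeasurable ?_)).measurable
  exact (measurable_innerPotential hφ).comp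
    (by fun_prop : Measurable fun z : (X × X) × Y => (z.2, z.1.2))

lemma integrable_innerPotential (hτ : 0 < τ) (hφ : Measurable (Function.uncurry φ))
    (hb : ∀ x y, φ x y ∈ Set.Icc 0 C) (xh x : X) :
    Integrable (fun yh => innerPotential τ qY φ yh x) (κ xh) := by
  refine Integrable.of_bound ((measurable_innerPotential hφ).comp
    (by fun_prop : Measurable fun yh : Y => (yh, x))).aestronglyMeasurable C
    (ae_of_all _ fun yh => ?_)
  rw [Real.norm_of_nonneg (innerPotential_mem_Icc hτ hφ hb yh x).1]
  exact (innerPotential_mem_Icc hτ hφ hb yh x).2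

lemma meanPotential_mem_Icc (hτ : 0 < τ) (hφ : Measurable (Function.uncurry φ))
    (hb : ∀ x y, φ x y ∈ Set.Icc 0 C) (xh x : X) :
    meanPotential τ κ qY φ xh x ∈ Set.Icc 0 C := by
  refine ⟨integral_nonneg fun yh => (innerPotential_mem_Icc hτ hφ hb yh x).1, ?_⟩
  calc _ ≤ ∫ _, C ∂(κ xh) := integral_mono (integrable_innerPotential hτ hφ hb xh x) (by simp)
        fun yh => (innerPotential_mem_Icc hτ hφ hb yh x).2
    _ = C := by simp

lemma measurable_outerPotential (hφ : Measurable (Function.uncurry φ)) :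
    Measurable (outerPotential τ κ qX qY φ) :=
  measurable_realLogMeanExp qX (measurable_meanPotential hφ)

lemma outerPotential_mem_Icc (hτ : 0 < τ) (hφ : Measurable (Function.uncurry φ))
    (hb : ∀ x y, φ x y ∈ Set.Icc 0 C) (xh : X) :
    outerPotential τ κ qX qY φ xh ∈ Set.Icc 0 C :=
  realLogMeanExp_mem_Icc hτ ((measurable_meanPotential hφ).comp measurable_prodMk_left)
    (meanPotential_mem_Icc hτ hφ hb xh)

lemma measurable_gibbsExponent (hφ : Measurable (Function.uncurry φ)) :
    Measurable (gibbsExponent τ κ qX qY φ) := by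
  have h1 : Measurable fun ω : (X × Y) × (X × Y) => φ ω.2.1 ω.2.2 :=
    hφ.comp (by fun_prop : Measurable fun ω : (X × Y) × (X × Y) => (ω.2.1, ω.2.2))
  have h2 : Measurable fun ω : (X × Y) × (X × Y) => innerPotential τ qY φ ω.1.2 ω.2.1 :=
    (measurable_innerPotential hφ).comp
      (by fun_prop : Measurable fun ω : (X × Y) × (X × Y) => (ω.1.2, ω.2.1))
  have h3 : Measurable fun ω : (X × Y) × (X × Y) => meanPotential τ κ qY φ ω.1.1 ω.2.1 :=
    (measurable_meanPotential hφ).comp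
      (by fun_prop : Measurable fun ω : (X × Y) × (X × Y) => (ω.1.1, ω.2.1))
  have h4 : Measurable fun ω : (X × Y) × (X × Y) => outerPotential τ κ qX qY φ ω.1.1 :=
    (measurable_outerPotential hφ).comp (by fun_prop)
  exact ((h1.sub h2).div_const τ).add ((h3.sub h4).div_const τ)

lemma softDual_ofReal (hτ : 0 < τ) (hφ : Measurable (Function.uncurry φ))
    (hb : ∀ x y, φ x y ∈ Set.Icc 0 C) :
    softDual τ μ κ qX qY (fun x y => ENNReal.ofReal (φ x y))
      = ENNReal.ofReal (∫ xh, outerPotential τ κ qX qY φ xh ∂μ) := by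
  have e1 : ∀ x yh, logMeanExp τ (qY yh) (fun y => ENNReal.ofReal (φ x y))
      = ENNReal.ofReal (innerPotential τ qY φ yh x) := fun x yh =>
    logMeanExp_ofReal hτ (hφ.comp measurable_prodMk_left) (hb x)
  have e2 : ∀ xh x, ∫⁻ yh, ENNReal.ofReal (innerPotential τ qY φ yh x) ∂(κ xh)
      = ENNReal.ofReal (meanPotential τ κ qY φ xh x) := fun xh x =>
    (ofReal_integral_eq_lintegral_ofReal (integrable_innerPotential hτ hφ hb xh x)
      (ae_of_all _ fun yh => (innerPotential_mem_Icc hτ hφ hb yh x).1)).symm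
  have e3 : ∀ xh, logMeanExp τ (qX xh) (fun x => ENNReal.ofReal (meanPotential τ κ qY φ xh x))
      = ENNReal.ofReal (outerPotential τ κ qX qY φ xh) := fun xh =>
    logMeanExp_ofReal hτ ((measurable_meanPotential hφ).comp measurable_prodMk_left)
      (meanPotential_mem_Icc hτ hφ hb xh)
  simp only [softDual, e1, e2, e3]
  refine (ofReal_integral_eq_lintegral_ofReal ?_
    (ae_of_all _ fun xh => (outerPotential_mem_Icc hτ hφ hb xh).1)).symm
  refine Integrable.of_bound (measurable_outerPotential hφ).aestronglyMeasurable C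
    (ae_of_all _ fun xh => ?_)
  rw [Real.norm_of_nonneg (outerPotential_mem_Icc hτ hφ hb xh).1]
  exact (outerPotential_mem_Icc hτ hφ hb xh).2

/-- The test function does not see `y`, so integrating `y` out turns the first factor of the density
into `1`. What is left depends on `(x̂, x)` alone, which yields both normalization and causality of
the Gibbs plan. -/
lemma lintegral_exp_gibbsExponent_mul (hτ : 0 < τ) (hφ : Measurable (Function.uncurry φ))
    (hb : ∀ x y, φ x y ∈ Set.Icc 0 C) {F : (X × X) × Y → ℝ≥0∞} (hF : Measurable F) :
    ∫⁻ ω, ENNReal.ofReal (Real.exp (gibbsExponent τ κ qX qY φ ω)) *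
        F ((ω.1.1, ω.2.1), ω.1.2) ∂(referencePlan μ κ qX qY)
      = ∫⁻ xh, ∫⁻ yh, ∫⁻ x, F ((xh, x), yh) * ENNReal.ofReal (Real.exp
          ((meanPotential τ κ qY φ xh x - outerPotential τ κ qX qY φ xh) / τ))
          ∂(qX xh) ∂(κ xh) ∂μ := by
  rw [lintegral_referencePlan]
  · refine lintegral_congr fun xh => lintegral_congr fun yh => lintegral_congr fun x => ?_
    have hy : Measurable fun y => ENNReal.ofReal (Real.exp
        ((φ x y - innerPotential τ qY φ yh x) / τ)) := by
      have : Measurable (φ x) := hφ.comp measurable_prodMk_left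
      fun_prop
    simp only [gibbsExponent, Real.exp_add, ENNReal.ofReal_mul (Real.exp_nonneg _), mul_assoc]
    rw [lintegral_mul_const _ hy, innerPotential,
      lintegral_exp_sub_realLogMeanExp (h := φ x) hτ (hφ.comp measurable_prodMk_left) (hb x),
      one_mul,
      mul_comm]
  · have := measurable_gibbsExponent (τ := τ) (κ := κ) (qX := qX) (qY := qY) hφ
    fun_prop

lemma lintegral_exp_meanPotential (hτ : 0 < τ) (hφ : Measurable (Function.uncurry φ))
    (hb : ∀ x y, φ x y ∈ Set.Icc 0 C) (xh : X) :
    ∫⁻ x, ENNReal.ofReal (Real.exp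
      ((meanPotential τ κ qY φ xh x - outerPotential τ κ qX qY φ xh) / τ)) ∂(qX xh) = 1 :=
  lintegral_exp_sub_realLogMeanExp hτ ((measurable_meanPotential hφ).comp measurable_prodMk_left)
    (meanPotential_mem_Icc hτ hφ hb xh)

lemma lintegral_exp_gibbsExponent (hτ : 0 < τ) (hφ : Measurable (Function.uncurry φ))
    (hb : ∀ x y, φ x y ∈ Set.Icc 0 C) :
    ∫⁻ ω, ENNReal.ofReal (Real.exp (gibbsExponent τ κ qX qY φ ω))
      ∂(referencePlan μ κ qX qY) = 1 := by
  have := lintegral_exp_gibbsExponent_mul (μ := μ) (κ := κ) (qX := qX) (qY := qY) hτ hφ hb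
    (F := fun _ => 1) measurable_const
  simpa [lintegral_exp_meanPotential hτ hφ hb] using this

lemma integrable_exp_gibbsExponent (hτ : 0 < τ) (hφ : Measurable (Function.uncurry φ))
    (hb : ∀ x y, φ x y ∈ Set.Icc 0 C) :
    Integrable (fun ω => Real.exp (gibbsExponent τ κ qX qY φ ω)) (referencePlan μ κ qX qY) := by
  have hm : Measurable fun ω => Real.exp (gibbsExponent τ κ qX qY φ ω) :=
    Real.measurable_exp.comp (measurable_gibbsExponent hφ)
  refine (lintegral_ofReal_ne_top_iff_integrable hm.aestronglyMeasurable
    (ae_of_all _ fun ω => Real.exp_nonneg _)).1 ?_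
  rw [lintegral_exp_gibbsExponent hτ hφ hb]
  exact ENNReal.one_ne_top

lemma integral_exp_gibbsExponent (hτ : 0 < τ) (hφ : Measurable (Function.uncurry φ))
    (hb : ∀ x y, φ x y ∈ Set.Icc 0 C) :
    ∫ ω, Real.exp (gibbsExponent τ κ qX qY φ ω) ∂(referencePlan μ κ qX qY) = 1 := by
  rw [integral_eq_lintegral_of_nonneg_ae (ae_of_all _ fun ω => Real.exp_nonneg _)
    (integrable_exp_gibbsExponent hτ hφ hb).aestronglyMeasurable,
    lintegral_exp_gibbsExponent hτ hφ hb, ENNReal.toReal_one]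

lemma integrable_of_mem_Icc {Ω : Type*} [MeasurableSpace Ω] {γ : Measure Ω} [IsFiniteMeasure γ]
    {h : Ω → ℝ} (hm : Measurable h) (hb : ∀ ω, h ω ∈ Set.Icc 0 C) : Integrable h γ := by
  refine Integrable.of_bound hm.aestronglyMeasurable C (ae_of_all _ fun ω => ?_)
  rw [Real.norm_of_nonneg (hb ω).1]
  exact (hb ω).2

/-- Under a causal law, the Gibbs exponent integrates to the gap between the mean of `φ` and the
dual value. -/
lemma integral_gibbsExponent (hτ : 0 < τ) (hφ : Measurable (Function.uncurry φ))
    (hb : ∀ x y, φ x y ∈ Set.Icc 0 C) {γ : Measure ((X × Y) × (X × Y))}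
    (hγ : γ ∈ causalLaws μ κ) :
    Integrable (gibbsExponent τ κ qX qY φ) γ ∧ ∫ ω, gibbsExponent τ κ qX qY φ ω ∂γ
      = (∫ ω, φ ω.2.1 ω.2.2 ∂γ - ∫ xh, outerPotential τ κ qX qY φ xh ∂μ) / τ := by
  have := isProbabilityMeasure_of_mem_causalLaws hγ
  have h1 : Integrable (fun ω : (X × Y) × (X × Y) => φ ω.2.1 ω.2.2) γ :=
    integrable_of_mem_Icc (hφ.comp
      (by fun_prop : Measurable fun ω : (X × Y) × (X × Y) => (ω.2.1, ω.2.2))) fun _ => hb _ _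
  have h2 : Integrable (fun ω : (X × Y) × (X × Y) => innerPotential τ qY φ ω.1.2 ω.2.1) γ :=
    integrable_of_mem_Icc ((measurable_innerPotential hφ).comp
      (by fun_prop : Measurable fun ω : (X × Y) × (X × Y) => (ω.1.2, ω.2.1)))
      fun _ => innerPotential_mem_Icc hτ hφ hb _ _
  have h3 : Integrable (fun ω : (X × Y) × (X × Y) => meanPotential τ κ qY φ ω.1.1 ω.2.1) γ :=
    integrable_of_mem_Icc ((measurable_meanPotential hφ).comp
      (by fun_prop : Measurable fun ω : (X × Y) × (X × Y) => (ω.1.1, ω.2.1)))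
      fun _ => meanPotential_mem_Icc hτ hφ hb _ _
  have h4 : Integrable (fun ω : (X × Y) × (X × Y) => outerPotential τ κ qX qY φ ω.1.1) γ :=
    integrable_of_mem_Icc ((measurable_outerPotential hφ).comp
      (by fun_prop)) fun _ => outerPotential_mem_Icc hτ hφ hb _
  -- This makes the inner and mean potentials cancel in the integrated exponent.
  have h5 := integral_of_mem_causalLaws hγ (measurable_innerPotential (τ := τ) (qY := qY) hφ)
    (innerPotential_mem_Icc hτ hφ hb)
  refine ⟨((h1.sub h2).div_const τ).add ((h3.sub h4).div_const τ), ?_⟩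
  simp only [gibbsExponent]
  rw [integral_add (by exact (h1.sub h2).div_const τ) (by exact (h3.sub h4).div_const τ),
    integral_div, integral_div, integral_sub h1 h2, integral_sub h3 h4, h5,
    integral_fst_of_mem_causalLaws hγ (measurable_outerPotential hφ)]
  simp only [meanPotential]
  ring

open InformationTheory

/-- Weak duality for bounded losses. -/
lemma integral_le_of_mem_causalLaws (hτ : 0 < τ) (hφ : Measurable (Function.uncurry φ))
    (hb : ∀ x y, φ x y ∈ Set.Icc 0 C) {γ : Measure ((X × Y) × (X × Y))}
    (hγ : γ ∈ causalLaws μ κ) (hkl : klDiv γ (referencePlan μ κ qX qY) ≠ ⊤) :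
    ∫ ω, φ ω.2.1 ω.2.2 ∂γ ≤ τ * (klDiv γ (referencePlan μ κ qX qY)).toReal
      + ∫ xh, outerPotential τ κ qX qY φ xh ∂μ := by
  have := isProbabilityMeasure_of_mem_causalLaws hγ
  obtain ⟨hi, he⟩ := integral_gibbsExponent (qX := qX) (qY := qY) hτ hφ hb hγ
  have h1 := integral_le_toReal_klDiv hkl hi (integrable_exp_gibbsExponent hτ hφ hb)
    (integral_exp_gibbsExponent hτ hφ hb)
  rw [he, div_le_iff₀ hτ] at h1
  linarith

/-- The causal Gibbs plan attains the dual value for bounded losses. -/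
lemma exists_integral_eq (hτ : 0 < τ) (hφ : Measurable (Function.uncurry φ))
    (hb : ∀ x y, φ x y ∈ Set.Icc 0 C) : ∃ γ ∈ causalLaws μ κ,
      klDiv γ (referencePlan μ κ qX qY) ≠ ⊤ ∧
      ∫ ω, φ ω.2.1 ω.2.2 ∂γ = τ * (klDiv γ (referencePlan μ κ qX qY)).toReal
        + ∫ xh, outerPotential τ κ qX qY φ xh ∂μ := by
  have hint := integrable_exp_gibbsExponent (μ := μ) (κ := κ) (qX := qX) (qY := qY) hτ hφ hb
  have h1 := integral_exp_gibbsExponent (μ := μ) (κ := κ) (qX := qX) (qY := qY) hτ hφ hb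
  have hmem : (referencePlan μ κ qX qY).tilted (gibbsExponent τ κ qX qY φ) ∈ causalLaws μ κ := by
    refine mem_causalLaws_of_lintegral (qX := qX) (m := fun xh x => ENNReal.ofReal (Real.exp
      ((meanPotential τ κ qY φ xh x - outerPotential τ κ qX qY φ xh) / τ))) ?_
      (lintegral_exp_meanPotential hτ hφ hb) fun F hF => ?_
    · have h3 := measurable_meanPotential (τ := τ) (κ := κ) (qY := qY) hφ
      have h4 : Measurable fun z : X × X => outerPotential τ κ qX qY φ z.1 :=
        (measurable_outerPotential hφ).comp measurable_fst
      exact (Real.measurable_exp.comp ((h3.sub h4).div_const τ)).ennreal_ofReal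
    -- The partition function is `1`, so tilting multiplies by exactly `exp` of the exponent.
    · rw [lintegral_tilted, ← lintegral_exp_gibbsExponent_mul hτ hφ hb hF]
      simp [h1]
  obtain ⟨hi, he⟩ := integral_gibbsExponent (qX := qX) (qY := qY) hτ hφ hb hmem
  obtain ⟨hk, hk'⟩ := klDiv_tilted_self hint h1 hi
  refine ⟨_, hmem, hk, ?_⟩
  rw [hk', he]
  field_simp
  ring

end Dual

/-! ### Removing truncations by monotone convergence. -/

section SoftDual

variable {X Y : Type*} [MeasurableSpace X] [MeasurableSpace Y] {τ : ℝ} {μ : Measure X}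
  {κ : Kernel X Y} {qX : Kernel X X} {qY : Kernel Y Y}

lemma softDual_mono (hτ : 0 < τ) {φ ψ : X → Y → ℝ≥0∞} (h : ∀ x y, φ x y ≤ ψ x y) :
    softDual τ μ κ qX qY φ ≤ softDual τ μ κ qX qY ψ :=
  lintegral_mono fun _ => logMeanExp_mono hτ <| ae_of_all _ fun x => lintegral_mono fun _ =>
    logMeanExp_mono hτ <| ae_of_all _ fun y => h x y

variable [IsMarkovKernel κ] [IsMarkovKernel qX] [IsMarkovKernel qY]

/-- Monotone convergence passes through the four layers in turn: over `x̂`, over `x`, over `ŷ`, and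
over `y`. -/
lemma softDual_iSup (hτ : 0 < τ) {φ : ℕ → X → Y → ℝ≥0∞}
    (hφ : ∀ n, Measurable (Function.uncurry (φ n))) (hmono : Monotone φ) :
    softDual τ μ κ qX qY (fun x y => ⨆ n, φ n x y) = ⨆ n, softDual τ μ κ qX qY (φ n) := by
  simp only [softDual]
  rw [← lintegral_iSup (fun n => measurable_softDual_integrand hτ (hφ n))
    (fun a b hab xh => logMeanExp_mono hτ <| ae_of_all _ fun x => lintegral_mono fun yh =>
      logMeanExp_mono hτ <| ae_of_all _ fun y => hmono hab x y)]
  refine lintegral_congr fun xh => ?_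
  refine Eq.trans ?_ (logMeanExp_iSup
    (h := fun n x => ∫⁻ yh, logMeanExp τ (qY yh) (φ n x) ∂(κ xh)) hτ
    (fun n => (measurable_lintegral_logMeanExp hτ (hφ n)).comp measurable_prodMk_left)
    (fun a b hab x => lintegral_mono fun yh =>
      logMeanExp_mono hτ <| ae_of_all _ fun y => hmono hab x y))
  congr 1
  ext1 x
  refine Eq.trans ?_ (lintegral_iSup
    (f := fun n yh => logMeanExp τ (qY yh) (φ n x))
    (fun n => (measurable_logMeanExp_inner hτ (hφ n)).comp measurable_prodMk_right)
    (fun a b hab yh => logMeanExp_mono hτ <| ae_of_all _ fun y => hmono hab x y))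
  refine lintegral_congr fun yh => ?_
  exact logMeanExp_iSup (h := fun n => φ n x) hτ
    (fun n => (hφ n).comp measurable_prodMk_left) fun a b hab => hmono hab x

lemma softDual_le_of_forall_min (hτ : 0 < τ) {φ : X → Y → ℝ≥0∞}
    (hφ : Measurable (Function.uncurry φ)) {c : ℝ≥0∞}
    (h : ∀ n : ℕ, softDual τ μ κ qX qY (fun x y => min (φ x y) n) ≤ c) :
    softDual τ μ κ qX qY φ ≤ c := by
  have e : φ = fun x y => ⨆ n : ℕ, min (φ x y) n := by
    ext x y
    rw [← inf_iSup_eq, ENNReal.iSup_natCast, inf_top_eq]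
  rw [e, softDual_iSup (φ := fun n x y => min (φ x y) (n : ℝ≥0∞)) hτ
    (fun n => hφ.min measurable_const)
    (fun a b hab x y => min_le_min_left _ (by exact_mod_cast hab))]
  exact iSup_le h

lemma lintegral_eq_iSup_min {Ω : Type*} [MeasurableSpace Ω] {γ : Measure Ω} {h : Ω → ℝ≥0∞}
    (hm : Measurable h) : ∫⁻ ω, h ω ∂γ = ⨆ n : ℕ, ∫⁻ ω, min (h ω) n ∂γ := by
  rw [← lintegral_iSup (fun n => hm.min measurable_const)
    (fun a b hab ω => min_le_min_left _ (by exact_mod_cast hab))]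
  refine lintegral_congr fun ω => ?_
  rw [← inf_iSup_eq, ENNReal.iSup_natCast, inf_top_eq]

end SoftDual

/-! ### Duality over entropy balls for losses in `[0, ∞]`. -/

section Duality

open InformationTheory

variable {X Y : Type*} [MeasurableSpace X] [MeasurableSpace Y]
  {τ : ℝ} {μ : Measure X} {κ : Kernel X Y} {qX : Kernel X X} {qY : Kernel Y Y}
  [IsProbabilityMeasure μ] [IsMarkovKernel κ] [IsMarkovKernel qX] [IsMarkovKernel qY]
  {φ : X → Y → ℝ≥0∞} {γ : Measure ((X × Y) × (X × Y))}

lemma ofReal_toReal_min (a : ℝ≥0∞) (n : ℕ) : ENNReal.ofReal (min a n).toReal = min a n :=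
  ENNReal.ofReal_toReal (ne_top_of_le_ne_top (ENNReal.natCast_ne_top n) (min_le_right _ _))

lemma toReal_min_mem_Icc (a : ℝ≥0∞) (n : ℕ) : (min a n).toReal ∈ Set.Icc 0 (n : ℝ) :=
  ⟨ENNReal.toReal_nonneg, by
    simpa using ENNReal.toReal_mono (ENNReal.natCast_ne_top n) (min_le_right a n)⟩

lemma measurable_uncurry_loss (hφ : Measurable (Function.uncurry φ)) :
    Measurable fun ω : (X × Y) × (X × Y) => φ ω.2.1 ω.2.2 :=
  hφ.comp measurable_snd

lemma lintegral_min_eq_ofReal_integral [IsFiniteMeasure γ] (hφ : Measurable (Function.uncurry φ))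
    (n : ℕ) : ∫⁻ ω, min (φ ω.2.1 ω.2.2) n ∂γ
      = ENNReal.ofReal (∫ ω, (min (φ ω.2.1 ω.2.2) n).toReal ∂γ) := by
  rw [ofReal_integral_eq_lintegral_ofReal (integrable_of_mem_Icc
    ((measurable_uncurry_loss hφ).min measurable_const).ennreal_toReal
    fun ω => toReal_min_mem_Icc _ n) (ae_of_all _ fun ω => ENNReal.toReal_nonneg)]
  simp only [ofReal_toReal_min]

/-- Weak duality: the mean loss of a causal law is bounded by the penalized dual functional. -/
lemma lintegral_le_mul_klDiv_add_softDual (hτ : 0 < τ) (hφ : Measurable (Function.uncurry φ))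
    (hγ : γ ∈ causalLaws μ κ) (hkl : klDiv γ (referencePlan μ κ qX qY) ≠ ⊤) :
    ∫⁻ ω, φ ω.2.1 ω.2.2 ∂γ ≤ ENNReal.ofReal τ * klDiv γ (referencePlan μ κ qX qY)
      + softDual τ μ κ qX qY φ := by
  have := isProbabilityMeasure_of_mem_causalLaws hγ
  rw [lintegral_eq_iSup_min (measurable_uncurry_loss hφ)]
  refine iSup_le fun n => ?_
  have h1 := integral_le_of_mem_causalLaws hτ
    (φ := fun x y => (min (φ x y) n).toReal) (hφ.min measurable_const).ennreal_toReal
    (fun x y => toReal_min_mem_Icc _ n) hγ hkl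
  have h2 := softDual_ofReal (μ := μ) (κ := κ) (qX := qX) (qY := qY) hτ
    (φ := fun x y => (min (φ x y) n).toReal) (hφ.min measurable_const).ennreal_toReal
    (fun x y => toReal_min_mem_Icc _ n)
  simp only [ofReal_toReal_min] at h2
  calc _ ≤ _ := (lintegral_min_eq_ofReal_integral hφ n).le.trans (ENNReal.ofReal_le_ofReal h1)
    _ ≤ _ := ENNReal.ofReal_add_le
    _ ≤ _ := by
      rw [ENNReal.ofReal_mul hτ.le, ENNReal.ofReal_toReal hkl, ← h2]
      exact add_le_add_right (softDual_mono hτ fun x y => min_le_left _ _) _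

/-- Attainment of the dual functional for a truncated loss. -/
lemma exists_lintegral_min_eq (hτ : 0 < τ) (hφ : Measurable (Function.uncurry φ)) (n : ℕ) :
    ∃ γ ∈ causalLaws μ κ, klDiv γ (referencePlan μ κ qX qY) ≠ ⊤ ∧
      ∫⁻ ω, min (φ ω.2.1 ω.2.2) n ∂γ = ENNReal.ofReal τ * klDiv γ (referencePlan μ κ qX qY)
        + softDual τ μ κ qX qY (fun x y => min (φ x y) n) := by
  have hm : Measurable (Function.uncurry fun x y => (min (φ x y) n).toReal) :=
    (hφ.min measurable_const).ennreal_toReal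
  obtain ⟨γ, hγ, hkl, he⟩ := exists_integral_eq (μ := μ) (κ := κ) (qX := qX) (qY := qY) hτ hm
    (fun x y => toReal_min_mem_Icc _ n)
  have := isProbabilityMeasure_of_mem_causalLaws hγ
  have h2 := softDual_ofReal (μ := μ) (κ := κ) (qX := qX) (qY := qY) hτ hm
    (fun x y => toReal_min_mem_Icc _ n)
  simp only [ofReal_toReal_min] at h2
  refine ⟨γ, hγ, hkl, ?_⟩
  rw [lintegral_min_eq_ofReal_integral hφ n, he, ENNReal.ofReal_add (by positivity)
    (integral_nonneg fun xh => (outerPotential_mem_Icc hτ hm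
      (fun x y => toReal_min_mem_Icc _ n) xh).1), h2, ENNReal.ofReal_mul hτ.le,
    ENNReal.ofReal_toReal hkl]

/-- Two-point mixtures of causal laws. -/
lemma exists_mixture {γ₁ γ₂ : Measure ((X × Y) × (X × Y))} (h₁ : γ₁ ∈ causalLaws μ κ)
    (h₂ : γ₂ ∈ causalLaws μ κ) {ν : Measure ((X × Y) × (X × Y))} [IsProbabilityMeasure ν]
    (hac₁ : γ₁ ≪ ν) (hac₂ : γ₂ ≪ ν) {t : ℝ} (ht0 : 0 ≤ t) (ht1 : t ≤ 1) :
    ∃ γ ∈ causalLaws μ κ,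
      klDiv γ ν ≤ ENNReal.ofReal t * klDiv γ₁ ν + ENNReal.ofReal (1 - t) * klDiv γ₂ ν ∧
      ∀ F : (X × Y) × (X × Y) → ℝ≥0∞, ∫⁻ ω, F ω ∂γ
        = ENNReal.ofReal t * ∫⁻ ω, F ω ∂γ₁ + ENNReal.ofReal (1 - t) * ∫⁻ ω, F ω ∂γ₂ := by
  have hp₁ := isProbabilityMeasure_of_mem_causalLaws h₁
  have hp₂ := isProbabilityMeasure_of_mem_causalLaws h₂
  let w : Bool → ℝ≥0∞ := fun b => bif b then ENNReal.ofReal t else ENNReal.ofReal (1 - t)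
  let g : Bool → Measure ((X × Y) × (X × Y)) := fun b => bif b then γ₁ else γ₂
  have hw : ∑' i, w i = 1 := by
    rw [tsum_bool]
    simp only [w, cond_true, cond_false]
    rw [← ENNReal.ofReal_add (by linarith) ht0]; simp
  have hg : ∀ i, g i ∈ causalLaws μ κ := fun i => by cases i <;> assumption
  have hgp : ∀ i, IsProbabilityMeasure (g i) := fun i =>
    isProbabilityMeasure_of_mem_causalLaws (hg i)
  refine ⟨_, sum_smul_mem_causalLaws hw hg, ?_, fun F => ?_⟩
  · refine (klDiv_sum_smul_le hw (γ := g) (fun i => by cases i <;> assumption)).trans ?_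
    rw [tsum_bool, add_comm]; rfl
  · rw [lintegral_sum_measure, tsum_bool, add_comm]
    simp only [lintegral_smul_measure, smul_eq_mul]; rfl

lemma ac_of_klDiv_ne_top {Ω : Type*} [MeasurableSpace Ω] {α ν : Measure Ω}
    (h : klDiv α ν ≠ ⊤) : α ≪ ν := (klDiv_ne_top_iff.1 h).1

/-- Mixing with the reference plan, of zero entropy, brings any law of finite entropy into the ball;
the bound there forces its own mean loss to be finite. -/
lemma lintegral_ne_top_of_klDiv_ne_top {r V : ℝ} (hr : 0 < r)
    (hV : ∀ γ ∈ causalLaws μ κ, klDiv γ (referencePlan μ κ qX qY) ≤ ENNReal.ofReal r →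
      ∫⁻ ω, φ ω.2.1 ω.2.2 ∂γ ≤ ENNReal.ofReal V)
    (hγ : γ ∈ causalLaws μ κ) (hkl : klDiv γ (referencePlan μ κ qX qY) ≠ ⊤) :
    ∫⁻ ω, φ ω.2.1 ω.2.2 ∂γ ≠ ⊤ := by
  set k := (klDiv γ (referencePlan μ κ qX qY)).toReal with hk
  have hk0 : 0 ≤ k := ENNReal.toReal_nonneg
  -- The weight `t = r / (r + k)` satisfies `t k ≤ r` and stays positive even when `k = 0`.
  have ht0 : 0 < r / (r + k) := by positivity
  have ht1 : r / (r + k) ≤ 1 := (div_le_one (by positivity)).2 (by linarith)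
  obtain ⟨γ', hγ', h1, h2⟩ := exists_mixture hγ referencePlan_mem_causalLaws
    (ac_of_klDiv_ne_top hkl) (Measure.AbsolutelyContinuous.refl (referencePlan μ κ qX qY))
    ht0.le ht1
  have h3 := hV γ' hγ' (h1.trans (by
    rw [klDiv_self, mul_zero, add_zero, ← ENNReal.ofReal_toReal hkl, ← hk,
      ← ENNReal.ofReal_mul ht0.le]
    refine ENNReal.ofReal_le_ofReal ?_
    rw [div_mul_eq_mul_div, div_le_iff₀ (by positivity)]
    nlinarith))
  rw [h2] at h3
  intro htop
  rw [htop, ENNReal.mul_top (by simpa using ht0), top_add] at h3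
  exact ENNReal.ofReal_ne_top (top_le_iff.1 h3)

/-- A supporting line at `r` of the value as a function of the relative entropy. -/
lemma exists_supporting_slope {r V : ℝ} (hr : 0 < r) (hV0 : 0 ≤ V)
    (hV : ∀ γ ∈ causalLaws μ κ, klDiv γ (referencePlan μ κ qX qY) ≤ ENNReal.ofReal r →
      ∫⁻ ω, φ ω.2.1 ω.2.2 ∂γ ≤ ENNReal.ofReal V) :
    ∃ s : ℝ, 0 ≤ s ∧ ∀ γ ∈ causalLaws μ κ, klDiv γ (referencePlan μ κ qX qY) ≠ ⊤ →
      (∫⁻ ω, φ ω.2.1 ω.2.2 ∂γ).toReal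
        ≤ V + s * ((klDiv γ (referencePlan μ κ qX qY)).toReal - r) := by
  set ν := referencePlan μ κ qX qY with hν
  let k : Measure ((X × Y) × (X × Y)) → ℝ := fun γ => (klDiv γ ν).toReal
  let v : Measure ((X × Y) × (X × Y)) → ℝ := fun γ => (∫⁻ ω, φ ω.2.1 ω.2.2 ∂γ).toReal
  let K : Set (Measure ((X × Y) × (X × Y))) := {γ | γ ∈ causalLaws μ κ ∧ klDiv γ ν ≠ ⊤}
  have hle : ∀ γ ∈ K, k γ ≤ r → v γ ≤ V := fun γ hγ hkr => by
    refine ENNReal.toReal_le_of_le_ofReal hV0 (hV γ hγ.1 ?_)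
    rw [← ENNReal.ofReal_toReal hγ.2]
    exact ENNReal.ofReal_le_ofReal hkr
  -- The chord inequality of concavity: slopes from `(r, V)` to points on the right never exceed
  -- slopes to points on the left. It is tested on the mixture whose interpolated entropy is exactly
  -- `r`, which lies in the ball by convexity.
  have hcross : ∀ γ₁ ∈ K, ∀ γ₂ ∈ K, k γ₁ < r → r < k γ₂ →
      (v γ₂ - V) / (k γ₂ - r) ≤ (V - v γ₁) / (r - k γ₁) := by
    intro γ₁ hγ₁ γ₂ hγ₂ h1 h2
    have hd : 0 < k γ₂ - k γ₁ := by linarith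
    set t := (r - k γ₁) / (k γ₂ - k γ₁) with ht
    have ht0 : 0 ≤ t := div_nonneg (by linarith) hd.le
    have ht1 : t ≤ 1 := (div_le_one hd).2 (by linarith)
    have e : t * (k γ₂ - k γ₁) = r - k γ₁ := div_mul_cancel₀ _ hd.ne'
    obtain ⟨γ', hγ', h3, h4⟩ := exists_mixture hγ₂.1 hγ₁.1 (ac_of_klDiv_ne_top hγ₂.2)
      (ac_of_klDiv_ne_top hγ₁.2) ht0 ht1
    have h5 := hV γ' hγ' (h3.trans (by
      rw [← ENNReal.ofReal_toReal hγ₁.2, ← ENNReal.ofReal_toReal hγ₂.2,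
        ← ENNReal.ofReal_mul ht0, ← ENNReal.ofReal_mul (by linarith),
        ← ENNReal.ofReal_add (by positivity)
          (mul_nonneg (by linarith) ENNReal.toReal_nonneg)]
      refine ENNReal.ofReal_le_ofReal (le_of_eq ?_)
      change t * k γ₂ + (1 - t) * k γ₁ = r
      linarith))
    have f1 := lintegral_ne_top_of_klDiv_ne_top hr hV hγ₁.1 hγ₁.2
    have f2 := lintegral_ne_top_of_klDiv_ne_top hr hV hγ₂.1 hγ₂.2
    rw [h4, ← ENNReal.ofReal_toReal f1, ← ENNReal.ofReal_toReal f2,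
      ← ENNReal.ofReal_mul ht0, ← ENNReal.ofReal_mul (by linarith),
      ← ENNReal.ofReal_add (by positivity)
        (mul_nonneg (by linarith) ENNReal.toReal_nonneg), ENNReal.ofReal_le_ofReal_iff hV0] at h5
    change t * v γ₂ + (1 - t) * v γ₁ ≤ V at h5
    rw [div_le_div_iff₀ (by linarith) (by linarith)]
    have e2 : (1 - t) * (k γ₂ - k γ₁) = k γ₂ - r := by linarith
    have h6 := mul_le_mul_of_nonneg_right h5 hd.le
    have e3 : (t * v γ₂ + (1 - t) * v γ₁) * (k γ₂ - k γ₁)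
        = (t * (k γ₂ - k γ₁)) * v γ₂ + ((1 - t) * (k γ₂ - k γ₁)) * v γ₁ := by ring
    rw [e3, e, e2] at h6
    linarith
  -- Slopes to the right of `r`. Adding `0` makes the set nonempty and its supremum nonnegative;
  -- slopes on the left bound it, and the reference plan supplies one because `0 < r`.
  let A : Set ℝ := insert 0 {s | ∃ γ ∈ K, r < k γ ∧ s = (v γ - V) / (k γ - r)}
  have h0K : ν ∈ K := ⟨referencePlan_mem_causalLaws, by rw [klDiv_self]; exact ENNReal.zero_ne_top⟩
  have hk0 : k ν = 0 := by simp [k, klDiv_self]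
  have hub : ∀ γ ∈ K, k γ < r → (V - v γ) / (r - k γ) ∈ upperBounds A := by
    intro γ hγ hk s hs
    rcases hs with rfl | ⟨γ₂, hγ₂, h2, rfl⟩
    · exact div_nonneg (sub_nonneg.2 (hle γ hγ hk.le)) (by linarith)
    · exact hcross γ hγ γ₂ hγ₂ hk h2
  have hbdd : BddAbove A := ⟨_, hub ν h0K (by rw [hk0]; exact hr)⟩
  refine ⟨sSup A, le_csSup hbdd (Set.mem_insert _ _), fun γ hγ hkl => ?_⟩
  change v γ ≤ V + sSup A * (k γ - r)
  rcases lt_trichotomy (k γ) r with h | h | h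
  · have := csSup_le ⟨0, Set.mem_insert _ _⟩ (hub γ ⟨hγ, hkl⟩ h)
    rw [le_div_iff₀ (by linarith)] at this
    linarith
  · rw [h, sub_self, mul_zero, add_zero]
    exact hle γ ⟨hγ, hkl⟩ h.le
  · have := le_csSup hbdd (Set.mem_insert_of_mem 0 ⟨γ, ⟨hγ, hkl⟩, h, rfl⟩)
    rw [div_le_iff₀ (by linarith)] at this
    linarith

/-- Strong duality up to an arbitrarily small error, with a strictly positive multiplier. -/
lemma exists_softDual_le (hφ : Measurable (Function.uncurry φ)) {r V : ℝ} (hr : 0 < r)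
    (hV0 : 0 ≤ V)
    (hV : ∀ γ ∈ causalLaws μ κ, klDiv γ (referencePlan μ κ qX qY) ≤ ENNReal.ofReal r →
      ∫⁻ ω, φ ω.2.1 ω.2.2 ∂γ ≤ ENNReal.ofReal V) {η : ℝ} (hη : 0 < η) :
    ∃ τ : ℝ, 0 < τ ∧ ENNReal.ofReal (τ * r) + softDual τ μ κ qX qY φ
      ≤ ENNReal.ofReal (V + η) := by
  obtain ⟨s, hs, hsl⟩ := exists_supporting_slope hr hV0 hV
  -- A Gibbs plan needs positive temperature. Raising the slope by `η / r` lowers the line to the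
  -- left of `r` by at most `η`, since entropies are nonnegative.
  have hτ : 0 < s + η / r := by positivity
  have hline : ∀ γ ∈ causalLaws μ κ, klDiv γ (referencePlan μ κ qX qY) ≠ ⊤ →
      (∫⁻ ω, φ ω.2.1 ω.2.2 ∂γ).toReal
        ≤ V + (s + η / r) * ((klDiv γ (referencePlan μ κ qX qY)).toReal - r) + η := by
    intro γ hγ hkl
    have h1 := hsl γ hγ hkl
    have h2 : (s + η / r) * ((klDiv γ (referencePlan μ κ qX qY)).toReal - r) + η
      = s * ((klDiv γ (referencePlan μ κ qX qY)).toReal - r)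
        + η / r * (klDiv γ (referencePlan μ κ qX qY)).toReal := by field_simp; ring
    have h3 : 0 ≤ η / r * (klDiv γ (referencePlan μ κ qX qY)).toReal := by positivity
    linarith
  refine ⟨s + η / r, hτ, ?_⟩
  -- The raised line at zero entropy dominates the reference plan's nonnegative mean loss, so the
  -- bound in `hD` is a genuine nonnegative number.
  have hgap : (s + η / r) * r ≤ V + η := by
    have h0 := hline _ (referencePlan_mem_causalLaws (qX := qX) (qY := qY))
      (by rw [klDiv_self]; exact ENNReal.zero_ne_top)
    rw [klDiv_self, ENNReal.toReal_zero] at h0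
    have := ENNReal.toReal_nonneg (a := ∫⁻ ω, φ ω.2.1 ω.2.2 ∂(referencePlan μ κ qX qY))
    linarith
  -- For the truncated Gibbs plan of entropy `k`, `τ k` plus the truncated dual equals its truncated
  -- mean, which is at most `V + τ (k - r) + η`; the terms `τ k` cancel.
  have hD : softDual (s + η / r) μ κ qX qY φ ≤ ENNReal.ofReal (V + η - (s + η / r) * r) := by
    refine softDual_le_of_forall_min hτ hφ fun n => ?_
    obtain ⟨γ, hγ, hkl, he⟩ := exists_lintegral_min_eq (μ := μ) (κ := κ) (qX := qX) (qY := qY)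
      hτ hφ n
    have hf := lintegral_ne_top_of_klDiv_ne_top hr hV hγ hkl
    have h1 : ∫⁻ ω, min (φ ω.2.1 ω.2.2) n ∂γ ≤ ∫⁻ ω, φ ω.2.1 ω.2.2 ∂γ :=
      lintegral_mono fun ω => min_le_left _ _
    have hDn : softDual (s + η / r) μ κ qX qY (fun x y => min (φ x y) n) ≠ ⊤ := by
      intro htop
      rw [he, htop, add_top] at h1
      exact hf (top_le_iff.1 h1)
    have h2 := ENNReal.toReal_mono hf h1
    rw [he, ENNReal.toReal_add (ENNReal.mul_ne_top ENNReal.ofReal_ne_top hkl) hDn,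
      ENNReal.toReal_mul, ENNReal.toReal_ofReal hτ.le] at h2
    rw [← ENNReal.ofReal_toReal hDn]
    refine ENNReal.ofReal_le_ofReal ?_
    have := hline γ hγ hkl
    linarith
  calc _ ≤ _ := add_le_add_right hD _
    _ = _ := by
      rw [← ENNReal.ofReal_add (by positivity) (by linarith)]
      congr 1; ring

/-- If the mean loss is unbounded on an entropy ball, then it is infinite at some point of a
strictly smaller ball. -/
lemma exists_lintegral_eq_top {r : ℝ}
    (h : ∀ V : ℝ≥0∞, V ≠ ⊤ → ∃ γ ∈ causalLaws μ κ,
      klDiv γ (referencePlan μ κ qX qY) ≤ ENNReal.ofReal r ∧ V < ∫⁻ ω, φ ω.2.1 ω.2.2 ∂γ) :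
    ∃ γ ∈ causalLaws μ κ, klDiv γ (referencePlan μ κ qX qY) ≤ ENNReal.ofReal (r / 2) ∧
      ∫⁻ ω, φ ω.2.1 ω.2.2 ∂γ = ⊤ := by
  -- Losses above `2 ^ (n + 1)` against weights `2 ^ -(n + 1)`: every term of the mixed loss is at
  -- least `1`.
  have hex : ∀ n : ℕ, ∃ γ ∈ causalLaws μ κ,
      klDiv γ (referencePlan μ κ qX qY) ≤ ENNReal.ofReal r ∧
        2 ^ (n + 1) < ∫⁻ ω, φ ω.2.1 ω.2.2 ∂γ := fun n => h _ (by simp)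
  choose g hg hkl hint using hex
  have hp := fun n => isProbabilityMeasure_of_mem_causalLaws (hg n)
  have hw : ∑' n : ℕ, (2⁻¹ : ℝ≥0∞) ^ (n + 1) = 1 := by
    rw [ENNReal.tsum_geometric_add_one, ENNReal.one_sub_inv_two, inv_inv,
      ENNReal.inv_mul_cancel (by simp) (by simp)]
  have hac : ∀ n, g n ≪ referencePlan μ κ qX qY := fun n =>
    ac_of_klDiv_ne_top (ne_top_of_le_ne_top ENNReal.ofReal_ne_top (hkl n))
  have hmix := sum_smul_mem_causalLaws hw hg
  have hmp := isProbabilityMeasure_of_mem_causalLaws hmix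
  have hk : klDiv (Measure.sum fun n => (2⁻¹ : ℝ≥0∞) ^ (n + 1) • g n) (referencePlan μ κ qX qY)
      ≤ ENNReal.ofReal r := by
    refine (klDiv_sum_smul_le hw hac).trans ?_
    calc _ ≤ ∑' n : ℕ, (2⁻¹ : ℝ≥0∞) ^ (n + 1) * ENNReal.ofReal r :=
          ENNReal.tsum_le_tsum fun n => mul_le_mul_right (hkl n) _
      _ = _ := by rw [ENNReal.tsum_mul_right, hw, one_mul]
  have hi : ∫⁻ ω, φ ω.2.1 ω.2.2 ∂(Measure.sum fun n => (2⁻¹ : ℝ≥0∞) ^ (n + 1) • g n) = ⊤ := by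
    rw [lintegral_sum_measure, ← top_le_iff,
      ← ENNReal.tsum_const_eq_top_of_ne_zero (α := ℕ) one_ne_zero]
    refine ENNReal.tsum_le_tsum fun n => ?_
    rw [lintegral_smul_measure, smul_eq_mul]
    calc (1 : ℝ≥0∞) = (2⁻¹ : ℝ≥0∞) ^ (n + 1) * 2 ^ (n + 1) := by
          rw [← mul_pow, ENNReal.inv_mul_cancel (by simp) (by simp), one_pow]
      _ ≤ _ := mul_le_mul_right (hint n).le _
  -- Averaging with the zero-entropy reference plan halves the entropy bound and keeps the loss
  -- infinite.
  obtain ⟨γ, hγ, h1, h2⟩ := exists_mixture hmix referencePlan_mem_causalLaws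
    (ac_of_klDiv_ne_top (ne_top_of_le_ne_top ENNReal.ofReal_ne_top hk))
    (Measure.AbsolutelyContinuous.refl (referencePlan μ κ qX qY))
    (by norm_num : (0 : ℝ) ≤ 1 / 2) (by norm_num)
  refine ⟨γ, hγ, h1.trans ?_, ?_⟩
  · rw [klDiv_self, mul_zero, add_zero]
    refine (mul_le_mul_right hk _).trans_eq ?_
    rw [← ENNReal.ofReal_mul (by norm_num)]; congr 1; ring
  · rw [h2, hi, ENNReal.mul_top (by norm_num), top_add]

/-- The dual functional decreases to the mean loss under the reference plan. -/
lemma iInf_softDual_le (hτ : 0 < τ) (hφ : Measurable (Function.uncurry φ))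
    (hfin : softDual τ μ κ qX qY φ ≠ ⊤) :
    ⨅ n : ℕ, softDual (τ + n) μ κ qX qY φ
      ≤ ∫⁻ ω, φ ω.2.1 ω.2.2 ∂(referencePlan μ κ qX qY) := by
  have hpos : ∀ n : ℕ, 0 < τ + n := fun n => by positivity
  have hle : ∀ a b : ℕ, a ≤ b → τ + a ≤ τ + b := fun a b hab => by gcongr
  have hφx : ∀ x, Measurable (φ x) := fun x => hφ.comp measurable_prodMk_left
  let g : ℕ → X → X → ℝ≥0∞ := fun n xh x => ∫⁻ yh, logMeanExp (τ + n) (qY yh) (φ x) ∂(κ xh)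
  have hgm : ∀ n xh, Measurable (g n xh) := fun n xh =>
    (measurable_lintegral_logMeanExp (hpos n) hφ).comp measurable_prodMk_left
  have hganti : ∀ xh x, Antitone fun n => g n xh x := fun xh x a b hab =>
    lintegral_mono fun yh => logMeanExp_antitone (hpos a) (hle a b hab) (hφx x)
  have hg : ∀ xh x, g 0 xh x ≠ ⊤ → ⨅ n, g n xh x ≤ ∫⁻ yh, ∫⁻ y, φ x y ∂(qY yh) ∂(κ xh) := by
    intro xh x hx
    have hm : Measurable fun yh => logMeanExp τ (qY yh) (φ x) :=
      (measurable_logMeanExp_inner hτ hφ).comp measurable_prodMk_right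
    have hx' : ∫⁻ yh, logMeanExp τ (qY yh) (φ x) ∂(κ xh) ≠ ⊤ := by simpa [g] using hx
    rw [← lintegral_iInf (f := fun n yh => logMeanExp (τ + n) (qY yh) (φ x))
      (fun n => (measurable_logMeanExp_inner (hpos n) hφ).comp measurable_prodMk_right)
      (fun a b hab yh => logMeanExp_antitone (hpos a) (hle a b hab) (hφx x)) hx]
    refine lintegral_mono_ae ((ae_lt_top hm hx').mono fun yh hyh => ?_)
    exact iInf_logMeanExp_le hτ (hφx x) hyh.ne
  have hD : ∀ n : ℕ, softDual (τ + n) μ κ qX qY φ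
      = ∫⁻ xh, logMeanExp (τ + n) (qX xh) (g n xh) ∂μ := fun n => rfl
  have hLanti : ∀ xh, Antitone fun n : ℕ => logMeanExp (τ + n) (qX xh) (g n xh) :=
    fun xh a b hab => (logMeanExp_antitone (hpos a) (hle a b hab) (hgm b xh)).trans
      (logMeanExp_mono (hpos a) (ae_of_all _ fun x => hganti xh x hab))
  have hLm : ∀ n : ℕ, Measurable fun xh => logMeanExp (τ + n) (qX xh) (g n xh) := fun n =>
    measurable_softDual_integrand (hpos n) hφ
  have hfin0 : ∫⁻ xh, logMeanExp (τ + (0 : ℕ)) (qX xh) (g 0 xh) ∂μ ≠ ⊤ := by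
    rw [← hD]; simpa using hfin
  simp only [hD]
  rw [← lintegral_iInf hLm (fun a b hab xh => hLanti xh hab) hfin0,
    lintegral_referencePlan (measurable_uncurry_loss hφ)]
  refine lintegral_mono_ae ((ae_lt_top (hLm 0) hfin0).mono fun xh hxh => ?_)
  -- The temperature occurs in both layers. Freeze the inner one at level `m` while the outer one
  -- grows, comparing at index `max m n`; then let `m` grow.
  have hmean : ∀ m, ⨅ n : ℕ, logMeanExp (τ + n) (qX xh) (g n xh) ≤ ∫⁻ x, g m xh x ∂(qX xh) := by
    intro m
    have hτm : logMeanExp τ (qX xh) (g m xh) ≠ ⊤ := by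
      refine ne_top_of_le_ne_top hxh.ne ?_
      simp only [Nat.cast_zero, add_zero]
      exact logMeanExp_mono hτ (ae_of_all _ fun x => hganti xh x (Nat.zero_le m))
    refine le_trans ?_ (iInf_logMeanExp_le hτ (hgm m xh) hτm)
    refine le_iInf fun n => (iInf_le _ (max m n)).trans ?_
    exact (logMeanExp_mono (hpos _) (ae_of_all _ fun x => hganti xh x (le_max_left m n))).trans
      (logMeanExp_antitone (hpos n) (hle _ _ (le_max_right m n)) (hgm m xh))
  have hint0 : ∫⁻ x, g 0 xh x ∂(qX xh) ≠ ⊤ :=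
    lintegral_ne_top_of_logMeanExp_ne_top (hpos 0) hxh.ne
  calc _ ≤ ⨅ m, ∫⁻ x, g m xh x ∂(qX xh) := le_iInf hmean
    _ = ∫⁻ x, ⨅ m, g m xh x ∂(qX xh) :=
      (lintegral_iInf (fun m => hgm m xh) (fun a b hab x => hganti xh x hab) hint0).symm
    _ ≤ ∫⁻ x, ∫⁻ yh, ∫⁻ y, φ x y ∂(qY yh) ∂(κ xh) ∂(qX xh) :=
      lintegral_mono_ae ((ae_lt_top (hgm 0 xh) hint0).mono fun x hx => hg xh x hx.ne)
    -- Under the reference plan `x` and `ŷ` are independent given `x̂`, so their order of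
    -- integration is immaterial.
    _ = _ := by
      refine lintegral_lintegral_swap (Measurable.aemeasurable ?_)
      exact Measurable.lintegral_kernel_prod_right (κ := qY.comap Prod.snd measurable_snd)
        (f := fun (z : X × Y) y => φ z.1 y)
        (hφ.comp (by fun_prop : Measurable fun z : (X × Y) × Y => (z.1.1, z.2)))

end Duality

/-! ### Expectations of extended-real functions. -/

section ExtendedExpectation

variable {Ω : Type*} [MeasurableSpace Ω] {μ : Measure Ω}

lemma eexp_congr_ae {F G : Ω → EReal} (h : F =ᵐ[μ] G) : eexp μ F = eexp μ G := by
  have h1 : ∫⁻ ω, (F ω).toENNReal ∂μ = ∫⁻ ω, (G ω).toENNReal ∂μ :=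
    lintegral_congr_ae (h.mono fun ω hω => by simp only [hω])
  have h2 : ∫⁻ ω, (-F ω).toENNReal ∂μ = ∫⁻ ω, (-G ω).toENNReal ∂μ :=
    lintegral_congr_ae (h.mono fun ω hω => by simp only [hω])
  rw [eexp, eexp, h1, h2]

/-- The identity `(a + r)⁺ - (a + r)⁻ = a + r⁺ - r⁻`, rearranged to contain only sums so that it
survives `a = ⊤`. -/
lemma toENNReal_coe_add_real (a : ℝ≥0∞) (r : ℝ) :
    ((a : EReal) + (r : EReal)).toENNReal + ENNReal.ofReal (-r)
      = a + (ENNReal.ofReal r + (-((a : EReal) + (r : EReal))).toENNReal) := by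
  induction a with
  | top => simp
  | coe x =>
    have e : (((x : NNReal) : ℝ≥0∞) : EReal) = ((x : ℝ) : EReal) := rfl
    have e2 : -(((x : ℝ) : EReal) + (r : EReal)) = ((-((x : ℝ) + r) : ℝ) : EReal) := by
      push_cast; rfl
    rw [e, e2, ← EReal.coe_add, EReal.real_coe_toENNReal, EReal.real_coe_toENNReal,
      ← ENNReal.ofReal_coe_nnreal (p := x)]
    have hx := x.coe_nonneg
    rw [← ENNReal.toReal_eq_toReal_iff' (by simp) (by simp)]
    rw [ENNReal.toReal_add (by simp) (by simp), ENNReal.toReal_add (by simp) (by simp),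
      ENNReal.toReal_add (by simp) (by simp)]
    simp only [ENNReal.toReal_ofReal']
    rcases max_cases ((x : ℝ) + r) 0 with ⟨h1, _⟩ | ⟨h1, _⟩ <;>
    rcases max_cases (-((x : ℝ) + r)) 0 with ⟨h2, _⟩ | ⟨h2, _⟩ <;>
    rcases max_cases r 0 with ⟨h3, _⟩ | ⟨h3, _⟩ <;>
    rcases max_cases (-r) 0 with ⟨h4, _⟩ | ⟨h4, _⟩ <;>
    rw [h1, h2, h3, h4, max_eq_left hx] <;> linarith

/-- The extended expectation of a nonnegative function plus an integrable one. -/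
lemma eexp_coe_add_real {F : Ω → ℝ≥0∞} (hF : AEMeasurable F μ) {r : Ω → ℝ}
    (hr : Integrable r μ) : eexp μ (fun ω => (F ω : EReal) + (r ω : EReal))
      = ((∫⁻ ω, F ω ∂μ : ℝ≥0∞) : EReal) + ((∫ ω, r ω ∂μ : ℝ) : EReal) := by
  have hrm := hr.aemeasurable
  have hp : ∫⁻ ω, ENNReal.ofReal (r ω) ∂μ ≠ ⊤ := hr.lintegral_lt_top.ne
  have hn : ∫⁻ ω, ENNReal.ofReal (-r ω) ∂μ ≠ ⊤ := hr.neg.lintegral_lt_top.ne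
  -- The negative part of the sum is dominated by that of the integrable summand.
  have hN : ∫⁻ ω, (-((F ω : EReal) + (r ω : EReal))).toENNReal ∂μ ≠ ⊤ := by
    refine ne_top_of_le_ne_top hn (lintegral_mono fun ω => ?_)
    refine (EReal.toENNReal_le_toENNReal (EReal.neg_le_neg_iff.2
      (le_add_of_nonneg_left (by positivity : (0 : EReal) ≤ F ω)))).trans_eq ?_
    rw [← EReal.coe_neg, EReal.real_coe_toENNReal]
  have key : ∫⁻ ω, ((F ω : EReal) + (r ω : EReal)).toENNReal ∂μ
      + ∫⁻ ω, ENNReal.ofReal (-r ω) ∂μ = ∫⁻ ω, F ω ∂μ + (∫⁻ ω, ENNReal.ofReal (r ω) ∂μ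
        + ∫⁻ ω, (-((F ω : EReal) + (r ω : EReal))).toENNReal ∂μ) := by
    rw [← lintegral_add_right' (g := fun ω => ENNReal.ofReal (-r ω)) _ hrm.neg.ennreal_ofReal,
      ← lintegral_add_left' hrm.ennreal_ofReal, ← lintegral_add_left' hF]
    exact lintegral_congr fun ω => toENNReal_coe_add_real _ _
  rw [integral_eq_lintegral_pos_part_sub_lintegral_neg_part hr, eexp]
  generalize ∫⁻ ω, ((F ω : EReal) + (r ω : EReal)).toENNReal ∂μ = A at *
  generalize ∫⁻ ω, (-((F ω : EReal) + (r ω : EReal))).toENNReal ∂μ = N at *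
  generalize ∫⁻ ω, ENNReal.ofReal (r ω) ∂μ = p at *
  generalize ∫⁻ ω, ENNReal.ofReal (-r ω) ∂μ = n at *
  generalize ∫⁻ ω, F ω ∂μ = I at *
  lift p to NNReal using hp
  lift n to NNReal using hn
  lift N to NNReal using hN
  induction I with
  | top =>
    have : A = ⊤ := by
      by_contra h
      lift A to NNReal using h
      simp at key
    rw [this]; rfl
  | coe I =>
    lift A to NNReal using (by
      rintro rfl
      have : (⊤ : ℝ≥0∞) = _ := (top_add (n : ℝ≥0∞)).symm.trans key
      exact absurd this (by exact_mod_cast ENNReal.top_ne_coe))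
    have k2 : (A : ℝ) + n = I + (p + N) := by exact_mod_cast key
    change (((A : ℝ) : EReal) - ((N : ℝ) : EReal)) = ((I : ℝ) : EReal) + _
    rw [← EReal.coe_sub, ← EReal.coe_add, EReal.coe_eq_coe_iff]
    simp only [ENNReal.coe_toReal]
    linarith

lemma eexp_real {r : Ω → ℝ} (hr : Integrable r μ) :
    eexp μ (fun ω => (r ω : EReal)) = ((∫ ω, r ω ∂μ : ℝ) : EReal) := by
  have := eexp_coe_add_real (F := fun _ => 0) (μ := μ) aemeasurable_const hr
  simpa using this

/-- Nothing is asked of the positive part because `⊤ - ⊤ = ⊥` in `EReal`. -/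
lemma eexp_eq_bot {F : Ω → EReal} (hn : ∫⁻ ω, (-F ω).toENNReal ∂μ = ⊤) : eexp μ F = ⊥ := by
  rw [eexp, hn, EReal.coe_ennreal_top, EReal.sub_top]

lemma eexp_eq_top {F : Ω → EReal} (hp : ∫⁻ ω, (F ω).toENNReal ∂μ = ⊤)
    (hn : ∫⁻ ω, (-F ω).toENNReal ∂μ ≠ ⊤) : eexp μ F = ⊤ := by
  rw [eexp, hp, EReal.coe_ennreal_top, EReal.top_sub (by simpa using hn)]

end ExtendedExpectation

/-! ### The log-integral-exp functional as a log-mean-exp. -/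

section SoftSup

variable {S : Type*} [MeasurableSpace S] {ν : Measure S} {τ : ℝ}

lemma one_le_lintegral_scaledExp [IsProbabilityMeasure ν] (hτ : 0 < τ) (h : S → ℝ≥0∞) :
    1 ≤ ∫⁻ s, scaledExp τ (h s) ∂ν :=
  calc (1 : ℝ≥0∞) = ∫⁻ _, 1 ∂ν := by simp
    _ ≤ _ := lintegral_mono fun s => one_le_scaledExp hτ _

/-- For a probability measure and a nonnegative function the integral is at least `1`, so the
truncation at zero is inactive. -/
lemma coe_logMeanExp [IsProbabilityMeasure ν] (hτ : 0 < τ) (h : S → ℝ≥0∞) :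
    (logMeanExp τ ν h : EReal)
      = (τ : EReal) * ENNReal.log (∫⁻ s, scaledExp τ (h s) ∂ν) := by
  rw [logMeanExp, EReal.coe_ennreal_mul, EReal.coe_toENNReal
    (ENNReal.zero_le_log_iff.2 (one_le_lintegral_scaledExp hτ h)), EReal.coe_ennreal_ofReal,
    max_eq_left hτ.le]

lemma exp_coe_add_real_div (hτ : 0 < τ) (a : ℝ≥0∞) (b : ℝ) :
    EReal.exp (((a : EReal) + (b : EReal)) / (τ : EReal))
      = ENNReal.ofReal (Real.exp (b / τ)) * scaledExp τ a := by
  have h1 : ((a : EReal) + (b : EReal)) / (τ : EReal)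
      = ((b / τ : ℝ) : EReal) + (a : EReal) / (τ : EReal) := by
    induction a with
    | top =>
      rw [EReal.coe_ennreal_top, EReal.top_add_coe,
        EReal.top_div_of_pos_ne_top (by exact_mod_cast hτ) (EReal.coe_ne_top _),
        EReal.coe_add_top]
    | coe x =>
      have e : (((x : NNReal) : ℝ≥0∞) : EReal) = ((x : ℝ) : EReal) := rfl
      rw [e, ← EReal.coe_add, ← EReal.coe_div, ← EReal.coe_div, ← EReal.coe_add]
      congr 1; ring
  rw [h1, EReal.exp_add, EReal.exp_coe]; rfl

/-- Change of reference measure in the log-integral-exp functional. -/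
lemma softSup_coe_add_real (hτ : 0 < τ) {h : S → ℝ≥0∞} (a : ℝ) {d : S → ℝ}
    (hd : Measurable d) {k : S → ℝ≥0∞} (hk : ∀ s, k s = ENNReal.ofReal (Real.exp (-d s)))
    (hZ0 : ∫⁻ s, k s ∂ν ≠ 0) (hZt : ∫⁻ s, k s ∂ν ≠ ⊤) :
    softSup τ ν (fun s => (h s : EReal) + ((a - τ * d s : ℝ) : EReal))
      = (logMeanExp τ ((∫⁻ s, k s ∂ν)⁻¹ • ν.withDensity k) h : EReal)
        + ((a + τ * Real.log (∫⁻ s, k s ∂ν).toReal : ℝ) : EReal) := by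
  have hkm : Measurable k := by
    have : k = fun s => ENNReal.ofReal (Real.exp (-d s)) := funext hk
    rw [this]; fun_prop
  set Z := ∫⁻ s, k s ∂ν with hZ
  have hp : IsProbabilityMeasure (Z⁻¹ • ν.withDensity k) := ⟨by
    rw [Measure.smul_apply, withDensity_apply _ MeasurableSet.univ, setLIntegral_univ,
      smul_eq_mul, ENNReal.inv_mul_cancel hZ0 hZt]⟩
  set I := ∫⁻ s, scaledExp τ (h s) ∂(Z⁻¹ • ν.withDensity k) with hI
  have hI1 : 1 ≤ I := one_le_lintegral_scaledExp hτ h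
  have hint : ∫⁻ s, k s * scaledExp τ (h s) ∂ν = Z * I := by
    rw [hI, lintegral_smul_measure, lintegral_withDensity_eq_lintegral_mul_non_measurable _ hkm
      (ae_of_all _ fun s => by rw [hk]; exact ENNReal.ofReal_lt_top), smul_eq_mul, ← mul_assoc,
      ENNReal.mul_inv_cancel hZ0 hZt, one_mul]
    rfl
  -- The exponential splits into a constant, the kernel density and the exponential of `h`; the
  -- first two produce the additive real terms after taking logarithms.
  have hc : ∀ s, EReal.exp (((h s : EReal) + ((a - τ * d s : ℝ) : EReal)) / (τ : EReal))
      = ENNReal.ofReal (Real.exp (a / τ)) * (k s * scaledExp τ (h s)) := fun s => by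
    rw [exp_coe_add_real_div hτ, hk, ← mul_assoc, ← ENNReal.ofReal_mul (Real.exp_nonneg _),
      ← Real.exp_add]
    congr 4
    field_simp
    ring
  rw [softSup, if_neg hτ.ne', coe_logMeanExp hτ]
  simp only [hc]
  rw [lintegral_const_mul' _ _ ENNReal.ofReal_ne_top, hint, ENNReal.log_mul_add,
    ENNReal.log_mul_add, ENNReal.log_ofReal_of_pos (Real.exp_pos _), Real.log_exp,
    ENNReal.log_pos_real hZ0 hZt, ← hI]
  rcases eq_or_ne I ⊤ with hIt | hIt
  · rw [hIt, ENNReal.log_top, EReal.coe_add_top, EReal.coe_add_top,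
      EReal.coe_mul_top_of_pos hτ, EReal.top_add_coe]
  · rw [ENNReal.log_pos_real (by positivity) hIt]
    norm_cast
    field_simp
    ring

end SoftSup

/-! ### Normalizing constants and smoothing kernels. -/

section SmoothingKernels

lemma rpow_norm_le {E : Type*} [NormedAddCommGroup E] {p : ℝ} (hp : 1 ≤ p) (a u : E) :
    ‖u‖ ^ p ≤ 2 ^ (p - 1) * (‖u - a‖ ^ p + ‖a‖ ^ p) := by
  have h1 : ‖u‖ ≤ ‖u - a‖ + ‖a‖ := by simpa using norm_add_le (u - a) a
  refine (Real.rpow_le_rpow (norm_nonneg _) h1 (by linarith)).trans ?_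
  have := NNReal.rpow_add_le_mul_rpow_add_rpow ‖u - a‖₊ ‖a‖₊ hp
  exact_mod_cast this

lemma kernelDensity_ne_zero {E : Type*} [NormedAddCommGroup E] {S : Set E} {p ε : ℝ}
    (a u : S) : kernelDensity p ε a u ≠ 0 := by
  simp [kernelDensity, Real.exp_pos]

variable {E : Type*} [NormedAddCommGroup E] [MeasurableSpace E] {S : Set E} {p ε : ℝ}
  {ν : Measure S}

/-- Convexity of the `p`-th power gives `‖u - a‖ ^ p ≥ ‖u‖ ^ p / C - ‖a‖ ^ p`, so the kernel is
dominated by a multiple of an exponential covered by `hν`. -/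
lemma normalizer_ne_top (hp : 1 ≤ p) (hε : 0 < ε)
    (hν : ∀ δ : ℝ, 0 < δ → ∫⁻ u : S, ENNReal.ofReal (Real.exp (-δ * ‖(u : E)‖ ^ p)) ∂ν < ⊤)
    (a : S) : normalizer p ε ν a ≠ ⊤ := by
  set C : ℝ := 2 ^ (p - 1) with hC
  have hC0 : 0 < C := by positivity
  -- Chosen so that `δ * C = 1 / ε`.
  set δ : ℝ := (C * ε)⁻¹ with hδ
  have hδ0 : 0 < δ := by positivity
  have hle : normalizer p ε ν a ≤ ∫⁻ u : S, ENNReal.ofReal (Real.exp (‖(a : E)‖ ^ p / ε))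
      * ENNReal.ofReal (Real.exp (-δ * ‖(u : E)‖ ^ p)) ∂ν := by
    refine lintegral_mono fun u => ?_
    rw [kernelDensity, ← ENNReal.ofReal_mul (Real.exp_nonneg _), ← Real.exp_add]
    refine ENNReal.ofReal_le_ofReal (Real.exp_le_exp.2 ?_)
    have h1 := mul_le_mul_of_nonneg_left (rpow_norm_le hp (a : E) (u : E)) hδ0.le
    have h2 : δ * (C * (‖(u : E) - a‖ ^ p + ‖(a : E)‖ ^ p))
        = ‖(u : E) - a‖ ^ p / ε + ‖(a : E)‖ ^ p / ε := by
      rw [hδ]; field_simp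
    rw [h2] at h1
    rw [neg_div]
    linarith
  refine ne_top_of_le_ne_top ?_ hle
  rw [lintegral_const_mul' _ _ ENNReal.ofReal_ne_top]
  exact ENNReal.mul_ne_top ENNReal.ofReal_ne_top (hν δ hδ0).ne

variable [BorelSpace E]

lemma measurable_kernelDensity_comp [SecondCountableTopology E] {T : Type*} [MeasurableSpace T]
    {f g : T → S} (hf : Measurable f) (hg : Measurable g) :
    Measurable fun t => kernelDensity p ε (f t) (g t) := by
  unfold kernelDensity
  fun_prop

lemma measurable_kernelDensity_right (a : S) : Measurable (kernelDensity p ε a) := by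
  unfold kernelDensity
  fun_prop

lemma normalizer_ne_zero (hν : ν ≠ 0) (a : S) : normalizer p ε ν a ≠ 0 := by
  rw [normalizer, Ne, lintegral_eq_zero_iff (measurable_kernelDensity_right a)]
  intro h
  refine hν (Measure.measure_univ_eq_zero.1 ?_)
  have : ∀ᵐ u ∂ν, False := h.mono fun u hu => kernelDensity_ne_zero a u hu
  simpa [ae_iff] using this

variable [SecondCountableTopology E]

lemma measurable_kernelDensity :
    Measurable (Function.uncurry (kernelDensity p ε : S → S → ℝ≥0∞)) := by
  unfold kernelDensity Function.uncurry
  fun_prop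

lemma measurable_normalizer [SFinite ν] : Measurable (normalizer p ε ν) :=
  measurable_kernelDensity.lintegral_prod_right

/-- The measure weighted by `exp (-‖u‖ ^ p)` is finite, and dividing by this positive finite weight
recovers `ν`. -/
lemma sigmaFinite_of_lintegral_exp_lt_top
    (hν : ∀ δ : ℝ, 0 < δ → ∫⁻ u : S, ENNReal.ofReal (Real.exp (-δ * ‖(u : E)‖ ^ p)) ∂ν < ⊤) :
    SigmaFinite ν := by
  set k : S → ℝ≥0∞ := fun u => ENNReal.ofReal (Real.exp (-1 * ‖(u : E)‖ ^ p)) with hk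
  have hkm : Measurable k := by fun_prop
  have hk0 : ∀ u, k u ≠ 0 := fun u => by simp [hk, Real.exp_pos]
  have hfin : IsFiniteMeasure (ν.withDensity k) := isFiniteMeasure_withDensity (hν 1 one_pos).ne
  rw [← withDensity_inv_same (μ := ν) hkm (ae_of_all _ hk0)
    (ae_of_all _ fun u => ENNReal.ofReal_ne_top)]
  exact SigmaFinite.withDensity_of_ne_top (ae_of_all _ fun u => ENNReal.inv_ne_top.2 (hk0 u))

variable (p ε ν) in
/-- The smoothing distributions as a Markov kernel. -/
noncomputable def smoothing [SFinite ν] : Kernel S S where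
  toFun := smoothingKernel p ε ν
  measurable' := by
    refine Measure.measurable_of_measurable_coe _ fun s hs => ?_
    have h1 : Measurable fun a => ∫⁻ u in s, kernelDensity p ε a u ∂ν :=
      measurable_kernelDensity.lintegral_prod_right
    simp only [smoothingKernel, Measure.smul_apply, withDensity_apply _ hs, smul_eq_mul]
    exact measurable_normalizer.inv.mul h1

lemma smoothing_apply [SFinite ν] (a : S) : smoothing p ε ν a = smoothingKernel p ε ν a := rfl

lemma isMarkovKernel_smoothing [SFinite ν] (h0 : ∀ a, normalizer p ε ν a ≠ 0)
    (ht : ∀ a, normalizer p ε ν a ≠ ⊤) : IsMarkovKernel (smoothing p ε ν) := ⟨fun a => ⟨by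
  rw [smoothing_apply, smoothingKernel, Measure.smul_apply, withDensity_apply _ MeasurableSet.univ,
    setLIntegral_univ, smul_eq_mul]
  exact ENNReal.inv_mul_cancel (h0 a) (ht a)⟩⟩

end SmoothingKernels

/-! ### Conditional independence versus factorization through the kernel. -/

section Causality

lemma setIntegral_indicator_one_eq {Ω : Type*} [MeasurableSpace Ω] {γ : Measure Ω} (A : Set Ω)
    {B : Set Ω} (hB : MeasurableSet B) :
    ∫ ω in A, B.indicator (fun _ => (1 : ℝ)) ω ∂γ = γ.real (A ∩ B) := by
  rw [integral_indicator_const _ hB, smul_eq_mul, mul_one, measureReal_restrict_apply hB,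
    Set.inter_comm]

section Rectangles

variable {X Y : Type*} [MeasurableSpace X] [MeasurableSpace Y]
  {μ : Measure X} {κ : Kernel X Y} {γ : Measure ((X × Y) × (X × Y))}
  [IsProbabilityMeasure μ] [IsMarkovKernel κ]

/-- The rectangle form of the factorization defining `causalLaws`. -/
lemma measureReal_rectangle_of_mem_causalLaws (hγ : γ ∈ causalLaws μ κ) {A C : Set X} {B : Set Y}
    (hA : MeasurableSet A) (hB : MeasurableSet B) (hC : MeasurableSet C) :
    γ.real ({ω | ω.1.1 ∈ C} ∩ ({ω | ω.2.1 ∈ A} ∩ {ω | ω.1.2 ∈ B}))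
      = ∫ ω in {ω | ω.1.1 ∈ C} ∩ {ω | ω.2.1 ∈ A}, (κ ω.1.1).real B ∂γ := by
  have := isProbabilityMeasure_of_mem_causalLaws hγ
  have h1 := congrArg (fun m => m ((C ×ˢ A) ×ˢ B)) hγ.2
  have hS : MeasurableSet {ω : (X × Y) × (X × Y) | ω.1.1 ∈ C} :=
    hC.preimage (by fun_prop : Measurable fun ω : (X × Y) × (X × Y) => ω.1.1)
  have hS' : MeasurableSet {ω : (X × Y) × (X × Y) | ω.2.1 ∈ A} :=
    hA.preimage (by fun_prop : Measurable fun ω : (X × Y) × (X × Y) => ω.2.1)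
  have hκB : Measurable fun x => κ x B := κ.measurable_coe hB
  simp only [Measure.compProd_apply_prod (hC.prod hA) hB, Kernel.comap_apply] at h1
  rw [Measure.map_apply (by fun_prop) ((hC.prod hA).prod hB),
    setLIntegral_map (hC.prod hA) (by fun_prop) (by fun_prop)] at h1
  have e1 : {ω : (X × Y) × (X × Y) | ω.1.1 ∈ C} ∩ ({ω | ω.2.1 ∈ A} ∩ {ω | ω.1.2 ∈ B})
      = (fun ω : (X × Y) × (X × Y) => ((ω.1.1, ω.2.1), ω.1.2)) ⁻¹' ((C ×ˢ A) ×ˢ B) := by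
    ext ω; simp [and_assoc]
  have e2 : {ω : (X × Y) × (X × Y) | ω.1.1 ∈ C} ∩ {ω | ω.2.1 ∈ A}
      = (fun ω : (X × Y) × (X × Y) => (ω.1.1, ω.2.1)) ⁻¹' (C ×ˢ A) := by
    ext ω; simp
  rw [Measure.real, e1, h1, e2]
  simp only [Measure.real]
  rw [integral_toReal (by fun_prop) (ae_of_all _ fun ω => measure_lt_top _ _)]

lemma mem_causalLaws_of_measureReal_rectangle (hfst : γ.fst = μ.compProd κ)
    (h : ∀ (A C : Set X) (B : Set Y), MeasurableSet A → MeasurableSet B → MeasurableSet C →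
      γ.real ({ω | ω.1.1 ∈ C} ∩ ({ω | ω.2.1 ∈ A} ∩ {ω | ω.1.2 ∈ B}))
        = ∫ ω in {ω | ω.1.1 ∈ C} ∩ {ω | ω.2.1 ∈ A}, (κ ω.1.1).real B ∂γ) :
    γ ∈ causalLaws μ κ := by
  have := isProbabilityMeasure_of_fst_eq hfst
  refine ⟨hfst, ?_⟩
  have : IsProbabilityMeasure (γ.map fun ω => ((ω.1.1, ω.2.1), ω.1.2)) :=
    Measure.isProbabilityMeasure_map (by fun_prop)
  -- Uniqueness of measures on boxes is applied to right-nested triple products, hence the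
  -- reassociation.
  refine MeasurableEquiv.prodAssoc.map_measurableEquiv_injective ?_
  have : IsProbabilityMeasure ((γ.map fun ω => ((ω.1.1, ω.2.1), ω.1.2)).map
      (MeasurableEquiv.prodAssoc (α := X) (β := X) (γ := Y))) :=
    Measure.isProbabilityMeasure_map (by fun_prop)
  refine Measure.ext_prod₃ fun {C A B} hC hA hB => ?_
  have hκB : Measurable fun x => κ x B := κ.measurable_coe hB
  have e0 : (MeasurableEquiv.prodAssoc (α := X) (β := X) (γ := Y)) ⁻¹' (C ×ˢ A ×ˢ B)
      = (C ×ˢ A) ×ˢ B := by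
    ext z; simp [MeasurableEquiv.prodAssoc, and_assoc]
  have e1 : {ω : (X × Y) × (X × Y) | ω.1.1 ∈ C} ∩ ({ω | ω.2.1 ∈ A} ∩ {ω | ω.1.2 ∈ B})
      = (fun ω : (X × Y) × (X × Y) => ((ω.1.1, ω.2.1), ω.1.2)) ⁻¹' ((C ×ˢ A) ×ˢ B) := by
    ext ω; simp [and_assoc]
  have e2 : {ω : (X × Y) × (X × Y) | ω.1.1 ∈ C} ∩ {ω | ω.2.1 ∈ A}
      = (fun ω : (X × Y) × (X × Y) => (ω.1.1, ω.2.1)) ⁻¹' (C ×ˢ A) := by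
    ext ω; simp
  rw [MeasurableEquiv.map_apply, MeasurableEquiv.map_apply, e0,
    Measure.map_apply (by fun_prop) ((hC.prod hA).prod hB),
    Measure.compProd_apply_prod (hC.prod hA) hB]
  simp only [Kernel.comap_apply]
  rw [setLIntegral_map (f := fun z : X × X => κ z.1 B) (hC.prod hA) (by fun_prop) (by fun_prop)]
  have h1 := h A C B hA hB hC
  rw [e1, e2] at h1
  simp only [Measure.real] at h1
  rw [integral_toReal (by fun_prop) (ae_of_all _ fun ω => measure_lt_top _ _)] at h1
  refine (ENNReal.toReal_eq_toReal_iff' (measure_ne_top _ _) ?_).1 h1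
  refine ne_top_of_le_ne_top ENNReal.one_ne_top ?_
  calc _ ≤ ∫⁻ _, 1 ∂γ := (setLIntegral_le_lintegral _ _).trans
        (lintegral_mono fun ω => prob_le_one)
    _ = 1 := by simp

variable (X Y) in
/-- The σ-algebra generated by `X̂`. -/
abbrev sourceSigma : MeasurableSpace ((X × Y) × (X × Y)) :=
  MeasurableSpace.comap (fun ω : (X × Y) × (X × Y) => ω.1.1) inferInstance

end Rectangles

variable {E F : Type*} [MeasurableSpace E] [MeasurableSpace F] {X : Set E} {Y : Set F}
  {μ : Measure X} {κ : Kernel X Y} {γ : Measure ((X × Y) × (X × Y))}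
  [IsProbabilityMeasure μ] [IsMarkovKernel κ]

/-- Causality in terms of conditional probabilities agrees with the factorization of the law of
`(X̂, X, Ŷ)`. -/
lemma isCausal_iff_mem_causalLaws (hfst : γ.fst = μ.compProd κ) :
    IsCausal γ ↔ γ ∈ causalLaws μ κ := by
  have hprob := isProbabilityMeasure_of_fst_eq hfst
  have hmle : sourceSigma X Y ≤ Prod.instMeasurableSpace :=
    (by fun_prop : Measurable fun ω : (X × Y) × (X × Y) => ω.1.1).comap_le
  have hmeas : Measurable[sourceSigma X Y] fun ω : (X × Y) × (X × Y) => ω.1.1 := comap_measurable _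
  have hSA : ∀ A : Set X, MeasurableSet A →
      MeasurableSet {ω : (X × Y) × (X × Y) | ω.2.1 ∈ A} := fun A hA =>
    hA.preimage (by fun_prop : Measurable fun ω : (X × Y) × (X × Y) => ω.2.1)
  have hSB : ∀ B : Set Y, MeasurableSet B →
      MeasurableSet {ω : (X × Y) × (X × Y) | ω.1.2 ∈ B} := fun B hB =>
    hB.preimage (by fun_prop : Measurable fun ω : (X × Y) × (X × Y) => ω.1.2)
  have hSC : ∀ C : Set X, MeasurableSet C →
      MeasurableSet {ω : (X × Y) × (X × Y) | ω.1.1 ∈ C} := fun C hC =>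
    hC.preimage (by fun_prop : Measurable fun ω : (X × Y) × (X × Y) => ω.1.1)
  have hκm : ∀ B : Set Y, MeasurableSet B → Measurable fun x => (κ x).real B := fun B hB =>
    (κ.measurable_coe hB).ennreal_toReal
  have hκs : ∀ B : Set Y, MeasurableSet B →
      StronglyMeasurable[sourceSigma X Y] fun ω : (X × Y) × (X × Y) => (κ ω.1.1).real B := fun B hB =>
    ((hκm B hB).comp hmeas).stronglyMeasurable
  have hκi : ∀ B : Set Y, MeasurableSet B →
      Integrable (fun ω : (X × Y) × (X × Y) => (κ ω.1.1).real B) γ := fun B hB =>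
    integrable_of_mem_Icc (C := 1) ((hκm B hB).comp (by fun_prop))
      fun ω => ⟨measureReal_nonneg, measureReal_le_one⟩
  have hind : ∀ S : Set ((X × Y) × (X × Y)), MeasurableSet S →
      Integrable (S.indicator fun _ => (1 : ℝ)) γ := fun S hS =>
    (integrable_const 1).indicator hS
  have hset : ∀ s, MeasurableSet[sourceSigma X Y] s → ∃ C : Set X, MeasurableSet C ∧
      s = {ω : (X × Y) × (X × Y) | ω.1.1 ∈ C} := fun s hs => by
    obtain ⟨C, hC, rfl⟩ := hs
    exact ⟨C, hC, rfl⟩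
  -- `κ X̂ B` is a version of the conditional probability of `Ŷ ∈ B` given `X̂`.
  have hB1 : ∀ B : Set Y, MeasurableSet B →
      (fun ω : (X × Y) × (X × Y) => (κ ω.1.1).real B) =ᵐ[γ] γ⟦{ω | ω.1.2 ∈ B} | sourceSigma X Y⟧ := by
    intro B hB
    refine ae_eq_condExp_of_forall_setIntegral_eq hmle (hind _ (hSB B hB))
      (fun _ _ _ => (hκi B hB).integrableOn) (fun s hs _ => ?_)
      (hκs B hB).aestronglyMeasurable
    obtain ⟨C, hC, rfl⟩ := hset s hs
    rw [setIntegral_indicator_one_eq _ (hSB B hB)]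
    have h1 : γ ({ω | ω.1.1 ∈ C} ∩ {ω | ω.1.2 ∈ B}) = ∫⁻ x in C, κ x B ∂μ := by
      rw [← Measure.compProd_apply_prod hC hB, ← hfst, Measure.fst_apply (hC.prod hB)]
      congr 1
    have h2 : γ.map (fun ω => ω.1.1) = μ := by
      rw [← Measure.fst_compProd μ κ, ← hfst, Measure.fst, Measure.fst,
        Measure.map_map measurable_fst measurable_fst]; rfl
    have hκB : Measurable fun x => κ x B := κ.measurable_coe hB
    rw [Measure.real, h1, ← h2, setLIntegral_map hC hκB (by fun_prop)]
    simp only [Measure.real]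
    rw [integral_toReal (by fun_prop) (ae_of_all _ fun ω => measure_lt_top _ _)]
    rfl
  have hmulint : ∀ (A : Set X) (B : Set Y), MeasurableSet A → MeasurableSet B →
      Integrable (({ω : (X × Y) × (X × Y) | ω.2.1 ∈ A}.indicator fun _ => (1 : ℝ))
        * fun ω => (κ ω.1.1).real B) γ := fun A B hA hB => by
    have : (({ω : (X × Y) × (X × Y) | ω.2.1 ∈ A}.indicator fun _ => (1 : ℝ))
        * fun ω => (κ ω.1.1).real B)
        = {ω : (X × Y) × (X × Y) | ω.2.1 ∈ A}.indicator fun ω => (κ ω.1.1).real B := by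
      ext ω; by_cases h : ω.2.1 ∈ A <;> simp [h]
    rw [this]
    exact (hκi B hB).indicator (hSA A hA)
  -- Pulling out the `X̂`-measurable factor makes the product of conditional probabilities a single
  -- conditional expectation. Causality then equates two conditional expectations, and integrating
  -- over `{X̂ ∈ C}` gives the rectangle identity.
  have hpull : ∀ (A : Set X) (B : Set Y), MeasurableSet A → MeasurableSet B →
      γ[({ω : (X × Y) × (X × Y) | ω.2.1 ∈ A}.indicator fun _ => (1 : ℝ))
        * (fun ω => (κ ω.1.1).real B) | sourceSigma X Y]
      =ᵐ[γ] fun ω => (γ⟦{ω | ω.2.1 ∈ A} | sourceSigma X Y⟧) ω *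
        (γ⟦{ω | ω.1.2 ∈ B} | sourceSigma X Y⟧) ω := by
    intro A B hA hB
    filter_upwards [condExp_mul_of_stronglyMeasurable_right (hκs B hB) (hmulint A B hA hB)
      (hind _ (hSA A hA)), hB1 B hB] with ω h1 h2
    rw [h1, Pi.mul_apply, h2]
  have hmulset : ∀ (A C : Set X) (B : Set Y), MeasurableSet A → MeasurableSet B →
      MeasurableSet C → ∫ ω in {ω : (X × Y) × (X × Y) | ω.1.1 ∈ C},
        (({ω : (X × Y) × (X × Y) | ω.2.1 ∈ A}.indicator fun _ => (1 : ℝ))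
          * fun ω : (X × Y) × (X × Y) => (κ ω.1.1).real B) ω ∂γ
        = ∫ ω in {ω : (X × Y) × (X × Y) | ω.1.1 ∈ C} ∩ {ω | ω.2.1 ∈ A},
          (κ ω.1.1).real B ∂γ := by
    intro A C B hA hB hC
    rw [← setIntegral_indicator (hSA A hA)]
    refine integral_congr_ae (ae_of_all _ fun ω => ?_)
    by_cases h : ω.2.1 ∈ A <;> simp [h]
  constructor
  · intro hc
    refine mem_causalLaws_of_measureReal_rectangle hfst fun A C B hA hB hC => ?_
    have hCm : MeasurableSet[sourceSigma X Y] {ω : (X × Y) × (X × Y) | ω.1.1 ∈ C} := ⟨C, hC, rfl⟩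
    have h1 := (hc A hA B hB).trans (hpull A B hA hB).symm
    rw [← setIntegral_indicator_one_eq _ ((hSA A hA).inter (hSB B hB)),
      ← setIntegral_condExp hmle (hind _ ((hSA A hA).inter (hSB B hB))) hCm,
      ← hmulset A C B hA hB hC, ← setIntegral_condExp hmle (hmulint A B hA hB) hCm]
    exact integral_congr_ae (ae_restrict_of_ae h1)
  · intro hc A hA B hB
    refine Filter.EventuallyEq.trans ?_ (hpull A B hA hB)
    refine (ae_eq_condExp_of_forall_setIntegral_eq hmle
      (hind _ ((hSA A hA).inter (hSB B hB))) (fun _ _ _ => integrable_condExp.integrableOn)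
      (fun s hs _ => ?_) stronglyMeasurable_condExp.aestronglyMeasurable).symm
    rw [setIntegral_condExp hmle (hmulint A B hA hB) hs]
    obtain ⟨C, hC, rfl⟩ := hset s hs
    rw [hmulset A C B hA hB hC,
      setIntegral_indicator_one_eq _ ((hSA A hA).inter (hSB B hB)),
      measureReal_rectangle_of_mem_causalLaws hc hA hB hC]

end Causality

/-! ### Integrability of positive and negative parts. -/

section NegativePart

variable {Ω : Type*} [MeasurableSpace Ω] {γ ν : Measure Ω}

/-- The negative part of the log-likelihood ratio is always integrable. -/
lemma lintegral_neg_llr_ne_top [IsProbabilityMeasure γ] [IsProbabilityMeasure ν] (hac : γ ≪ ν) :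
    ∫⁻ ω, ENNReal.ofReal (-llr γ ν ω) ∂γ ≠ ⊤ := by
  have hm : Measurable fun ω => ENNReal.ofReal (-llr γ ν ω) :=
    (measurable_llr γ ν).neg.ennreal_ofReal
  rw [← lintegral_rnDeriv_mul hac hm.aemeasurable]
  refine ne_top_of_le_ne_top ENNReal.one_ne_top ?_
  calc _ ≤ ∫⁻ _, 1 ∂ν := by
        refine lintegral_mono_ae ?_
        filter_upwards [Measure.rnDeriv_lt_top γ ν] with ω hω
        rw [← ENNReal.ofReal_toReal hω.ne, ← ENNReal.ofReal_mul ENNReal.toReal_nonneg, llr_def]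
        refine ENNReal.ofReal_le_one.2 ?_
        -- With `d` the density, `klFun d ≥ 0` reads `-d log d ≤ 1 - d`, which is at most `1`.
        have h := InformationTheory.klFun_nonneg (x := (γ.rnDeriv ν ω).toReal)
          ENNReal.toReal_nonneg
        have hn := ENNReal.toReal_nonneg (a := γ.rnDeriv ν ω)
        rw [InformationTheory.klFun_apply] at h
        linarith
    _ = 1 := by simp

lemma integrable_of_lintegral_ne_top {f : Ω → ℝ} (hf : Measurable f)
    (hp : ∫⁻ ω, ENNReal.ofReal (f ω) ∂γ ≠ ⊤) (hn : ∫⁻ ω, ENNReal.ofReal (-f ω) ∂γ ≠ ⊤) :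
    Integrable f γ := by
  refine ⟨hf.aestronglyMeasurable, ?_⟩
  have h : ∀ ω, ‖f ω‖ₑ = ENNReal.ofReal (f ω) + ENNReal.ofReal (-f ω) := fun ω => by
    rw [← ofReal_norm, Real.norm_eq_abs]
    rcases le_total 0 (f ω) with h | h
    · rw [abs_of_nonneg h, ENNReal.ofReal_of_nonpos (p := -f ω) (by linarith), add_zero]
    · rw [abs_of_nonpos h, ENNReal.ofReal_of_nonpos (p := f ω) h, zero_add]
  rw [HasFiniteIntegral]
  simp only [h]
  rw [lintegral_add_left hf.ennreal_ofReal]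
  exact (ENNReal.add_ne_top.2 ⟨hp, hn⟩).lt_top

lemma lintegral_ofReal_ne_top_of_le_add {f g h : Ω → ℝ} (hg : Measurable g)
    (hle : ∀ ω, f ω ≤ g ω + h ω) (hgt : ∫⁻ ω, ENNReal.ofReal (g ω) ∂γ ≠ ⊤)
    (hht : ∫⁻ ω, ENNReal.ofReal (h ω) ∂γ ≠ ⊤) : ∫⁻ ω, ENNReal.ofReal (f ω) ∂γ ≠ ⊤ := by
  refine ne_top_of_le_ne_top (ENNReal.add_ne_top.2 ⟨hgt, hht⟩) ?_
  rw [← lintegral_add_left hg.ennreal_ofReal]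
  exact lintegral_mono fun ω => (ENNReal.ofReal_le_ofReal (hle ω)).trans ENNReal.ofReal_add_le

lemma lintegral_ofReal_const_mul {f : Ω → ℝ} {c : ℝ} (hc : 0 ≤ c) :
    ∫⁻ ω, ENNReal.ofReal (c * f ω) ∂γ = ENNReal.ofReal c * ∫⁻ ω, ENNReal.ofReal (f ω) ∂γ := by
  rw [← lintegral_const_mul' _ _ ENNReal.ofReal_ne_top]
  exact lintegral_congr fun ω => ENNReal.ofReal_mul hc

lemma lintegral_ofReal_const_mul_ne_top_iff {f : Ω → ℝ} {c : ℝ} (hc : 0 < c) :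
    ∫⁻ ω, ENNReal.ofReal (c * f ω) ∂γ ≠ ⊤ ↔ ∫⁻ ω, ENNReal.ofReal (f ω) ∂γ ≠ ⊤ := by
  rw [lintegral_ofReal_const_mul hc.le]
  constructor
  · intro h h2
    exact h (by rw [h2, ENNReal.mul_top (by simpa using hc)])
  · exact fun h => ENNReal.mul_ne_top ENNReal.ofReal_ne_top h

lemma lintegral_comp_fst_eq {α β : Type*} [MeasurableSpace α] [MeasurableSpace β]
    {γ : Measure (α × β)} {P : Measure α} (hfst : γ.fst = P) {f : α → ℝ≥0∞} (hf : Measurable f) :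
    ∫⁻ ω, f ω.1 ∂γ = ∫⁻ a, f a ∂P := by
  rw [← hfst, Measure.fst, lintegral_map hf measurable_fst]

end NegativePart

/-! ### Real-valued log-normalizers. -/

section LogNormalizer

variable {E : Type*} [NormedAddCommGroup E] [MeasurableSpace E] {S : Set E}

/-- The logarithm of the normalizing constant, as a real number. -/
noncomputable def logNormalizer (p ε : ℝ) (ν : Measure S) (a : S) : ℝ :=
  Real.log (normalizer p ε ν a).toReal

variable {p ε : ℝ} {ν : Measure S}

lemma log_normalizer_eq {a : S} (h0 : normalizer p ε ν a ≠ 0) (ht : normalizer p ε ν a ≠ ⊤) :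
    ENNReal.log (normalizer p ε ν a) = (logNormalizer p ε ν a : EReal) :=
  ENNReal.log_pos_real h0 ht

lemma measurable_logNormalizer [BorelSpace E] [SecondCountableTopology E] [SFinite ν] :
    Measurable (logNormalizer p ε ν) :=
  Real.measurable_log.comp measurable_normalizer.ennreal_toReal

end LogNormalizer

/-- All normalizing constants are positive and finite. -/
structure RegularNormalizers {E F : Type*} [NormedAddCommGroup E] [MeasurableSpace E]
    [NormedAddCommGroup F] [MeasurableSpace F] {X : Set E} {Y : Set F} (p ε : ℝ) (νX : Measure X)
    (νY : Measure Y) : Prop where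
  ne_zero_left : ∀ a, normalizer p ε νX a ≠ 0
  ne_top_left : ∀ a, normalizer p ε νX a ≠ ⊤
  ne_zero_right : ∀ a, normalizer p ε νY a ≠ 0
  ne_top_right : ∀ a, normalizer p ε νY a ≠ ⊤

/-! ### The entropic cost as a relative entropy. -/

section EntropicCost

open InformationTheory

variable {E F : Type*} [NormedAddCommGroup E] [MeasurableSpace E] [NormedAddCommGroup F]
  [MeasurableSpace F] {X : Set E} {Y : Set F} {p ε : ℝ} {νX : Measure X} {νY : Measure Y}

variable (p ε νX νY) in
/-- The sum of the two log-normalizers. -/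
noncomputable def logNormalizerSum (a : X × Y) : ℝ :=
  logNormalizer p ε νX a.1 + logNormalizer p ε νY a.2

variable (p ε νX νY) in
/-- The density of the smoothed plan with respect to the product reference measure. -/
noncomputable def smoothingDensity (ω : (X × Y) × (X × Y)) : ℝ≥0∞ :=
  (normalizer p ε νX ω.1.1)⁻¹ * kernelDensity p ε ω.1.1 ω.2.1 *
    ((normalizer p ε νY ω.1.2)⁻¹ * kernelDensity p ε ω.1.2 ω.2.2)

lemma smoothingDensity_ne_zero (hN : RegularNormalizers p ε νX νY)
    (ω : (X × Y) × (X × Y)) : smoothingDensity p ε νX νY ω ≠ 0 :=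
  mul_ne_zero (mul_ne_zero (ENNReal.inv_ne_zero.2 (hN.ne_top_left _)) (kernelDensity_ne_zero _ _))
    (mul_ne_zero (ENNReal.inv_ne_zero.2 (hN.ne_top_right _)) (kernelDensity_ne_zero _ _))

lemma smoothingDensity_ne_top (hN : RegularNormalizers p ε νX νY)
    (ω : (X × Y) × (X × Y)) : smoothingDensity p ε νX νY ω ≠ ⊤ :=
  ENNReal.mul_ne_top
    (ENNReal.mul_ne_top (ENNReal.inv_ne_top.2 (hN.ne_zero_left _)) ENNReal.ofReal_ne_top)
    (ENNReal.mul_ne_top (ENNReal.inv_ne_top.2 (hN.ne_zero_right _)) ENNReal.ofReal_ne_top)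

/-- The identity by which the change of reference measure absorbs the transport cost, leaving only a
function of the source point. -/
lemma log_toReal_smoothingDensity (hN : RegularNormalizers p ε νX νY)
    (hε : 0 < ε) (ω : (X × Y) × (X × Y)) :
    ε * Real.log (smoothingDensity p ε νX νY ω).toReal
      = -(transportCost p ω.1 ω.2) - ε * logNormalizerSum p ε νX νY ω.1 := by
  have h1 := (ENNReal.toReal_pos (hN.ne_zero_left ω.1.1) (hN.ne_top_left ω.1.1)).ne'
  have h2 := (ENNReal.toReal_pos (hN.ne_zero_right ω.1.2) (hN.ne_top_right ω.1.2)).ne'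
  simp only [smoothingDensity, kernelDensity, ENNReal.toReal_mul, ENNReal.toReal_inv,
    ENNReal.toReal_ofReal (Real.exp_nonneg _)]
  rw [Real.log_mul (by positivity) (by positivity), Real.log_mul (by positivity) (by positivity),
    Real.log_mul (by positivity) (by positivity), Real.log_inv, Real.log_inv, Real.log_exp,
    Real.log_exp, logNormalizerSum, logNormalizer, logNormalizer, transportCost]
  field_simp
  ring

variable [BorelSpace E] [SecondCountableTopology E] [BorelSpace F] [SecondCountableTopology F]
  [SigmaFinite νX] [SigmaFinite νY] {P : Measure (X × Y)} [IsProbabilityMeasure P]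
  {κ : Kernel X Y} [IsMarkovKernel κ]

variable (p ε νX νY P κ) in
/-- The plan with independent smoothing kernels. -/
noncomputable def smoothedPlan : Measure ((X × Y) × (X × Y)) :=
  referencePlan P.fst κ (smoothing p ε νX) (smoothing p ε νY)

lemma measurable_smoothingDensity : Measurable (smoothingDensity p ε νX νY) := by
  have h1 : Measurable fun ω : (X × Y) × (X × Y) => (normalizer p ε νX ω.1.1)⁻¹ :=
    (measurable_normalizer.comp (by fun_prop)).inv
  have h2 : Measurable fun ω : (X × Y) × (X × Y) => (normalizer p ε νY ω.1.2)⁻¹ :=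
    (measurable_normalizer.comp (by fun_prop)).inv
  have h3 : Measurable fun ω : (X × Y) × (X × Y) => kernelDensity p ε ω.1.1 ω.2.1 :=
    measurable_kernelDensity_comp (by fun_prop) (by fun_prop)
  have h4 : Measurable fun ω : (X × Y) × (X × Y) => kernelDensity p ε ω.1.2 ω.2.2 :=
    measurable_kernelDensity_comp (by fun_prop) (by fun_prop)
  exact (h1.mul h3).mul (h2.mul h4)

lemma measurable_logNormalizerSum : Measurable (logNormalizerSum p ε νX νY) :=
  (measurable_logNormalizer.comp measurable_fst).add (measurable_logNormalizer.comp measurable_snd)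

lemma lintegral_smoothing {S : Set E} {ν : Measure S} [SFinite ν] (a : S) {g : S → ℝ≥0∞}
    (hg : Measurable g) : ∫⁻ u, g u ∂(smoothing p ε ν a)
      = ∫⁻ u, (normalizer p ε ν a)⁻¹ * kernelDensity p ε a u * g u ∂ν := by
  rw [smoothing_apply, smoothingKernel, lintegral_smul_measure,
    lintegral_withDensity_eq_lintegral_mul _ (measurable_kernelDensity_right a) hg, smul_eq_mul,
    ← lintegral_const_mul _ ((measurable_kernelDensity_right a).mul hg)]
  simp only [Pi.mul_apply, mul_assoc]

lemma smoothedPlan_eq_withDensity (hN : RegularNormalizers p ε νX νY)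
    (hκ : P.fst.compProd κ = P) :
    smoothedPlan p ε νX νY P κ
      = (P.prod (νX.prod νY)).withDensity (smoothingDensity p ε νX νY) := by
  have := isMarkovKernel_smoothing hN.ne_zero_left hN.ne_top_left
  have := isMarkovKernel_smoothing hN.ne_zero_right hN.ne_top_right
  refine Measure.ext_of_lintegral _ fun f hf => ?_
  have hm := measurable_smoothingDensity (p := p) (ε := ε) (νX := νX) (νY := νY)
  have hmf : Measurable fun ω => smoothingDensity p ε νX νY ω * f ω := hm.mul hf
  rw [smoothedPlan, lintegral_referencePlan hf, lintegral_withDensity_eq_lintegral_mul _ hm hf]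
  simp only [Pi.mul_apply]
  rw [lintegral_prod _ hmf.aemeasurable]
  have hPκ : ∀ g : X × Y → ℝ≥0∞, ∫⁻ a, g a ∂P = ∫⁻ a, g a ∂(P.fst.compProd κ) := by
    rw [hκ]; exact fun _ => rfl
  rw [hPκ, Measure.lintegral_compProd hmf.lintegral_prod_right']
  refine lintegral_congr fun xh => lintegral_congr fun yh => ?_
  have h2 : Measurable fun b : X × Y => smoothingDensity p ε νX νY ((xh, yh), b)
      * f ((xh, yh), b) := hmf.comp measurable_prodMk_left
  rw [lintegral_prod _ h2.aemeasurable]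
  have h3 : Measurable fun x => ∫⁻ y, f ((xh, yh), (x, y)) ∂(smoothing p ε νY yh) :=
    Measurable.lintegral_kernel_prod_right (κ := Kernel.const X (smoothing p ε νY yh))
      (f := fun x y => f ((xh, yh), (x, y)))
      (hf.comp (by fun_prop : Measurable fun z : X × Y => (((xh, yh), (z.1, z.2)) :
        (X × Y) × (X × Y))))
  rw [lintegral_smoothing xh h3]
  refine lintegral_congr fun x => ?_
  have h4 : Measurable fun y => f ((xh, yh), (x, y)) := hf.comp (by fun_prop)
  have h6 : Measurable fun y => (normalizer p ε νY yh)⁻¹ * kernelDensity p ε yh y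
      * f ((xh, yh), (x, y)) := ((measurable_kernelDensity_right yh).const_mul _).mul h4
  rw [lintegral_smoothing yh h4, ← lintegral_const_mul _ h6]
  refine lintegral_congr fun y => ?_
  simp only [smoothingDensity]
  ring

lemma isProbabilityMeasure_smoothedPlan (hN : RegularNormalizers p ε νX νY) :
    IsProbabilityMeasure (smoothedPlan p ε νX νY P κ) := by
  have := isMarkovKernel_smoothing hN.ne_zero_left hN.ne_top_left
  have := isMarkovKernel_smoothing hN.ne_zero_right hN.ne_top_right
  unfold smoothedPlan
  infer_instance

/-- The smoothing density never vanishes, so the two reference measures have the same null sets. -/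
lemma absolutelyContinuous_iff (hN : RegularNormalizers p ε νX νY)
    (hκ : P.fst.compProd κ = P) {γ : Measure ((X × Y) × (X × Y))} :
    γ ≪ P.prod (νX.prod νY) ↔ γ ≪ smoothedPlan p ε νX νY P κ := by
  rw [smoothedPlan_eq_withDensity hN hκ]
  exact ⟨fun h => h.trans (withDensity_absolutelyContinuous'
    measurable_smoothingDensity.aemeasurable
    (ae_of_all _ (smoothingDensity_ne_zero hN))),
    fun h => h.trans (withDensity_absolutelyContinuous _ _)⟩

/-- Changing the reference measure divides the density of `γ` by the smoothing density, whose
logarithm cancels the transport cost. -/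
lemma transportCost_add_llr_ae (hN : RegularNormalizers p ε νX νY)
    (hκ : P.fst.compProd κ = P) (hε : 0 < ε) {γ : Measure ((X × Y) × (X × Y))}
    [IsProbabilityMeasure γ] (hac : γ ≪ P.prod (νX.prod νY)) :
    ∀ᵐ ω ∂γ, transportCost p ω.1 ω.2 + ε * llr γ (P.prod (νX.prod νY)) ω
      = ε * (llr γ (smoothedPlan p ε νX νY P κ) ω - logNormalizerSum p ε νX νY ω.1) := by
  have h1 := Measure.rnDeriv_withDensity_right γ (P.prod (νX.prod νY))
    (measurable_smoothingDensity (p := p) (ε := ε) (νX := νX) (νY := νY)).aemeasurable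
    (ae_of_all _ (smoothingDensity_ne_zero hN))
    (ae_of_all _ (smoothingDensity_ne_top hN))
  rw [← smoothedPlan_eq_withDensity hN hκ] at h1
  filter_upwards [hac.ae_le h1, Measure.rnDeriv_pos hac,
    hac.ae_le (Measure.rnDeriv_lt_top γ (P.prod (νX.prod νY)))] with ω h2 h3 h4
  have h5 := log_toReal_smoothingDensity hN hε ω
  have h6 := ENNReal.toReal_pos h3.ne' h4.ne
  have h7 := ENNReal.toReal_pos (smoothingDensity_ne_zero hN ω)
    (smoothingDensity_ne_top hN ω)
  simp only [llr_def]
  rw [h2, ENNReal.toReal_mul, ENNReal.toReal_inv, Real.log_mul (by positivity) h6.ne',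
    Real.log_inv]
  linarith

lemma entropicCost_eq_neg_eexp (hN : RegularNormalizers p ε νX νY)
    (hκ : P.fst.compProd κ = P) (hε : 0 < ε) {γ : Measure ((X × Y) × (X × Y))}
    [IsProbabilityMeasure γ] (hac : γ ≪ P.prod (νX.prod νY)) :
    entropicCost p ε νX νY P γ = -eexp γ (fun ω => ((-(ε * (llr γ (smoothedPlan p ε νX νY P κ) ω
      - logNormalizerSum p ε νX νY ω.1)) : ℝ) : EReal)) := by
  rw [entropicCost, if_pos hac]
  congr 1
  refine eexp_congr_ae ?_
  filter_upwards [transportCost_add_llr_ae hN hκ hε hac] with ω hω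
  rw [hω]

lemma entropicCost_eq_top_of_lintegral (hN : RegularNormalizers p ε νX νY)
    (hκ : P.fst.compProd κ = P) (hε : 0 < ε) {γ : Measure ((X × Y) × (X × Y))}
    [IsProbabilityMeasure γ] (h : ∫⁻ ω, ENNReal.ofReal (llr γ (smoothedPlan p ε νX νY P κ) ω
      - logNormalizerSum p ε νX νY ω.1) ∂γ = ⊤) : entropicCost p ε νX νY P γ = ⊤ := by
  by_cases hac : γ ≪ P.prod (νX.prod νY)
  · rw [entropicCost_eq_neg_eexp hN hκ hε hac, eexp_eq_bot, EReal.neg_bot]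
    by_contra hne
    refine (lintegral_ofReal_const_mul_ne_top_iff hε).1 ?_ h
    simpa only [← EReal.coe_neg, EReal.real_coe_toENNReal, neg_neg] using hne
  · rw [entropicCost, if_neg hac]

/-- The entropic cost as a relative entropy with respect to the smoothed plan. -/
lemma entropicCost_eq (hN : RegularNormalizers p ε νX νY)
    (hκ : P.fst.compProd κ = P) (hε : 0 < ε) {γ : Measure ((X × Y) × (X × Y))} (hfst : γ.fst = P)
    (hs : Integrable (logNormalizerSum p ε νX νY) P) :
    entropicCost p ε νX νY P γ
      = ((ENNReal.ofReal ε * klDiv γ (smoothedPlan p ε νX νY P κ) : ℝ≥0∞) : EReal)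
        - ((ε * ∫ a, logNormalizerSum p ε νX νY a ∂P : ℝ) : EReal) := by
  have hp := isProbabilityMeasure_of_fst_eq hfst
  have hr := isProbabilityMeasure_smoothedPlan (P := P) (κ := κ) hN
  have hsm := measurable_logNormalizerSum (p := p) (ε := ε) (νX := νX) (νY := νY)
  have htop : klDiv γ (smoothedPlan p ε νX νY P κ) = ⊤ →
      ((ENNReal.ofReal ε * klDiv γ (smoothedPlan p ε νX νY P κ) : ℝ≥0∞) : EReal)
        - ((ε * ∫ a, logNormalizerSum p ε νX νY a ∂P : ℝ) : EReal) = ⊤ := fun h => by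
    rw [h, ENNReal.mul_top (by simpa using hε), EReal.coe_ennreal_top,
      EReal.top_sub (EReal.coe_ne_top _)]
  by_cases hac : γ ≪ P.prod (νX.prod νY)
  swap
  · rw [htop (klDiv_of_not_ac ((absolutelyContinuous_iff hN hκ).not.1 hac)),
      entropicCost, if_neg hac]
  have hac' := (absolutelyContinuous_iff hN hκ).1 hac
  have hsγ : Integrable (fun ω : (X × Y) × (X × Y) => logNormalizerSum p ε νX νY ω.1) γ := by
    rw [← hfst] at hs
    exact hs.comp_measurable measurable_fst
  by_cases hi : Integrable (llr γ (smoothedPlan p ε νX νY P κ)) γ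
  · rw [entropicCost_eq_neg_eexp hN hκ hε hac, eexp_real
      (by exact ((hi.sub hsγ).const_mul ε).neg)]
    have hk := klDiv_ne_top hac' hi
    have e1 : ∫ ω, logNormalizerSum p ε νX νY ω.1 ∂γ = ∫ a, logNormalizerSum p ε νX νY a ∂P := by
      rw [← hfst, Measure.fst, integral_map measurable_fst.aemeasurable hsm.aestronglyMeasurable]
    rw [← ENNReal.ofReal_toReal hk, ← ENNReal.ofReal_mul hε.le, EReal.coe_ennreal_ofReal,
      max_eq_left (by positivity), toReal_klDiv_of_measure_eq hac' (by simp), ← EReal.coe_neg,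
      ← EReal.coe_sub, integral_neg, integral_const_mul, integral_sub hi hsγ, e1]
    congr 1
    ring
  -- The negative part of the log-likelihood ratio is always integrable, so here the positive part
  -- is infinite; the integrable normalizers cannot compensate.
  · rw [htop (klDiv_of_not_integrable hi)]
    refine entropicCost_eq_top_of_lintegral hN hκ hε ?_
    by_contra hne
    refine hi (integrable_of_lintegral_ne_top (measurable_llr _ _) ?_
      (lintegral_neg_llr_ne_top hac'))
    exact lintegral_ofReal_ne_top_of_le_add
      ((measurable_llr _ _).sub (hsm.comp measurable_fst))
      (h := fun ω => logNormalizerSum p ε νX νY ω.1)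
      (fun ω => by simp) hne hsγ.lintegral_lt_top.ne

/-- The entropic cost is infinite when the log-normalizers have infinite negative part. -/
lemma entropicCost_eq_top (hN : RegularNormalizers p ε νX νY)
    (hκ : P.fst.compProd κ = P) (hε : 0 < ε) {γ : Measure ((X × Y) × (X × Y))} (hfst : γ.fst = P)
    (hs : ∫⁻ a, ENNReal.ofReal (-logNormalizerSum p ε νX νY a) ∂P = ⊤) :
    entropicCost p ε νX νY P γ = ⊤ := by
  have hp := isProbabilityMeasure_of_fst_eq hfst
  have hr := isProbabilityMeasure_smoothedPlan (P := P) (κ := κ) hN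
  have hsm := measurable_logNormalizerSum (p := p) (ε := ε) (νX := νX) (νY := νY)
  by_cases hac : γ ≪ P.prod (νX.prod νY)
  swap
  · rw [entropicCost, if_neg hac]
  have hac' := (absolutelyContinuous_iff hN hκ).1 hac
  refine entropicCost_eq_top_of_lintegral hN hκ hε ?_
  by_contra hne
  rw [← lintegral_comp_fst_eq hfst
    (f := fun a => ENNReal.ofReal (-logNormalizerSum p ε νX νY a)) hsm.neg.ennreal_ofReal] at hs
  -- With `S` the log-normalizer sum, `-S = (llr - S) + (-llr)`: finite positive parts on the right
  -- would contradict `hs`.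
  refine lintegral_ofReal_ne_top_of_le_add
      ((measurable_llr γ (smoothedPlan p ε νX νY P κ)).sub (hsm.comp measurable_fst))
      (h := fun ω => -llr γ (smoothedPlan p ε νX νY P κ) ω)
      (fun ω => ?_) hne (lintegral_neg_llr_ne_top hac') hs
  simp

/-- The smoothed plan has entropic cost `-∞` when the log-normalizers have infinite positive part
only. -/
lemma entropicCost_smoothedPlan_eq_bot (hN : RegularNormalizers p ε νX νY)
    (hκ : P.fst.compProd κ = P) (hε : 0 < ε)
    (hfst : (smoothedPlan p ε νX νY P κ).fst = P)
    (hsp : ∫⁻ a, ENNReal.ofReal (logNormalizerSum p ε νX νY a) ∂P = ⊤)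
    (hsn : ∫⁻ a, ENNReal.ofReal (-logNormalizerSum p ε νX νY a) ∂P ≠ ⊤) :
    entropicCost p ε νX νY P (smoothedPlan p ε νX νY P κ) = ⊥ := by
  have hr := isProbabilityMeasure_smoothedPlan (P := P) (κ := κ) hN
  have hsm := measurable_logNormalizerSum (p := p) (ε := ε) (νX := νX) (νY := νY)
  have hac : smoothedPlan p ε νX νY P κ ≪ P.prod (νX.prod νY) :=
    (absolutelyContinuous_iff hN hκ).2 (Measure.AbsolutelyContinuous.refl _)
  have hcongr : eexp (smoothedPlan p ε νX νY P κ) (fun ω =>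
      ((-(ε * (llr (smoothedPlan p ε νX νY P κ) (smoothedPlan p ε νX νY P κ) ω
      - logNormalizerSum p ε νX νY ω.1)) : ℝ) : EReal))
      = eexp (smoothedPlan p ε νX νY P κ)
        (fun ω => ((ε * logNormalizerSum p ε νX νY ω.1 : ℝ) : EReal)) := by
    refine eexp_congr_ae ?_
    filter_upwards [llr_self (smoothedPlan p ε νX νY P κ)] with ω hω
    rw [hω]
    simp
  rw [entropicCost_eq_neg_eexp hN hκ hε hac, hcongr, eexp_eq_top, EReal.neg_top]
  · simp only [EReal.real_coe_toENNReal]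
    rw [lintegral_ofReal_const_mul hε.le, lintegral_comp_fst_eq hfst hsm.ennreal_ofReal, hsp,
      ENNReal.mul_top (by simpa using hε)]
  · simp only [← EReal.coe_neg, EReal.real_coe_toENNReal, ← mul_neg]
    rw [lintegral_ofReal_const_mul hε.le, lintegral_comp_fst_eq hfst
      (f := fun a => ENNReal.ofReal (-logNormalizerSum p ε νX νY a)) hsm.neg.ennreal_ofReal]
    exact ENNReal.mul_ne_top ENNReal.ofReal_ne_top hsn

end EntropicCost

/-! ### The loss above its lower bound. -/

section ExcessLoss

variable {X Y Z : Type*} [MeasurableSpace X] [MeasurableSpace Y] [MeasurableSpace Z] {f : X → Z}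
  {Ψ : Z × Y → EReal} {M : ℝ}

/-- The excess of the loss over its lower bound `M`. -/
noncomputable def excessLoss (f : X → Z) (Ψ : Z × Y → EReal) (M : ℝ) (x : X) (y : Y) : ℝ≥0∞ :=
  (Ψ (f x, y) - (M : EReal)).toENNReal

lemma coe_toENNReal_sub_add {c : EReal} (h : (M : EReal) ≤ c) :
    (((c - (M : EReal)).toENNReal : ℝ≥0∞) : EReal) + (M : EReal) = c := by
  rw [EReal.coe_toENNReal ((EReal.sub_nonneg (by simp) (by simp)).2 h), EReal.sub_add_cancel]

lemma coe_excessLoss_add (hM : ∀ w, (M : EReal) ≤ Ψ w) (x : X) (y : Y) :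
    (excessLoss f Ψ M x y : EReal) + (M : EReal) = Ψ (f x, y) :=
  coe_toENNReal_sub_add (hM _)

lemma measurable_excessLoss (hf : Measurable f) (hΨ : Measurable Ψ) :
    Measurable (Function.uncurry (excessLoss f Ψ M)) := by
  have h1 : Measurable fun z : X × Y => Ψ (f z.1, z.2) := hΨ.comp (by fun_prop)
  have h2 : Measurable fun z : X × Y => Ψ (f z.1, z.2) - (M : EReal) := by
    simp only [sub_eq_add_neg]
    exact h1.add_const _
  exact measurable_ereal_toENNReal.comp h2

lemma eexp_const {Ω : Type*} [MeasurableSpace Ω] {μ : Measure Ω} [IsProbabilityMeasure μ]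
    (c : EReal) : eexp μ (fun _ => c) = c := by
  simp only [eexp, lintegral_const, measure_univ, mul_one]
  induction c with
  | bot => simp
  | top => simp
  | coe r =>
    rw [← EReal.coe_neg, EReal.real_coe_toENNReal, EReal.real_coe_toENNReal,
      EReal.coe_ennreal_ofReal, EReal.coe_ennreal_ofReal, ← EReal.coe_sub, EReal.coe_eq_coe_iff]
    rcases max_cases r 0 with ⟨h1, _⟩ | ⟨h1, _⟩ <;>
    rcases max_cases (-r) 0 with ⟨h2, _⟩ | ⟨h2, _⟩ <;>
    rw [h1, h2] <;> linarith

lemma eexp_coe_add_affine {Ω : Type*} [MeasurableSpace Ω] {μ : Measure Ω} [IsProbabilityMeasure μ]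
    {F : Ω → ℝ≥0∞} (hF : Measurable F) {g : Ω → ℝ} (hg : Integrable g μ) (a b : ℝ) :
    eexp μ (fun ω => (F ω : EReal) + ((a + b * g ω : ℝ) : EReal))
      = ((∫⁻ ω, F ω ∂μ : ℝ≥0∞) : EReal) + ((a + b * ∫ ω, g ω ∂μ : ℝ) : EReal) := by
  have h := hg.const_mul b
  have h1 : Integrable (fun ω => a + b * g ω) μ := (integrable_const a).add h
  rw [eexp_coe_add_real hF.aemeasurable h1, integral_add (integrable_const a) h, integral_const,
    integral_const_mul, probReal_univ, one_smul]

end ExcessLoss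

/-! ### The dual problem in terms of the smoothing kernels. -/

section RegularModels

variable {E F G : Type*} [NormedAddCommGroup E] [MeasurableSpace E] [NormedAddCommGroup F]
  [MeasurableSpace F] [MeasurableSpace G] {X : Set E} {Y : Set F} {Z : Set G} {p ε ρ M l : ℝ}
  {νX : Measure X} {νY : Measure Y} {P : Measure (X × Y)} {κ : Kernel X Y} {f : X → Z}
  {Ψ : Z × Y → EReal}

variable (p ε νX νY P κ f Ψ M) in
/-- A model whose log-normalizers are integrable and whose loss is bounded below by `M`. -/
structure RegularModel : Prop where
  normalizers : RegularNormalizers p ε νX νY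
  eps_pos : 0 < ε
  disintegration : P.fst.compProd κ = P
  measurable_map : Measurable f
  measurable_loss : Measurable Ψ
  le_loss : ∀ w, (M : EReal) ≤ Ψ w
  integrable_left : Integrable (logNormalizer p ε νX) P.fst
  integrable_right : Integrable (fun a : X × Y => logNormalizer p ε νY a.2) P

namespace RegularModel

lemma integrable_logNormalizerSum (h : RegularModel p ε M νX νY P κ f Ψ) :
    Integrable (logNormalizerSum p ε νX νY) P :=
  (h.integrable_left.comp_measurable (f := Prod.fst) measurable_fst).add h.integrable_right

end RegularModel

variable (p ε ρ νX νY P) in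
/-- The adjusted radius as a real number. -/
noncomputable def realRadius : ℝ := ρ ^ p + ε * ∫ a, logNormalizerSum p ε νX νY a ∂P

lemma expectedLoss_eq {Q : Measure (X × Y)} [IsProbabilityMeasure Q] (hf : Measurable f)
    (hΨ : Measurable Ψ) (hM : ∀ w, (M : EReal) ≤ Ψ w) : expectedLoss f Ψ Q
      = ((∫⁻ b, excessLoss f Ψ M b.1 b.2 ∂Q : ℝ≥0∞) : EReal) + (M : EReal) := by
  have h := eexp_coe_add_real (μ := Q) (F := fun b => excessLoss f Ψ M b.1 b.2)
    (measurable_excessLoss hf hΨ).aemeasurable (integrable_const M)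
  simp only [coe_excessLoss_add hM, integral_const, probReal_univ, one_smul] at h
  exact h

variable [BorelSpace E] [SecondCountableTopology E] [BorelSpace F] [SecondCountableTopology F]
  [SigmaFinite νX] [SigmaFinite νY]

variable (p ε M νX νY P κ f Ψ) in
/-- The dual functional of the excess loss with respect to the smoothing kernels. -/
noncomputable def excessDual (τ : ℝ) : ℝ≥0∞ :=
  softDual τ P.fst κ (smoothing p ε νX) (smoothing p ε νY) (excessLoss f Ψ M)

variable [IsProbabilityMeasure P] [IsMarkovKernel κ]

namespace RegularModel

lemma isMarkovKernel_left (h : RegularModel p ε M νX νY P κ f Ψ) :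
    IsMarkovKernel (smoothing p ε νX) :=
  isMarkovKernel_smoothing h.normalizers.ne_zero_left h.normalizers.ne_top_left

lemma isMarkovKernel_right (h : RegularModel p ε M νX νY P κ f Ψ) :
    IsMarkovKernel (smoothing p ε νY) :=
  isMarkovKernel_smoothing h.normalizers.ne_zero_right h.normalizers.ne_top_right

/-- The `y`-part of the cost goes into the smoothing kernel and its normalizer; the `x`-part is
constant here and waits for the outer layer. -/
lemma softSup_sub_transportCost_eq (h : RegularModel p ε M νX νY P κ f Ψ) (hl : 0 < l) (xh x : X)
    (yh : Y) : softSup (l * ε) νY (fun y =>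
      Ψ (f x, y) - ((l * transportCost p (xh, yh) (x, y) : ℝ) : EReal))
      = (logMeanExp (l * ε) (smoothing p ε νY yh) (excessLoss f Ψ M x) : EReal)
        + ((M - l * ‖(x : E) - xh‖ ^ p + l * ε * logNormalizer p ε νY yh : ℝ) : EReal) := by
  have hε := h.eps_pos
  have h2 := softSup_coe_add_real (ν := νY) (mul_pos hl hε) (h := excessLoss f Ψ M x)
    (M - l * ‖(x : E) - xh‖ ^ p) (d := fun y : Y => ‖(y : F) - yh‖ ^ p / ε) (by fun_prop)
    (k := kernelDensity p ε yh) (fun y => by simp only [kernelDensity, neg_div])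
    (h.normalizers.ne_zero_right yh) (h.normalizers.ne_top_right yh)
  refine Eq.trans ?_ h2
  congr 1
  funext y
  rw [← coe_excessLoss_add h.le_loss, sub_eq_add_neg, add_assoc, ← EReal.coe_neg,
    ← EReal.coe_add]
  congr 2
  simp only [transportCost]
  field_simp
  ring

lemma measurable_logMeanExp_excessLoss (h : RegularModel p ε M νX νY P κ f Ψ) {τ : ℝ} (hτ : 0 < τ)
    (x : X) : Measurable fun yh => logMeanExp τ (smoothing p ε νY yh) (excessLoss f Ψ M x) := by
  have := h.isMarkovKernel_right
  have hφ := measurable_excessLoss (M := M) h.measurable_map h.measurable_loss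
  have h1 : Measurable (Function.uncurry fun _ : Y => excessLoss f Ψ M x) :=
    hφ.comp (measurable_const.prodMk measurable_snd)
  exact measurable_logMeanExp hτ (smoothing p ε νY) h1

lemma dualInner_eq (h : RegularModel p ε M νX νY P κ f Ψ) (hl : 0 < l) {xh : X}
    (hxh : Integrable (logNormalizer p ε νY) (κ xh)) (x : X) :
    dualInner p ε νY κ f Ψ l xh x
      = ((∫⁻ yh, logMeanExp (l * ε) (smoothing p ε νY yh) (excessLoss f Ψ M x) ∂(κ xh) : ℝ≥0∞) :
          EReal)
        + ((M - l * ‖(x : E) - xh‖ ^ p + l * ε * ∫ yh, logNormalizer p ε νY yh ∂(κ xh) : ℝ) :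
          EReal) := by
  have hε := h.eps_pos
  have hτ : 0 < l * ε := mul_pos hl hε
  have := h.isMarkovKernel_right
  rw [dualInner, funext fun yh => h.softSup_sub_transportCost_eq hl xh x yh]
  exact eexp_coe_add_affine (h.measurable_logMeanExp_excessLoss hτ x) hxh _ _

/-- The dual counterpart of `entropicCost_eq`: the normalizers released by the two layers average to
the correction turning `ρ ^ p` into the adjusted radius. -/
lemma dualObjective_eq (h : RegularModel p ε M νX νY P κ f Ψ) (hl : 0 < l) :
    dualObjective p ε ρ νX νY P κ f Ψ l
      = (excessDual p ε M νX νY P κ f Ψ (l * ε) : EReal)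
        + ((M + l * realRadius p ε ρ νX νY P : ℝ) : EReal) := by
  have hε := h.eps_pos
  have hτ : 0 < l * ε := mul_pos hl hε
  have := h.isMarkovKernel_left
  have := h.isMarkovKernel_right
  have hY := h.integrable_right
  rw [← h.disintegration] at hY
  obtain ⟨hY1, hY2⟩ := (Measure.integrable_compProd_iff hY.aestronglyMeasurable).1 hY
  have hmY : Integrable (fun xh => ∫ yh, logNormalizer p ε νY yh ∂(κ xh)) P.fst :=
    hY2.mono' (StronglyMeasurable.integral_kernel
      measurable_logNormalizer.stronglyMeasurable).aestronglyMeasurable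
      (ae_of_all _ fun xh => norm_integral_le_integral_norm _)
  have hiY : ∫ xh, ∫ yh, logNormalizer p ε νY yh ∂(κ xh) ∂P.fst
      = ∫ a, logNormalizer p ε νY a.2 ∂P := by
    conv_rhs => rw [← h.disintegration, Measure.integral_compProd hY]
  have h1 : (fun xh => softSup (l * ε) νX (fun x => dualInner p ε νY κ f Ψ l xh x)) =ᵐ[P.fst]
      fun xh => (logMeanExp (l * ε) (smoothing p ε νX xh) (fun x =>
          ∫⁻ yh, logMeanExp (l * ε) (smoothing p ε νY yh) (excessLoss f Ψ M x) ∂(κ xh)) : EReal)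
        + ((M + l * ε * (logNormalizer p ε νX xh + ∫ yh, logNormalizer p ε νY yh ∂(κ xh)) : ℝ) :
          EReal) := by
    -- Integrability of the log-normalizer under `κ x̂` is only known for almost every `x̂`.
    filter_upwards [hY1] with xh hxh
    have h2 := softSup_coe_add_real (ν := νX) hτ (h := fun x =>
        ∫⁻ yh, logMeanExp (l * ε) (smoothing p ε νY yh) (excessLoss f Ψ M x) ∂(κ xh))
      (M + l * ε * ∫ yh, logNormalizer p ε νY yh ∂(κ xh))
      (d := fun x : X => ‖(x : E) - xh‖ ^ p / ε) (by fun_prop)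
      (k := kernelDensity p ε xh) (fun y => by simp only [kernelDensity, neg_div])
      (h.normalizers.ne_zero_left xh) (h.normalizers.ne_top_left xh)
    refine Eq.trans ?_ (h2.trans ?_)
    · congr 1
      funext x
      rw [h.dualInner_eq hl hxh]
      congr 2
      field_simp
      ring
    · congr 2
      simp only [logNormalizer, normalizer]
      ring
  have hm := measurable_softDual_integrand (κ := κ) (qX := smoothing p ε νX)
    (qY := smoothing p ε νY) hτ (measurable_excessLoss (M := M) h.measurable_map h.measurable_loss)
  have hi : Integrable (fun xh => logNormalizer p ε νX xh
      + ∫ yh, logNormalizer p ε νY yh ∂(κ xh)) P.fst := h.integrable_left.add hmY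
  have e1 : ∫ xh, (logNormalizer p ε νX xh + ∫ yh, logNormalizer p ε νY yh ∂(κ xh)) ∂P.fst
      = ∫ a, logNormalizerSum p ε νX νY a ∂P := by
    have hX : Integrable (fun a : X × Y => logNormalizer p ε νX a.1) P :=
      h.integrable_left.comp_measurable measurable_fst
    unfold logNormalizerSum
    rw [integral_add h.integrable_left hmY, hiY,
      integral_add hX h.integrable_right]
    congr 1
    rw [Measure.fst, integral_map measurable_fst.aemeasurable
      measurable_logNormalizer.aestronglyMeasurable]
  rw [dualObjective, eexp_congr_ae h1, eexp_coe_add_affine hm hi, e1, add_left_comm,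
    ← EReal.coe_add]
  congr 2
  rw [realRadius]
  ring

/-- A log-mean-exp under a probability absolutely continuous with respect to `ν` is below the
`ν`-essential supremum. This lets the zero multiplier be handled by comparison with positive
temperatures. -/
lemma exists_dualObjective_zero_eq (h : RegularModel p ε M νX νY P κ f Ψ) :
    ∃ C : ℝ≥0∞, dualObjective p ε ρ νX νY P κ f Ψ 0 = (C : EReal) + (M : EReal) ∧
      ∀ τ, 0 < τ → excessDual p ε M νX νY P κ f Ψ τ ≤ C := by
  have := h.isMarkovKernel_left
  have := h.isMarkovKernel_right
  obtain ⟨⟨xh0, yh0⟩⟩ : Nonempty (X × Y) := nonempty_of_isProbabilityMeasure P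
  have hX0 : νX ≠ 0 := fun h0 => h.normalizers.ne_zero_left xh0 (by simp [normalizer, h0])
  have hY0 : νY ≠ 0 := fun h0 => h.normalizers.ne_zero_right yh0 (by simp [normalizer, h0])
  set e : X → EReal := fun x => essSup (fun y => Ψ (f x, y)) νY with he
  have heM : ∀ x, (M : EReal) ≤ e x := fun x => by
    rw [← essSup_const (M : EReal) hY0]
    exact essSup_mono_ae (ae_of_all _ fun y => h.le_loss _)
  have heM' : (M : EReal) ≤ essSup e νX := by
    rw [← essSup_const (M : EReal) hX0]
    exact essSup_mono_ae (ae_of_all _ heM)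
  have hacX : ∀ xh, smoothing p ε νX xh ≪ νX := fun xh =>
    Measure.smul_absolutelyContinuous.trans (withDensity_absolutelyContinuous _ _)
  have hacY : ∀ yh, smoothing p ε νY yh ≪ νY := fun yh =>
    Measure.smul_absolutelyContinuous.trans (withDensity_absolutelyContinuous _ _)
  have hmono : Monotone fun c : EReal => (c - (M : EReal)).toENNReal := fun a b hab =>
    EReal.toENNReal_le_toENNReal (EReal.sub_le_sub hab le_rfl)
  refine ⟨(essSup e νX - (M : EReal)).toENNReal, ?_, fun τ hτ => ?_⟩
  · rw [coe_toENNReal_sub_add heM']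
    simp only [dualObjective, dualInner, softSup, zero_mul, if_true, EReal.coe_zero, sub_zero,
      eexp_const, zero_add]
    rfl
  · have h1 : ∀ yh x, logMeanExp τ (smoothing p ε νY yh) (excessLoss f Ψ M x)
        ≤ (e x - (M : EReal)).toENNReal := fun yh x =>
      logMeanExp_const_le hτ ((hacY yh).ae_le
        ((ae_le_essSup (f := fun y => Ψ (f x, y)) (μ := νY)).mono fun y hy => hmono hy))
    have h2 : ∀ xh x, ∫⁻ yh, logMeanExp τ (smoothing p ε νY yh) (excessLoss f Ψ M x) ∂(κ xh)
        ≤ (e x - (M : EReal)).toENNReal := fun xh x =>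
      (lintegral_mono fun yh => h1 yh x).trans (by simp)
    have h3 : ∀ xh, logMeanExp τ (smoothing p ε νX xh) (fun x =>
        ∫⁻ yh, logMeanExp τ (smoothing p ε νY yh) (excessLoss f Ψ M x) ∂(κ xh))
        ≤ (essSup e νX - (M : EReal)).toENNReal := fun xh =>
      logMeanExp_const_le hτ ((hacX xh).ae_le
        ((ae_le_essSup (f := e) (μ := νX)).mono fun x hx => (h2 xh x).trans (hmono hx)))
    exact (lintegral_mono h3).trans (by simp)

/-- Finiteness of the nested functional descends layer by layer to almost every inner exponential
integral. -/
lemma lightTail_of_excessDual_ne_top (h : RegularModel p ε M νX νY P κ f Ψ) {τ : ℝ} (hτ : 0 < τ)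
    (hfin : excessDual p ε M νX νY P κ f Ψ τ ≠ ⊤) : LightTail p ε νX νY P f Ψ := by
  have hε := h.eps_pos
  have := h.isMarkovKernel_left
  have := h.isMarkovKernel_right
  have hφ := measurable_excessLoss (M := M) h.measurable_map h.measurable_loss
  have hA : MeasurableSet {w : Y × X |
      logMeanExp τ (smoothing p ε νY w.1) (excessLoss f Ψ M w.2) ≠ ⊤} :=
    (measurable_logMeanExp_inner (qY := smoothing p ε νY) hτ hφ)
      (measurableSet_singleton (⊤ : ℝ≥0∞)).compl
  -- The kernel density is positive, so statements holding almost everywhere for the kernel hold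
  -- `νX`-almost everywhere.
  have hac : ∀ xh, νX ≪ smoothing p ε νX xh := fun xh => by
    have h1 : νX ≪ νX.withDensity (kernelDensity p ε xh) :=
      withDensity_absolutelyContinuous' (measurable_kernelDensity_right xh).aemeasurable
        (ae_of_all _ (kernelDensity_ne_zero xh))
    exact h1.trans (Measure.absolutelyContinuous_smul
      (ENNReal.inv_ne_zero.2 (h.normalizers.ne_top_left xh)))
  have h1 : ∀ᵐ xh ∂P.fst, ∀ᵐ yh ∂(κ xh), ∀ᵐ x ∂νX,
      logMeanExp τ (smoothing p ε νY yh) (excessLoss f Ψ M x) ≠ ⊤ := by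
    filter_upwards [ae_lt_top (measurable_softDual_integrand (κ := κ) (qX := smoothing p ε νX)
      (qY := smoothing p ε νY) hτ hφ) hfin] with xh hxh
    have h2 := (hac xh).ae_le (ae_lt_top ((measurable_lintegral_logMeanExp (κ := κ)
      (qY := smoothing p ε νY) hτ hφ).comp measurable_prodMk_left)
      (lintegral_ne_top_of_logMeanExp_ne_top hτ hxh.ne))
    have h3 : ∀ᵐ x ∂νX, ∀ᵐ yh ∂(κ xh),
        logMeanExp τ (smoothing p ε νY yh) (excessLoss f Ψ M x) ≠ ⊤ := by
      filter_upwards [h2] with x hx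
      filter_upwards [ae_lt_top ((measurable_logMeanExp_inner (qY := smoothing p ε νY) hτ hφ).comp
        measurable_prodMk_right) hx.ne] with yh hyh using hyh.ne
    exact (Measure.ae_ae_comm hA).2 h3
  have hS : MeasurableSet {w : (X × Y) × X |
      logMeanExp τ (smoothing p ε νY w.1.2) (excessLoss f Ψ M w.2) ≠ ⊤} :=
    (by fun_prop : Measurable fun w : (X × Y) × X => ((w.1.2, w.2) : Y × X)) hA
  have hT : MeasurableSet {a : X × Y | ∀ᵐ x ∂νX,
      logMeanExp τ (smoothing p ε νY a.2) (excessLoss f Ψ M x) ≠ ⊤} :=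
    (measurable_measure_prodMk_left (ν := νX) hS.compl) (measurableSet_singleton 0)
  have h4 : ∀ᵐ a ∂P, ∀ᵐ x ∂νX,
      logMeanExp τ (smoothing p ε νY a.2) (excessLoss f Ψ M x) ≠ ⊤ := by
    rw [← h.disintegration]
    exact (Measure.ae_compProd_iff hT).2 h1
  -- This multiplier makes the temperature `l * ε` equal to `τ`.
  refine ⟨τ / ε, by positivity, ?_⟩
  filter_upwards [(Measure.ae_prod_iff_ae_ae hS).2 h4] with w hw
  rw [div_mul_cancel₀ _ hε.ne']
  simp only [← coe_excessLoss_add (f := f) h.le_loss, exp_coe_add_real_div hτ]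
  rw [lintegral_const_mul' _ _ ENNReal.ofReal_ne_top]
  exact ENNReal.mul_lt_top ENNReal.ofReal_lt_top (lintegral_scaledExp_ne_top hτ hw).lt_top

end RegularModel

end RegularModels

/-! ### Feasibility and duality in the integrable case. -/

section StrongDuality

open InformationTheory

variable {E F G : Type*} [NormedAddCommGroup E] [MeasurableSpace E] [NormedAddCommGroup F]
  [MeasurableSpace F] [MeasurableSpace G] {X : Set E} {Y : Set F} {Z : Set G} {p ε ρ M l : ℝ}
  {νX : Measure X} {νY : Measure Y} {P : Measure (X × Y)} {κ : Kernel X Y} {f : X → Z}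
  {Ψ : Z × Y → EReal}

lemma mem_causalPlans_iff [IsProbabilityMeasure P] [IsMarkovKernel κ]
    (hκ : P.fst.compProd κ = P) {Q : Measure (X × Y)} {γ : Measure ((X × Y) × (X × Y))} :
    γ ∈ causalPlans P Q ↔ γ ∈ causalLaws P.fst κ ∧ γ.snd = Q := by
  constructor
  · rintro ⟨h1, h2, h3⟩
    exact ⟨(isCausal_iff_mem_causalLaws (h1.trans hκ.symm)).1 h3, h2⟩
  · rintro ⟨h1, h2⟩
    exact ⟨h1.1.trans hκ, h2, (isCausal_iff_mem_causalLaws h1.1).2 h1⟩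

lemma isProbabilityMeasure_snd_of_mem_causalLaws [IsProbabilityMeasure P] [IsMarkovKernel κ]
    {γ : Measure ((X × Y) × (X × Y))} (hγ : γ ∈ causalLaws P.fst κ) :
    IsProbabilityMeasure γ.snd := by
  have := isProbabilityMeasure_of_mem_causalLaws hγ
  infer_instance

lemma lintegral_snd_excessLoss (hf : Measurable f) (hΨ : Measurable Ψ)
    {γ : Measure ((X × Y) × (X × Y))} : ∫⁻ b, excessLoss f Ψ M b.1 b.2 ∂γ.snd
      = ∫⁻ ω, excessLoss f Ψ M ω.2.1 ω.2.2 ∂γ :=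
  lintegral_map (measurable_excessLoss hf hΨ) measurable_snd

variable [BorelSpace E] [SecondCountableTopology E] [BorelSpace F] [SecondCountableTopology F]
  [SigmaFinite νX] [SigmaFinite νY] [IsProbabilityMeasure P] [IsMarkovKernel κ]

lemma smoothedPlan_mem_causalLaws (hN : RegularNormalizers p ε νX νY) :
    smoothedPlan p ε νX νY P κ ∈ causalLaws P.fst κ := by
  have := isMarkovKernel_smoothing hN.ne_zero_left hN.ne_top_left
  have := isMarkovKernel_smoothing hN.ne_zero_right hN.ne_top_right
  exact referencePlan_mem_causalLaws

lemma isFeasible_snd (hκ : P.fst.compProd κ = P) {γ : Measure ((X × Y) × (X × Y))}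
    (hγ : γ ∈ causalLaws P.fst κ) (h : entropicCost p ε νX νY P γ ≤ ((ρ ^ p : ℝ) : EReal)) :
    IsFeasible p ε ρ νX νY P γ.snd :=
  ⟨isProbabilityMeasure_snd_of_mem_causalLaws hγ,
    iInf₂_le_of_le γ ((mem_causalPlans_iff hκ).2 ⟨hγ, rfl⟩) h⟩

namespace RegularModel

lemma entropicCost_le (h : RegularModel p ε M νX νY P κ f Ψ) {γ : Measure ((X × Y) × (X × Y))}
    (hγ : γ ∈ causalLaws P.fst κ) {r : ℝ} (hr : 0 ≤ r)
    (hkl : klDiv γ (smoothedPlan p ε νX νY P κ) ≤ ENNReal.ofReal r) :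
    entropicCost p ε νX νY P γ
      ≤ ((ε * r - (realRadius p ε ρ νX νY P - ρ ^ p) : ℝ) : EReal) := by
  have hε := h.eps_pos
  rw [entropicCost_eq h.normalizers h.disintegration hε (hγ.1.trans h.disintegration)
    h.integrable_logNormalizerSum, realRadius, add_sub_cancel_left, EReal.coe_sub]
  refine EReal.sub_le_sub ?_ le_rfl
  calc ((ENNReal.ofReal ε * klDiv γ (smoothedPlan p ε νX νY P κ) : ℝ≥0∞) : EReal)
      ≤ ((ENNReal.ofReal (ε * r) : ℝ≥0∞) : EReal) := by
        rw [ENNReal.ofReal_mul hε.le]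
        exact_mod_cast mul_le_mul_right hkl _
    _ = ((ε * r : ℝ) : EReal) := by
        rw [EReal.coe_ennreal_ofReal, max_eq_left (by positivity)]

lemma isFeasible_of_klDiv_le (h : RegularModel p ε M νX νY P κ f Ψ)
    (hR : 0 ≤ realRadius p ε ρ νX νY P)
    {γ : Measure ((X × Y) × (X × Y))} (hγ : γ ∈ causalLaws P.fst κ)
    (hkl : klDiv γ (smoothedPlan p ε νX νY P κ)
      ≤ ENNReal.ofReal (realRadius p ε ρ νX νY P / ε)) :
    IsFeasible p ε ρ νX νY P γ.snd := by
  have hε := h.eps_pos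
  refine isFeasible_snd h.disintegration hγ
    ((h.entropicCost_le (ρ := ρ) hγ (div_nonneg hR hε.le) hkl).trans_eq ?_)
  congr 1
  field_simp
  ring

lemma isFeasible_smoothedPlan (h : RegularModel p ε M νX νY P κ f Ψ)
    (hR : 0 ≤ realRadius p ε ρ νX νY P) :
    IsFeasible p ε ρ νX νY P (smoothedPlan p ε νX νY P κ).snd := by
  have := isProbabilityMeasure_smoothedPlan (P := P) (κ := κ) h.normalizers
  refine h.isFeasible_of_klDiv_le hR (smoothedPlan_mem_causalLaws h.normalizers) ?_
  rw [klDiv_self]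
  exact zero_le

/-- The infimum over plans need not be attained, hence the slack `η`. Positivity of the enlarged
radius comes from nonnegativity of the relative entropy. -/
lemma exists_plan_of_isFeasible (h : RegularModel p ε M νX νY P κ f Ψ) {Q : Measure (X × Y)}
    (hQ : IsFeasible p ε ρ νX νY P Q) {η : ℝ} (hη : 0 < η) :
    0 < realRadius p ε ρ νX νY P + η ∧ ∃ γ ∈ causalLaws P.fst κ, γ.snd = Q ∧
      ENNReal.ofReal ε * klDiv γ (smoothedPlan p ε νX νY P κ)
        ≤ ENNReal.ofReal (realRadius p ε ρ νX νY P + η) := by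
  have hlt : csdPow p ε νX νY P Q < ((ρ ^ p + η : ℝ) : EReal) :=
    hQ.2.trans_lt (by exact_mod_cast lt_add_of_pos_right _ hη)
  simp only [csdPow, iInf_lt_iff] at hlt
  obtain ⟨γ, hγ, hcost⟩ := hlt
  obtain ⟨hγ1, hγ2⟩ := (mem_causalPlans_iff h.disintegration).1 hγ
  rw [entropicCost_eq h.normalizers h.disintegration h.eps_pos (hγ1.1.trans h.disintegration)
    h.integrable_logNormalizerSum, EReal.sub_lt_iff (Or.inl (EReal.coe_ne_bot _))
    (Or.inl (EReal.coe_ne_top _)), ← EReal.coe_add] at hcost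
  have e : ρ ^ p + η + ε * ∫ a, logNormalizerSum p ε νX νY a ∂P
      = realRadius p ε ρ νX νY P + η := by rw [realRadius]; ring
  rw [e] at hcost
  have hpos : 0 < realRadius p ε ρ νX νY P + η := by
    have := (EReal.coe_ennreal_nonneg _).trans_lt hcost
    exact_mod_cast this
  refine ⟨hpos, γ, hγ1, hγ2, ?_⟩
  rw [← EReal.coe_ennreal_le_coe_ennreal_iff, EReal.coe_ennreal_ofReal, max_eq_left hpos.le]
  exact hcost.le

lemma realRadius_nonneg_of_isFeasible (h : RegularModel p ε M νX νY P κ f Ψ)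
    {Q : Measure (X × Y)} (hQ : IsFeasible p ε ρ νX νY P Q) : 0 ≤ realRadius p ε ρ νX νY P :=
  le_of_forall_pos_lt_add fun _ hη => (h.exists_plan_of_isFeasible hQ hη).1

lemma lintegral_excessLoss_le (h : RegularModel p ε M νX νY P κ f Ψ) {Q : Measure (X × Y)}
    (hQ : IsFeasible p ε ρ νX νY P Q) {τ η : ℝ} (hτ : 0 < τ) (hη : 0 < η) :
    ∫⁻ b, excessLoss f Ψ M b.1 b.2 ∂Q
      ≤ ENNReal.ofReal (τ / ε * (realRadius p ε ρ νX νY P + η))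
        + excessDual p ε M νX νY P κ f Ψ τ := by
  have hε := h.eps_pos
  have := h.isMarkovKernel_left
  have := h.isMarkovKernel_right
  obtain ⟨_, γ, hγ, rfl, hkl⟩ := h.exists_plan_of_isFeasible hQ hη
  have hkt : klDiv γ (smoothedPlan p ε νX νY P κ) ≠ ⊤ := fun ht => by
    rw [ht, ENNReal.mul_top (by simpa using hε)] at hkl
    exact ENNReal.ofReal_ne_top (top_le_iff.1 hkl)
  rw [lintegral_snd_excessLoss h.measurable_map h.measurable_loss]
  refine (lintegral_le_mul_klDiv_add_softDual hτ
    (measurable_excessLoss h.measurable_map h.measurable_loss) hγ hkt).trans ?_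
  refine add_le_add_left ?_ _
  have e : ENNReal.ofReal τ = ENNReal.ofReal (τ / ε) * ENNReal.ofReal ε := by
    rw [← ENNReal.ofReal_mul (by positivity), div_mul_cancel₀ _ hε.ne']
  rw [e, mul_assoc, ENNReal.ofReal_mul (by positivity)]
  exact mul_le_mul_right hkl _

/-- Weak duality. -/
lemma primalValue_le_dualValue (h : RegularModel p ε M νX νY P κ f Ψ) :
    primalValue p ε ρ νX νY P f Ψ ≤ dualValue p ε ρ νX νY P κ f Ψ := by
  have hε := h.eps_pos
  refine iSup₂_le fun Q hQ => le_iInf₂ fun l hl => ?_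
  have hQp : IsProbabilityMeasure Q := hQ.1
  have hR := h.realRadius_nonneg_of_isFeasible hQ
  rw [expectedLoss_eq h.measurable_map h.measurable_loss h.le_loss]
  rcases (Set.mem_Ici.1 hl).eq_or_lt with rfl | hl
  · obtain ⟨C, hC, hD⟩ := h.exists_dualObjective_zero_eq (ρ := ρ)
    rw [hC]
    refine add_le_add ?_ le_rfl
    rw [EReal.coe_ennreal_le_coe_ennreal_iff]
    refine ENNReal.le_of_forall_pos_le_add fun δ hδ _ => ?_
    have hR1 : 0 < realRadius p ε ρ νX νY P + 1 := by linarith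
    have hδ' : (0 : ℝ) < δ := hδ
    -- At the zero multiplier, this temperature makes the entropy penalty exactly `δ`.
    have hτ : 0 < δ * ε / (realRadius p ε ρ νX νY P + 1) := by positivity
    refine (h.lintegral_excessLoss_le hQ hτ one_pos).trans ?_
    rw [add_comm]
    refine add_le_add (hD _ hτ) (le_of_eq ?_)
    rw [show δ * ε / (realRadius p ε ρ νX νY P + 1) / ε * (realRadius p ε ρ νX νY P + 1) = δ by
      field_simp, ENNReal.ofReal_coe_nnreal]
  · rw [h.dualObjective_eq hl, EReal.coe_add, add_comm (M : EReal), ← add_assoc]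
    refine add_le_add ?_ le_rfl
    have e : ((l * realRadius p ε ρ νX νY P : ℝ) : EReal)
        = ((ENNReal.ofReal (l * realRadius p ε ρ νX νY P) : ℝ≥0∞) : EReal) := by
      rw [EReal.coe_ennreal_ofReal, max_eq_left (by positivity)]
    rw [e, ← EReal.coe_ennreal_add, EReal.coe_ennreal_le_coe_ennreal_iff]
    refine ENNReal.le_of_forall_pos_le_add fun δ hδ _ => ?_
    have hδ' : (0 : ℝ) < δ := hδ
    refine (h.lintegral_excessLoss_le hQ (mul_pos hl hε) (div_pos hδ' hl)).trans ?_
    rw [add_comm, add_assoc]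
    refine add_le_add_right ?_ _
    rw [show l * ε / ε * (realRadius p ε ρ νX νY P + δ / l)
      = l * realRadius p ε ρ νX νY P + δ by field_simp]
    exact ENNReal.ofReal_add_le.trans (by rw [ENNReal.ofReal_coe_nnreal])

/-- `V` bounds the mean excess loss on the entropy ball; the abstract duality gives a temperature
`τ`, and `τ / ε` is the multiplier tested in the dual. -/
lemma dualValue_le_of_softDual_le (h : RegularModel p ε M νX νY P κ f Ψ)
    (hR : 0 < realRadius p ε ρ νX νY P) {V : ℝ} (hV0 : 0 ≤ V)
    (hV : ∀ γ ∈ causalLaws P.fst κ, klDiv γ (smoothedPlan p ε νX νY P κ)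
      ≤ ENNReal.ofReal (realRadius p ε ρ νX νY P / ε) →
        ∫⁻ ω, excessLoss f Ψ M ω.2.1 ω.2.2 ∂γ ≤ ENNReal.ofReal V) :
    dualValue p ε ρ νX νY P κ f Ψ ≤ ((V + M : ℝ) : EReal) := by
  have hε := h.eps_pos
  have := h.isMarkovKernel_left
  have := h.isMarkovKernel_right
  refine EReal.le_of_forall_lt_iff_le.1 fun z hz => ?_
  have hη : 0 < z - (V + M) := sub_pos.2 (by exact_mod_cast hz)
  obtain ⟨τ, hτ, hle⟩ := exists_softDual_le
    (measurable_excessLoss (M := M) h.measurable_map h.measurable_loss) (div_pos hR hε) hV0 hV hη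
  have hl : 0 < τ / ε := div_pos hτ hε
  refine (iInf₂_le (τ / ε) hl.le).trans ?_
  rw [h.dualObjective_eq hl, div_mul_cancel₀ _ hε.ne', EReal.coe_add, add_comm (M : EReal),
    ← add_assoc]
  have e : ((τ / ε * realRadius p ε ρ νX νY P : ℝ) : EReal)
      = ((ENNReal.ofReal (τ * (realRadius p ε ρ νX νY P / ε)) : ℝ≥0∞) : EReal) := by
    rw [EReal.coe_ennreal_ofReal, max_eq_left (by positivity)]
    congr 1
    ring
  rw [e, ← EReal.coe_ennreal_add, add_comm (excessDual _ _ _ _ _ _ _ _ _ _)]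
  calc _ ≤ ((ENNReal.ofReal (V + (z - (V + M))) : ℝ≥0∞) : EReal) + (M : EReal) :=
        add_le_add (by exact_mod_cast hle) le_rfl
    _ = (z : EReal) := by
        rw [EReal.coe_ennreal_ofReal, max_eq_left (by linarith), ← EReal.coe_add]
        congr 1
        ring

lemma expectedLoss_snd (h : RegularModel p ε M νX νY P κ f Ψ) {γ : Measure ((X × Y) × (X × Y))}
    (hγ : γ ∈ causalLaws P.fst κ) : expectedLoss f Ψ γ.snd
      = ((∫⁻ ω, excessLoss f Ψ M ω.2.1 ω.2.2 ∂γ : ℝ≥0∞) : EReal) + (M : EReal) := by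
  have := isProbabilityMeasure_snd_of_mem_causalLaws hγ
  rw [expectedLoss_eq h.measurable_map h.measurable_loss h.le_loss,
    lintegral_snd_excessLoss h.measurable_map h.measurable_loss]

lemma lintegral_add_le_primalValue (h : RegularModel p ε M νX νY P κ f Ψ)
    (hR : 0 ≤ realRadius p ε ρ νX νY P) {γ : Measure ((X × Y) × (X × Y))}
    (hγ : γ ∈ causalLaws P.fst κ) (hkl : klDiv γ (smoothedPlan p ε νX νY P κ)
      ≤ ENNReal.ofReal (realRadius p ε ρ νX νY P / ε)) :
    ((∫⁻ ω, excessLoss f Ψ M ω.2.1 ω.2.2 ∂γ : ℝ≥0∞) : EReal) + (M : EReal)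
      ≤ primalValue p ε ρ νX νY P f Ψ := by
  rw [← h.expectedLoss_snd hγ]
  exact le_iSup₂_of_le (f := fun Q (_ : Q ∈ {Q | IsFeasible p ε ρ νX νY P Q}) =>
    expectedLoss f Ψ Q) γ.snd (h.isFeasible_of_klDiv_le hR hγ hkl) le_rfl

lemma le_primalValue (h : RegularModel p ε M νX νY P κ f Ψ)
    (hR : 0 ≤ realRadius p ε ρ νX νY P) : (M : EReal) ≤ primalValue p ε ρ νX νY P f Ψ := by
  have := isProbabilityMeasure_smoothedPlan (P := P) (κ := κ) h.normalizers
  refine le_trans ?_ (h.lintegral_add_le_primalValue hR (smoothedPlan_mem_causalLaws h.normalizers)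
    (by rw [klDiv_self]; exact zero_le))
  exact le_add_of_nonneg_left (EReal.coe_ennreal_nonneg _)

/-- Strong duality for a positive adjusted radius. -/
lemma primalValue_eq_dualValue (h : RegularModel p ε M νX νY P κ f Ψ)
    (hR : 0 < realRadius p ε ρ νX νY P) :
    primalValue p ε ρ νX νY P f Ψ = dualValue p ε ρ νX νY P κ f Ψ := by
  refine le_antisymm h.primalValue_le_dualValue ?_
  have hMle := h.le_primalValue hR.le
  rcases eq_or_ne (primalValue p ε ρ νX νY P f Ψ) ⊤ with ht | ht
  · rw [ht]; exact le_top
  have hb : primalValue p ε ρ νX νY P f Ψ ≠ ⊥ := fun hb => by simp [hb] at hMle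
  have hv := EReal.coe_toReal ht hb
  set v := (primalValue p ε ρ νX νY P f Ψ).toReal
  rw [← hv] at hMle ⊢
  have hMv : M ≤ v := by exact_mod_cast hMle
  refine (h.dualValue_le_of_softDual_le hR (sub_nonneg.2 hMv) fun γ hγ hkl => ?_).trans_eq
    (by rw [sub_add_cancel])
  have h1 := h.lintegral_add_le_primalValue hR.le hγ hkl
  rw [← hv, ← EReal.le_sub_iff_add_le (by simp) (by simp), ← EReal.coe_sub] at h1
  rw [← EReal.coe_ennreal_le_coe_ennreal_iff, EReal.coe_ennreal_ofReal,
    max_eq_left (sub_nonneg.2 hMv)]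
  exact h1

/-- An infinite dual value makes the excess loss unbounded on the ball, hence infinite at a plan
within half the radius. Its second marginal is optimal, yet its discrepancy lies strictly below `ρ ^
p`. -/
lemma dualValue_lt_top_of_isBinding (h : RegularModel p ε M νX νY P κ f Ψ)
    (hR : 0 < realRadius p ε ρ νX νY P) (hbind : IsBinding p ε ρ νX νY P f Ψ) :
    dualValue p ε ρ νX νY P κ f Ψ < ⊤ := by
  have hε := h.eps_pos
  have := h.isMarkovKernel_left
  have := h.isMarkovKernel_right
  by_contra hnot
  have hd : dualValue p ε ρ νX νY P κ f Ψ = ⊤ := not_lt_top_iff.1 hnot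
  have hex : ∀ V : ℝ≥0∞, V ≠ ⊤ → ∃ γ ∈ causalLaws P.fst κ, klDiv γ (smoothedPlan p ε νX νY P κ)
      ≤ ENNReal.ofReal (realRadius p ε ρ νX νY P / ε) ∧
        V < ∫⁻ ω, excessLoss f Ψ M ω.2.1 ω.2.2 ∂γ := by
    intro V hV
    by_contra hne
    push Not at hne
    have h1 := h.dualValue_le_of_softDual_le hR (V := V.toReal) ENNReal.toReal_nonneg
      fun γ hγ hkl => by rw [ENNReal.ofReal_toReal hV]; exact hne γ hγ hkl
    rw [hd] at h1
    exact EReal.coe_ne_top _ (top_le_iff.1 h1)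
  obtain ⟨γ, hγ, hkl, htop⟩ := exists_lintegral_eq_top hex
  have hR2 : 0 < realRadius p ε ρ νX νY P / ε := div_pos hR hε
  have hfeas := h.isFeasible_of_klDiv_le hR.le hγ
    (hkl.trans (ENNReal.ofReal_le_ofReal (by linarith)))
  have hloss : expectedLoss f Ψ γ.snd = ⊤ := by
    rw [h.expectedLoss_snd hγ, htop, EReal.coe_ennreal_top, EReal.top_add_coe]
  have hcsd := hbind γ.snd hfeas (by rw [hloss, h.primalValue_eq_dualValue hR, hd])
  have hle : csdPow p ε νX νY P γ.snd ≤ entropicCost p ε νX νY P γ :=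
    iInf₂_le γ ((mem_causalPlans_iff h.disintegration).2 ⟨hγ, rfl⟩)
  have h2 := hle.trans (h.entropicCost_le (ρ := ρ) hγ (by linarith) hkl)
  rw [hcsd, EReal.coe_le_coe_iff] at h2
  have e : ε * (realRadius p ε ρ νX νY P / ε / 2) = realRadius p ε ρ νX νY P / 2 := by field_simp
  rw [e] at h2
  linarith

lemma dualValue_eq_top_of_not_lightTail (h : RegularModel p ε M νX νY P κ f Ψ)
    (hlt : ¬ LightTail p ε νX νY P f Ψ) : dualValue p ε ρ νX νY P κ f Ψ = ⊤ := by
  have hε := h.eps_pos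
  have hD : ∀ τ, 0 < τ → excessDual p ε M νX νY P κ f Ψ τ = ⊤ := fun τ hτ => by
    by_contra hne
    exact hlt (h.lightTail_of_excessDual_ne_top hτ hne)
  refine top_le_iff.1 (le_iInf₂ fun l hl => ?_)
  rcases (Set.mem_Ici.1 hl).eq_or_lt with rfl | hl
  · obtain ⟨C, hC, hDC⟩ := h.exists_dualObjective_zero_eq (ρ := ρ)
    have hCt : C = ⊤ := top_le_iff.1 ((hD 1 one_pos).symm.trans_le (hDC 1 one_pos))
    rw [hC, hCt, EReal.coe_ennreal_top, EReal.top_add_coe]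
  · rw [h.dualObjective_eq hl, hD _ (mul_pos hl hε), EReal.coe_ennreal_top, EReal.top_add_coe]

/-- Strong duality for a vanishing adjusted radius. -/
lemma primalValue_eq_dualValue_of_realRadius_eq_zero (h : RegularModel p ε M νX νY P κ f Ψ)
    (hR : realRadius p ε ρ νX νY P = 0) (hd : dualValue p ε ρ νX νY P κ f Ψ < ⊤) :
    primalValue p ε ρ νX νY P f Ψ = dualValue p ε ρ νX νY P κ f Ψ := by
  have hε := h.eps_pos
  have := h.isMarkovKernel_left
  have := h.isMarkovKernel_right
  have := isProbabilityMeasure_smoothedPlan (P := P) (κ := κ) h.normalizers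
  have hobj : ∀ τ, 0 < τ → dualValue p ε ρ νX νY P κ f Ψ
      ≤ (excessDual p ε M νX νY P κ f Ψ τ : EReal) + (M : EReal) := fun τ hτ => by
    refine (iInf₂_le (τ / ε) (div_pos hτ hε).le).trans_eq ?_
    rw [h.dualObjective_eq (div_pos hτ hε), hR, mul_zero, add_zero, div_mul_cancel₀ _ hε.ne']
  -- If the finite dual objective sits at multiplier zero, its bound `C` controls every temperature,
  -- in particular `1`.
  obtain ⟨τ, hτ, hfin⟩ : ∃ τ, 0 < τ ∧ excessDual p ε M νX νY P κ f Ψ τ ≠ ⊤ := by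
    simp only [dualValue, iInf_lt_iff] at hd
    obtain ⟨l, hl, hlt⟩ := hd
    rcases (Set.mem_Ici.1 hl).eq_or_lt with rfl | hl
    · obtain ⟨C, hC, hDC⟩ := h.exists_dualObjective_zero_eq (ρ := ρ)
      refine ⟨1, one_pos, fun ht => ?_⟩
      have hCt : C = ⊤ := top_le_iff.1 (ht.symm.trans_le (hDC 1 one_pos))
      rw [hC, hCt, EReal.coe_ennreal_top, EReal.top_add_coe] at hlt
      exact lt_irrefl _ hlt
    · refine ⟨l * ε, mul_pos hl hε, fun ht => ?_⟩
      rw [h.dualObjective_eq hl, ht, EReal.coe_ennreal_top, EReal.top_add_coe] at hlt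
      exact lt_irrefl _ hlt
  -- The smoothed plan has zero entropy, so its loss is a primal lower bound; it remains to bring
  -- the dual down to it by sending the temperature to infinity.
  refine le_antisymm h.primalValue_le_dualValue (le_trans ?_ (h.lintegral_add_le_primalValue hR.ge
    (smoothedPlan_mem_causalLaws h.normalizers) (by rw [klDiv_self]; exact zero_le)))
  have h1 : (dualValue p ε ρ νX νY P κ f Ψ - (M : EReal)).toENNReal
      ≤ ∫⁻ ω, excessLoss f Ψ M ω.2.1 ω.2.2 ∂(smoothedPlan p ε νX νY P κ) := by
    refine le_trans (le_iInf fun n : ℕ => ?_) (iInf_softDual_le hτ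
      (measurable_excessLoss (M := M) h.measurable_map h.measurable_loss) hfin)
    have h2 := hobj (τ + n) (by positivity)
    rw [← EReal.sub_le_iff_le_add (by simp) (by simp)] at h2
    exact (EReal.toENNReal_le_toENNReal h2).trans_eq EReal.toENNReal_coe
  have hMd : (M : EReal) ≤ dualValue p ε ρ νX νY P κ f Ψ :=
    (h.le_primalValue hR.ge).trans h.primalValue_le_dualValue
  rw [← coe_toENNReal_sub_add hMd]
  exact add_le_add (by exact_mod_cast h1) le_rfl

lemma exists_isFeasible_iff (h : RegularModel p ε M νX νY P κ f Ψ) :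
    (∃ Q, IsFeasible p ε ρ νX νY P Q) ↔ 0 ≤ realRadius p ε ρ νX νY P :=
  ⟨fun ⟨_, hQ⟩ => h.realRadius_nonneg_of_isFeasible hQ, fun hR => ⟨_, h.isFeasible_smoothedPlan hR⟩⟩

lemma adjustedRadius_eq (h : RegularModel p ε M νX νY P κ f Ψ) :
    adjustedRadius p ε ρ νX νY P = (realRadius p ε ρ νX νY P : EReal) := by
  have hX : Integrable (fun a : X × Y => logNormalizer p ε νX a.1) P :=
    h.integrable_left.comp_measurable measurable_fst
  have e1 : ∫ xh, logNormalizer p ε νX xh ∂P.fst = ∫ a, logNormalizer p ε νX a.1 ∂P := by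
    rw [Measure.fst, integral_map measurable_fst.aemeasurable
      measurable_logNormalizer.aestronglyMeasurable]
  rw [adjustedRadius, funext fun xh => log_normalizer_eq (h.normalizers.ne_zero_left xh)
      (h.normalizers.ne_top_left xh),
    funext fun a : X × Y => log_normalizer_eq (h.normalizers.ne_zero_right a.2)
      (h.normalizers.ne_top_right a.2), eexp_real h.integrable_left, eexp_real h.integrable_right,
    e1, realRadius]
  unfold logNormalizerSum
  rw [integral_add hX h.integrable_right]
  norm_cast
  ring

end RegularModel

end StrongDuality

/-! ### Infinite adjusted radius. -/

section Degenerate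

variable {E F : Type*} [NormedAddCommGroup E] [MeasurableSpace E] [NormedAddCommGroup F]
  [MeasurableSpace F] {X : Set E} {Y : Set F} {p ε ρ : ℝ} {νX : Measure X} {νY : Measure Y}
  {P : Measure (X × Y)}

lemma adjustedRadius_eq_bot (hε : 0 < ε)
    (h : eexp P.fst (fun xh => ENNReal.log (normalizer p ε νX xh)) = ⊥ ∨
      eexp P (fun a => ENNReal.log (normalizer p ε νY a.2)) = ⊥) :
    adjustedRadius p ε ρ νX νY P = ⊥ := by
  rcases h with h | h <;>
  simp only [adjustedRadius, h, EReal.coe_mul_bot_of_pos hε, EReal.add_bot, EReal.bot_add]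

lemma eexp_ne_bot {Ω : Type*} [MeasurableSpace Ω] {μ : Measure Ω} {g : Ω → EReal}
    (h : ∫⁻ ω, (-g ω).toENNReal ∂μ ≠ ⊤) : eexp μ g ≠ ⊥ := by
  intro hb
  by_cases ht : ∫⁻ ω, (g ω).toENNReal ∂μ = ⊤
  · rw [eexp_eq_top ht h] at hb
    exact top_ne_bot hb
  · rw [eexp] at hb
    lift ∫⁻ ω, (g ω).toENNReal ∂μ to NNReal using ht with a
    lift ∫⁻ ω, (-g ω).toENNReal ∂μ to NNReal using h with b
    exact EReal.coe_ne_bot ((a : ℝ) - b) hb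

lemma adjustedRadius_eq_top (hε : 0 < ε)
    (h1 : eexp P.fst (fun xh => ENNReal.log (normalizer p ε νX xh)) ≠ ⊥)
    (h2 : eexp P (fun a => ENNReal.log (normalizer p ε νY a.2)) ≠ ⊥)
    (h : eexp P.fst (fun xh => ENNReal.log (normalizer p ε νX xh)) = ⊤ ∨
      eexp P (fun a => ENNReal.log (normalizer p ε νY a.2)) = ⊤) :
    adjustedRadius p ε ρ νX νY P = ⊤ := by
  have hm : ∀ c : EReal, c ≠ ⊥ → (ε : EReal) * c ≠ ⊥ := fun c hc => by
    induction c with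
    | bot => exact absurd rfl hc
    | top => rw [EReal.coe_mul_top_of_pos hε]; exact top_ne_bot
    | coe r => rw [← EReal.coe_mul]; exact EReal.coe_ne_bot _
  rw [adjustedRadius]
  rcases h with h | h
  · rw [h, EReal.coe_mul_top_of_pos hε, EReal.coe_add_top, EReal.top_add_of_ne_bot (hm _ h2)]
  · rw [h, EReal.coe_mul_top_of_pos hε, EReal.add_top_of_ne_bot]
    rw [Ne, EReal.add_eq_bot_iff]
    exact not_or.2 ⟨EReal.coe_ne_bot _, hm _ h1⟩

lemma not_isFeasible_of_entropicCost_eq_top {Q : Measure (X × Y)}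
    (h : ∀ γ : Measure ((X × Y) × (X × Y)), γ.fst = P → entropicCost p ε νX νY P γ = ⊤) :
    ¬ IsFeasible p ε ρ νX νY P Q := fun hQ => by
  have h1 : csdPow p ε νX νY P Q = ⊤ :=
    top_le_iff.1 (le_iInf₂ fun γ hγ => (h γ hγ.1).ge)
  have h2 := hQ.2
  rw [h1, top_le_iff] at h2
  exact EReal.coe_ne_top _ h2

lemma adjustedRadius_eq_bot_of_measure_eq_zero [IsProbabilityMeasure P] (hε : 0 < ε)
    (h : νX = 0 ∨ νY = 0) : adjustedRadius p ε ρ νX νY P = ⊥ := by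
  refine adjustedRadius_eq_bot hε ?_
  rcases h with h | h
  · left
    exact eexp_eq_bot (by simp [h, normalizer])
  · right
    exact eexp_eq_bot (by simp [h, normalizer])

lemma not_isFeasible_of_measure_eq_zero [IsProbabilityMeasure P] [SFinite νX] [SFinite νY]
    (h : νX = 0 ∨ νY = 0) (Q : Measure (X × Y)) : ¬ IsFeasible p ε ρ νX νY P Q := by
  refine not_isFeasible_of_entropicCost_eq_top fun γ hγ => ?_
  have := isProbabilityMeasure_of_fst_eq hγ
  have h0 : P.prod (νX.prod νY) = 0 := by
    rcases h with h | h <;> simp [h]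
  rw [entropicCost, if_neg]
  rw [h0, Measure.absolutelyContinuous_zero_iff]
  exact IsProbabilityMeasure.ne_zero γ

variable [BorelSpace E] [SecondCountableTopology E] [BorelSpace F] [SecondCountableTopology F]
  [SigmaFinite νX] [SigmaFinite νY] [IsProbabilityMeasure P] {κ : Kernel X Y} [IsMarkovKernel κ]

/-- Well-definedness keeps infinite parts of one sign only. An infinite negative part makes every
plan cost `⊤`; an infinite positive part makes the smoothed plan cost `⊥`. -/
lemma integrable_logNormalizer_or (hN : RegularNormalizers p ε νX νY)
    (hκ : P.fst.compProd κ = P) (hε : 0 < ε) (hwd : RadiusWellDefined p ε νX νY P) :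
    (Integrable (logNormalizer p ε νX) P.fst ∧
      Integrable (fun a : X × Y => logNormalizer p ε νY a.2) P) ∨
    (adjustedRadius p ε ρ νX νY P = ⊥ ∧ ¬ ∃ Q, IsFeasible p ε ρ νX νY P Q) ∨
    (adjustedRadius p ε ρ νX νY P = ⊤ ∧ ∃ Q, IsFeasible p ε ρ νX νY P Q) := by
  have hlX := measurable_logNormalizer (p := p) (ε := ε) (ν := νX)
  have hlY := measurable_logNormalizer (p := p) (ε := ε) (ν := νY)
  have hlY2 : Measurable fun a : X × Y => logNormalizer p ε νY a.2 := hlY.comp measurable_snd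
  have hlX1 : Measurable fun a : X × Y => logNormalizer p ε νX a.1 := hlX.comp measurable_fst
  have eX : ∀ xh, ENNReal.log (normalizer p ε νX xh) = (logNormalizer p ε νX xh : EReal) :=
    fun xh => log_normalizer_eq (hN.ne_zero_left xh) (hN.ne_top_left xh)
  have eY : ∀ yh, ENNReal.log (normalizer p ε νY yh) = (logNormalizer p ε νY yh : EReal) :=
    fun yh => log_normalizer_eq (hN.ne_zero_right yh) (hN.ne_top_right yh)
  have hfst : ∀ g : X → ℝ≥0∞, Measurable g → ∫⁻ xh, g xh ∂P.fst = ∫⁻ a, g a.1 ∂P :=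
    fun g hg => lintegral_map hg measurable_fst
  by_cases hint : Integrable (logNormalizer p ε νX) P.fst ∧
      Integrable (fun a : X × Y => logNormalizer p ε νY a.2) P
  · exact Or.inl hint
  right
  simp only [RadiusWellDefined, eX, eY, ← EReal.coe_neg, EReal.real_coe_toENNReal,
    lt_top_iff_ne_top] at hwd
  rcases hwd with ⟨h1, h2⟩ | ⟨h1, h2⟩
  · left
    have h3 : ∫⁻ xh, ENNReal.ofReal (-logNormalizer p ε νX xh) ∂P.fst = ⊤ ∨
        ∫⁻ a, ENNReal.ofReal (-logNormalizer p ε νY a.2) ∂P = ⊤ := by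
      by_contra hne
      push Not at hne
      exact hint ⟨integrable_of_lintegral_ne_top hlX h1 hne.1,
        integrable_of_lintegral_ne_top hlY2 h2 hne.2⟩
    refine ⟨adjustedRadius_eq_bot hε (h3.imp (fun h => eexp_eq_bot ?_) fun h => eexp_eq_bot ?_), ?_⟩
    · simpa only [eX, ← EReal.coe_neg, EReal.real_coe_toENNReal] using h
    · simpa only [eY, ← EReal.coe_neg, EReal.real_coe_toENNReal] using h
    rintro ⟨Q, hQ⟩
    refine not_isFeasible_of_entropicCost_eq_top (fun γ hγ =>
      entropicCost_eq_top hN hκ hε hγ ?_) hQ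
    -- Each log-normalizer is the sum minus the other one, whose positive part is finite, so a
    -- finite negative part of the sum would contradict `h3`.
    by_contra hs
    rw [hfst _ hlX.ennreal_ofReal] at h1
    rw [hfst (fun xh => ENNReal.ofReal (-logNormalizer p ε νX xh)) hlX.neg.ennreal_ofReal] at h3
    rcases h3 with h3 | h3
    · exact lintegral_ofReal_ne_top_of_le_add (f := fun a : X × Y => -logNormalizer p ε νX a.1)
        (measurable_logNormalizerSum (p := p) (ε := ε) (νX := νX) (νY := νY)).neg
        (h := fun a => logNormalizer p ε νY a.2) (fun a => by simp [logNormalizerSum]) hs h2 h3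
    · exact lintegral_ofReal_ne_top_of_le_add (f := fun a : X × Y => -logNormalizer p ε νY a.2)
        (measurable_logNormalizerSum (p := p) (ε := ε) (νX := νX) (νY := νY)).neg
        (h := fun a => logNormalizer p ε νX a.1) (fun a => by simp [logNormalizerSum]) hs h1 h3
  · right
    have h3 : ∫⁻ xh, ENNReal.ofReal (logNormalizer p ε νX xh) ∂P.fst = ⊤ ∨
        ∫⁻ a, ENNReal.ofReal (logNormalizer p ε νY a.2) ∂P = ⊤ := by
      by_contra hne
      push Not at hne
      exact hint ⟨integrable_of_lintegral_ne_top hlX hne.1 h1,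
        integrable_of_lintegral_ne_top hlY2 hne.2 h2⟩
    have n1 : ∫⁻ xh, (-ENNReal.log (normalizer p ε νX xh)).toENNReal ∂P.fst ≠ ⊤ := by
      simpa only [eX, ← EReal.coe_neg, EReal.real_coe_toENNReal] using h1
    have n2 : ∫⁻ a, (-ENNReal.log (normalizer p ε νY a.2)).toENNReal ∂P ≠ ⊤ := by
      simpa only [eY, ← EReal.coe_neg, EReal.real_coe_toENNReal] using h2
    refine ⟨adjustedRadius_eq_top hε (eexp_ne_bot n1) (eexp_ne_bot n2)
      (h3.imp (fun h => eexp_eq_top ?_ n1) fun h => eexp_eq_top ?_ n2), ?_⟩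
    · simpa only [eX, EReal.real_coe_toENNReal] using h
    · simpa only [eY, EReal.real_coe_toENNReal] using h
    rw [hfst (fun xh => ENNReal.ofReal (-logNormalizer p ε νX xh)) hlX.neg.ennreal_ofReal] at h1
    rw [hfst _ hlX.ennreal_ofReal] at h3
    have hmem := smoothedPlan_mem_causalLaws (P := P) (κ := κ) hN
    have hsn : ∫⁻ a, ENNReal.ofReal (-logNormalizerSum p ε νX νY a) ∂P ≠ ⊤ :=
      lintegral_ofReal_ne_top_of_le_add
        (g := fun a : X × Y => -logNormalizer p ε νX a.1) hlX1.neg (h := fun a => -logNormalizer p ε νY a.2)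
        (fun a => by simp only [logNormalizerSum]; linarith) h1 h2
    have hsp : ∫⁻ a, ENNReal.ofReal (logNormalizerSum p ε νX νY a) ∂P = ⊤ := by
      by_contra hs
      rcases h3 with h3 | h3
      · exact lintegral_ofReal_ne_top_of_le_add (f := fun a : X × Y => logNormalizer p ε νX a.1)
          measurable_logNormalizerSum
          (h := fun a => -logNormalizer p ε νY a.2) (fun a => by simp [logNormalizerSum]) hs h2 h3
      · exact lintegral_ofReal_ne_top_of_le_add (f := fun a : X × Y => logNormalizer p ε νY a.2)
          measurable_logNormalizerSum
          (h := fun a => -logNormalizer p ε νX a.1) (fun a => by simp [logNormalizerSum]) hs h1 h3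
    exact ⟨_, isFeasible_snd hκ hmem (by
      rw [entropicCost_smoothedPlan_eq_bot hN hκ hε (hmem.1.trans hκ) hsp hsn]; exact bot_le)⟩

end Degenerate

end CausalSDRO

/-! ### Assembly of the cases. -/

theorem theorem1
    {E F G : Type*}
    [NormedAddCommGroup E] [NormedSpace ℝ E] [FiniteDimensional ℝ E]
    [MeasurableSpace E] [BorelSpace E]
    [NormedAddCommGroup F] [NormedSpace ℝ F] [FiniteDimensional ℝ F]
    [MeasurableSpace F] [BorelSpace F]
    [NormedAddCommGroup G] [NormedSpace ℝ G] [FiniteDimensional ℝ G]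
    [MeasurableSpace G] [BorelSpace G]
    (X : Set E) (Y : Set F) (Z : Set G)
    (hX : MeasurableSet X) (hY : MeasurableSet Y) (hZ : MeasurableSet Z)
    (p ε ρ : ℝ) (hp : 1 ≤ p) (hε : 0 < ε) (hρ : 0 ≤ ρ)
    (νX : Measure X) (νY : Measure Y)
    (hνX : ∀ δ : ℝ, 0 < δ →
      ∫⁻ u : X, ENNReal.ofReal (Real.exp (-δ * ‖(u : E)‖ ^ p)) ∂νX < ⊤)
    (hνY : ∀ δ : ℝ, 0 < δ →
      ∫⁻ u : Y, ENNReal.ofReal (Real.exp (-δ * ‖(u : F)‖ ^ p)) ∂νY < ⊤)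
    (P : Measure (X × Y)) [IsProbabilityMeasure P]
    (κ : Kernel X Y) [IsMarkovKernel κ] (hκ : P.fst.compProd κ = P)
    (f : X → Z) (hf : Measurable f)
    (Ψ : Z × Y → EReal) (hΨ : Measurable Ψ) (hΨ_below : ∃ M : ℝ, ∀ w, (M : EReal) ≤ Ψ w)
    (hwd : CausalSDRO.RadiusWellDefined p ε νX νY P) :
    ((∃ Q, CausalSDRO.IsFeasible p ε ρ νX νY P Q) ↔
        0 ≤ CausalSDRO.adjustedRadius p ε ρ νX νY P) ∧
    (0 < CausalSDRO.adjustedRadius p ε ρ νX νY P →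
      CausalSDRO.adjustedRadius p ε ρ νX νY P < ⊤ →
        CausalSDRO.primalValue p ε ρ νX νY P f Ψ
            = CausalSDRO.dualValue p ε ρ νX νY P κ f Ψ ∧
        (CausalSDRO.LightTail p ε νX νY P f Ψ →
          CausalSDRO.IsBinding p ε ρ νX νY P f Ψ →
            CausalSDRO.primalValue p ε ρ νX νY P f Ψ
                = CausalSDRO.dualValue p ε ρ νX νY P κ f Ψ ∧
            CausalSDRO.dualValue p ε ρ νX νY P κ f Ψ < ⊤) ∧
        (¬ CausalSDRO.LightTail p ε νX νY P f Ψ →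
          CausalSDRO.primalValue p ε ρ νX νY P f Ψ = ⊤ ∧
          CausalSDRO.dualValue p ε ρ νX νY P κ f Ψ = ⊤)) ∧
    (CausalSDRO.adjustedRadius p ε ρ νX νY P = 0 →
      (CausalSDRO.dualValue p ε ρ νX νY P κ f Ψ < ⊤ →
        CausalSDRO.primalValue p ε ρ νX νY P f Ψ
            = CausalSDRO.dualValue p ε ρ νX νY P κ f Ψ) ∧
      (¬ CausalSDRO.LightTail p ε νX νY P f Ψ →
        CausalSDRO.dualValue p ε ρ νX νY P κ f Ψ = ⊤)) := by
  obtain ⟨M, hM⟩ := hΨ_below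
  -- Properness supplies the second countability needed for joint measurability of the kernels.
  have := FiniteDimensional.proper_real E
  have := FiniteDimensional.proper_real F
  have := CausalSDRO.sigmaFinite_of_lintegral_exp_lt_top hνX
  have := CausalSDRO.sigmaFinite_of_lintegral_exp_lt_top hνY
  have key : (CausalSDRO.RegularModel p ε M νX νY P κ f Ψ) ∨
      (CausalSDRO.adjustedRadius p ε ρ νX νY P = ⊥ ∧
        ¬ ∃ Q, CausalSDRO.IsFeasible p ε ρ νX νY P Q) ∨
      (CausalSDRO.adjustedRadius p ε ρ νX νY P = ⊤ ∧
        ∃ Q, CausalSDRO.IsFeasible p ε ρ νX νY P Q) := by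
    by_cases h0 : νX = 0 ∨ νY = 0
    · exact Or.inr (Or.inl ⟨CausalSDRO.adjustedRadius_eq_bot_of_measure_eq_zero hε h0,
        fun ⟨Q, hQ⟩ => CausalSDRO.not_isFeasible_of_measure_eq_zero h0 Q hQ⟩)
    · push Not at h0
      have hN : CausalSDRO.RegularNormalizers p ε νX νY :=
        ⟨CausalSDRO.normalizer_ne_zero h0.1, CausalSDRO.normalizer_ne_top hp hε hνX,
          CausalSDRO.normalizer_ne_zero h0.2, CausalSDRO.normalizer_ne_top hp hε hνY⟩
      exact (CausalSDRO.integrable_logNormalizer_or hN hκ hε hwd).imp_left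
        fun h => ⟨hN, hε, hκ, hf, hΨ, hM, h.1, h.2⟩
  -- When the radius is infinite only the feasibility statement has content, since the other two
  -- presuppose a finite radius.
  rcases key with h | ⟨hr, hne⟩ | ⟨hr, hex⟩
  · rw [h.adjustedRadius_eq, h.exists_isFeasible_iff]
    refine ⟨by norm_cast, fun hpos _ => ?_, fun h0 => ?_⟩
    · have hR : 0 < CausalSDRO.realRadius p ε ρ νX νY P := by exact_mod_cast hpos
      have heq := h.primalValue_eq_dualValue hR
      refine ⟨heq, fun _ hb => ⟨heq, h.dualValue_lt_top_of_isBinding hR hb⟩, fun hlt => ?_⟩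
      have hd := h.dualValue_eq_top_of_not_lightTail (ρ := ρ) hlt
      exact ⟨heq.trans hd, hd⟩
    · have hR : CausalSDRO.realRadius p ε ρ νX νY P = 0 := by exact_mod_cast h0
      exact ⟨h.primalValue_eq_dualValue_of_realRadius_eq_zero hR,
        h.dualValue_eq_top_of_not_lightTail⟩
  · rw [hr]
    exact ⟨iff_of_false hne (by simp), fun hpos => absurd hpos (by simp),
      fun h0 => absurd h0 (by simp)⟩
  · rw [hr]
    exact ⟨iff_of_true hex le_top, fun _ hlt => absurd hlt (lt_irrefl _),
      fun h0 => absurd h0 (by simp)⟩
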